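/- There is an absolute constant $C>0$ such that the following holds. **Setting.** Let $X=\{x_1,\dots,x_n\}\subset\{1,\dots,\Delta\}^d$ be a set of $n\ge 2$ distinct points with the $\ell_p$ metric $d$, $p\in[1,\infty]$. Put $W=\sum_{i,j}d(x_i,x_j)$ and $q_i=\frac1W\sum_j d(x_i,x_j)$. For $z\in\{0,1\}^{n\times\{0,1\}}$ let $f(z)=\frac12\sum_{i,j}d(x_i,x_j)(z_{i,0}z_{j,0}+z_{i,1}z_{j,1})$; a row $(1,0)$ means the 0-side and $(0,1)$ the 1-side. Let $D,\gamma\in\mathbb R$, $\varepsilon,\varepsilon_{\rm pr}\in(0,1)$ and $t_0,t_e\in\mathbb N$ satisfy $$t_e\ge\frac{nD}{\varepsilon},\qquad \gamma\ge\frac{(D\ln t_e+1)^2}{\varepsilon^2},\qquad t_0\ge\max\Big\{\frac{\sqrt\gamma\,D}{\varepsilon},\frac1\varepsilon\Big\},\qquad \varepsilon_{\rm pr}\le\frac{\varepsilon}{\ln t_e}.$$ **Weights.** Let $w(x_1),\dots,w(x_n)$ be the output of a successful $D$-approximate weight sketch, i.e. $q_i\le w(x_i)\le D\,q_i$ for all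 $i$, and let $w_i=w(x_i)/(2D)$. **Sampler.** For every $s$ and every $1\le j\le s$ let $\mathcal G_{s,j}$ be the law of a pair $(y^*,p^*)$ with $y^*\in X\cup\{\bot\}$ and $p^*\in[0,1]$ such that, writing $p(x)=\Pr[y^*=x]$, one has $p(x_i)\ge q_i/D$ for all $i$, and almost surely $p(y^*)\le p^*\le(1+\varepsilon_{\rm pr})p(y^*)$ whenever $y^*\ne\bot$. **Correlated timeline-mask.** Let $\gamma^t=1$ for $t\le t_0$ and $\gamma^t=\min\{\gamma/t,1\}$ for $t>t_0$. Draw one mask $K\in\{0,1\}^{t_e}$ with independent entries $K_t\sim\mathrm{Ber}(\gamma^t)$ and let $s$ be its number of ones. Given $K$, draw independent samples, the $j$-th from $\mathcal G_{s,j}$; call the $j$-th one $(y^*_t,p^*_t)$, where $t$ is the $j$-th time with $K_t=1$. Then generate $A\in\{0,1\}^{n\times t_e}$ column by column, for $t=1,\dots,t_e$, with fresh randomness: * if $K_t=0$: independently for every $i$, $A_{i,t}\sim\mathrm{Ber}(\min\{w_i,1/t\})$ if $A_{i,\ell}=0$ for all $\ell<t$, and $A_{i,t}\sim\mathrm{Ber}(w_i)$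 otherwise; * if $K_t=1$: $A_{i,t}=0$ for all $i$ with $x_i\ne y^*_t$; if $y^*_t=x_i$, then $A_{i,t}\sim\mathrm{Ber}(\min\{1/(t\,p^*_t),1\})$ if $A_{i,\ell}=0$ for all $\ell<t$, and $A_{i,t}=1$ otherwise. The activation time $t_i$ of $x_i$ is the smallest $t$ with $A_{i,t}=1$, if there is one. **Greedy assignment.** Let $S=\{i: t_i\le t_0\}$ and $m=|S|$. A seed is a string $\sigma\in\{0,1\}^m$. It determines a cut $z(\sigma)$, computed in order of activation time: * a point $x_i$ with $i\in S$ goes to the side $\sigma_k$, where $x_i$ is the $k$-th point of $\{x_j:j\in S\}$ in lexicographic order; * a point $x_i$ with $t_0<t_i\le t_e$ goes to the 1-side if $C_0>C_1$ and to the 0-side otherwise, where $$C_b=\sum_{\substack{(j,\ell):\ \ell<t_i\\ A_{j,\ell}K_\ell=1}}\frac{d(x_i,x_j)}{\rho_j^\ell\,\gamma^\ell}\,z(\sigma)_{j,b},\qquad \rho_j^\ell=\begin{cases}\min\{p^*_\ell,1/\ell\}&\ell=t_j,\\ p^*_\ell&\ell>t_j;\end{cases}$$ * a point that is never activated goes to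 the 0-side. **Conclusion.** $$\mathbb E\Big[\min_{\sigma\in\{0,1\}^m}f(z(\sigma))\Big]\le\min_{\substack{z\in\{0,1\}^{n\times\{0,1\}}\\ z_i\ne(0,0)\ \forall i}}f(z)+C\,\varepsilon\sum_{i=1}^n\sum_{j=1}^n d(x_i,x_j).$$ -/

import Mathlib

open MeasureTheory
open scoped ENNReal

noncomputable section

namespace CorrelatedMaxCut

/-- The `ℓ_p` distance between two points with natural-number coordinates. -/
def lpDist (p : ℝ≥0∞) {d : ℕ} (u v : Fin d → ℕ) : ℝ :=
  dist (WithLp.toLp p (fun c => (u c : ℝ)) : PiLp p (fun _ : Fin d => ℝ))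
    (WithLp.toLp p (fun c => (v c : ℝ)))

/-- The sum of all pairwise distances (over ordered pairs). -/
def totalDist {n : ℕ} (δ : Fin n → Fin n → ℝ) : ℝ := ∑ i, ∑ j, δ i j

/-- The share of point `i` in the sum of all pairwise distances. -/
def distShare {n : ℕ} (δ : Fin n → Fin n → ℝ) (i : Fin n) : ℝ :=
  (∑ j, δ i j) / totalDist δ

/-- The internal cost `f(z)` of an `n × {0,1}` Boolean matrix `z`: row `(1,0)` means the `0`-side,
`(0,1)` the `1`-side, `(0,0)` unassigned. -/
def internalCost {n : ℕ} (δ : Fin n → Fin n → ℝ) (z : Fin n → Fin 2 → Bool) : ℝ :=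
  (1 / 2) * ∑ i, ∑ j, δ i j *
    (((z i 0).toNat : ℝ) * ((z j 0).toNat : ℝ) + ((z i 1).toNat : ℝ) * ((z j 1).toNat : ℝ))

/-- The output `wt` of a successful `D`-approximate weight sketch. -/
def IsWeightSketch {n : ℕ} (δ : Fin n → Fin n → ℝ) (D : ℝ) (wt : Fin n → ℝ) : Prop :=
  ∀ i, distShare δ i ≤ wt i ∧ wt i ≤ D * distShare δ i

/-- All subsets of the finite set of possible sampled points (`none` is the failure symbol `⊥`)
are measurable. -/
instance instMeasurableSpaceOptionFin (n : ℕ) : MeasurableSpace (Option (Fin n)) := ⊤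

/-- The probability that the point returned by a sampler with law `G` is `i`. -/
def sampleProb {n : ℕ} (G : Measure (Option (Fin n) × ℝ)) (i : Fin n) : ℝ :=
  G.real {s | s.1 = some i}

/-- `G` is the joint law of one geometric sample `(y*, p*)`: a random point `y*` or `⊥`, with
`D`-metric-compatible probabilities, and a number `p* ∈ [0,1]` that overestimates the probability
of the sampled point by at most a factor `1 + εpr`. -/
structure IsGeometricSampler {n : ℕ} (δ : Fin n → Fin n → ℝ) (D εpr : ℝ)
    (G : Measure (Option (Fin n) × ℝ)) : Prop where
  isProbabilityMeasure : IsProbabilityMeasure G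
  compatible : ∀ i, 1 / D * distShare δ i ≤ sampleProb G i
  mem_unit : ∀ᵐ s ∂G, 0 ≤ s.2 ∧ s.2 ≤ 1
  approx : ∀ᵐ s ∂G, ∀ i, s.1 = some i →
    sampleProb G i ≤ s.2 ∧ s.2 ≤ (1 + εpr) * sampleProb G i

/-- The probability that a Bernoulli variable of parameter `q` equals `b`. -/
def bern (q : ℝ) (b : Bool) : ℝ := if b then q else 1 - q

/-! Times `1, …, te` are indexed by `r : Fin te`; the index `r` stands for the time `r + 1`. -/

/-- The time `r + 1 ∈ {1, …, te}` with index `r`. -/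
def time {te : ℕ} (r : Fin te) : ℕ := (r : ℕ) + 1

/-- The keeping probability `γ^t`. -/
def keepProb (t0 : ℕ) (γ : ℝ) (t : ℕ) : ℝ := if t ≤ t0 then 1 else min (γ / t) 1

/-- The probability of a mask, whose entries are independent. -/
def maskProb (t0 : ℕ) (γ : ℝ) {te : ℕ} (K : Fin te → Bool) : ℝ :=
  ∏ r, bern (keepProb t0 γ (time r)) (K r)

/-- The number `s` of kept times. -/
def numKept {te : ℕ} (K : Fin te → Bool) : ℕ := (Finset.univ.filter fun r => K r = true).card

/-- For a kept time `r`, the number `j ∈ {1, …, s}` such that `r` is the `j`-th kept time. -/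
def keptRank {te : ℕ} (K : Fin te → Bool) (r : Fin te) : ℕ :=
  (Finset.univ.filter fun r' => K r' = true ∧ r' ≤ r).card

/-- One geometric sample `(y*_t, p*_t)` for every kept time `t`. -/
abbrev Samples (n : ℕ) {te : ℕ} (K : Fin te → Bool) : Type :=
  {r : Fin te // K r = true} → Option (Fin n) × ℝ

/-- The law of the samples given the mask. The samples are independent; `G s j` is the law of the
`j`-th one of `s` samples, and the `j`-th sample is used at the `j`-th kept time. -/
def samplesLaw {n te : ℕ} (G : ℕ → ℕ → Measure (Option (Fin n) × ℝ)) (K : Fin te → Bool) :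
    Measure (Samples n K) :=
  Measure.pi fun r => G (numKept K) (keptRank K r.1)

/-- In the timelines `A` (`A r i` is the entry of point `i` at time `r`), point `i` has been
activated strictly before time `r`. -/
def ActivatedBefore {n te : ℕ} (A : Fin te → Fin n → Bool) (r : Fin te) (i : Fin n) : Prop :=
  ∃ r' < r, A r' i = true

open Classical in
/-- The conditional probability that the timeline of point `i` has entry `1` at time `r`, given the
mask, the samples and the timelines before `r`. -/
def entryProb {n te : ℕ} (w : Fin n → ℝ) (K : Fin te → Bool) (v : Samples n K)
    (A : Fin te → Fin n → Bool) (r : Fin te) (i : Fin n) : ℝ :=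
  if h : K r = true then
    if (v ⟨r, h⟩).1 = some i then
      if ActivatedBefore A r i then 1 else min (1 / ((time r : ℝ) * (v ⟨r, h⟩).2)) 1
    else 0
  else
    if ActivatedBefore A r i then w i else min (w i) (1 / (time r : ℝ))

/-- The conditional probability of the timelines `A` given the mask and the samples: given the
past, the entries at time `r` are independent Bernoulli variables. -/
def timelinesProb {n te : ℕ} (w : Fin n → ℝ) (K : Fin te → Bool) (v : Samples n K)
    (A : Fin te → Fin n → Bool) : ℝ :=
  ∏ r, ∏ i, bern (entryProb w K v A r i) (A r i)

/-- The expectation of `F` over a correlated timeline-mask: draw the mask, then the geometric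
samples, then the timelines. -/
def corrExpectation {n te : ℕ} (t0 : ℕ) (γ : ℝ) (w : Fin n → ℝ)
    (G : ℕ → ℕ → Measure (Option (Fin n) × ℝ))
    (F : (K : Fin te → Bool) → Samples n K → (Fin te → Fin n → Bool) → ℝ) : ℝ :=
  ∑ K, maskProb t0 γ K *
    ∫ v, ∑ A, timelinesProb w K v A * F K v A ∂(samplesLaw G K)

/-- The activation time of point `i`, in `{1, …, te}`; it is used only if `i` is activated. -/
def activationTime {n te : ℕ} (A : Fin te → Fin n → Bool) (i : Fin n) : ℕ :=
  sInf {t | ∃ r, time r = t ∧ A r i = true}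

theorem activationTime_le {n te : ℕ} {A : Fin te → Fin n → Bool} {i : Fin n} {r : Fin te}
    (h : A r i = true) : activationTime A i ≤ time r :=
  Nat.sInf_le ⟨r, rfl, h⟩

open Classical in
/-- The set `S^{t0}` of points activated by time `t0`. -/
def seedSet {n te : ℕ} (t0 : ℕ) (A : Fin te → Fin n → Bool) : Finset (Fin n) :=
  Finset.univ.filter fun i => ∃ r, time r ≤ t0 ∧ A r i = true

/-- A seed: a bit string whose length is the number of points activated by time `t0`. -/
abbrev Seed {n te : ℕ} (t0 : ℕ) (A : Fin te → Fin n → Bool) : Type :=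
  Fin (seedSet t0 A).card → Bool

open Classical in
/-- The (zero-based) position of the point `x i` in the lexicographic order of the points indexed
by `S`. -/
def lexRank {n d : ℕ} (x : Fin n → Fin d → ℕ) (S : Finset (Fin n)) (i : Fin n) : ℕ :=
  (S.filter fun j => toLex (x j) < toLex (x i)).card

open Classical in
theorem lexRank_lt {n d : ℕ} (x : Fin n → Fin d → ℕ) {S : Finset (Fin n)} {i : Fin n}
    (hi : i ∈ S) : lexRank x S i < S.card :=
  Finset.card_lt_card (Finset.filter_ssubset.2 ⟨i, hi, lt_irrefl _⟩)

open Classical in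
/-- The side that a seed gives to a point activated by time `t0`. -/
def seedSide {n d te : ℕ} (x : Fin n → Fin d → ℕ) (t0 : ℕ) (A : Fin te → Fin n → Bool)
    (σ : Seed t0 A) (i : Fin n) : Bool :=
  if h : i ∈ seedSet t0 A then σ ⟨lexRank x (seedSet t0 A) i, lexRank_lt x h⟩ else false

open Classical in
/-- The estimate `ρ_j^ℓ` of the probability that point `j` is activated at the kept time `ℓ`. -/
def rho {n te : ℕ} (K : Fin te → Bool) (v : Samples n K) (A : Fin te → Fin n → Bool)
    (j : Fin n) (l : {r : Fin te // K r = true}) : ℝ :=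
  if time l.1 = activationTime A j then min (v l).2 (1 / (time l.1 : ℝ)) else (v l).2

open Classical in
/-- The assignment rule for point `i` with activation time `t` (`false` is the `0`-side and `true`
the `1`-side): the seed decides if `t ≤ t0`. Otherwise the two estimated contributions `C_0`, `C_1`
are sums over all pairs `(j, ℓ)` such that point `j` is activated and kept at time `ℓ < t`, and
point `i` goes to the `1`-side if and only if `C_0 > C_1`. -/
def assign {n d te : ℕ} (x : Fin n → Fin d → ℕ) (δ : Fin n → Fin n → ℝ) (t0 : ℕ) (γ : ℝ)
    (K : Fin te → Bool) (v : Samples n K) (A : Fin te → Fin n → Bool) (σ : Seed t0 A)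
    (t : ℕ) (i : Fin n) : Bool :=
  if t ≤ t0 then seedSide x t0 A σ i
  else
    let C : Bool → ℝ := fun b =>
      ∑ j, ∑ l : {r : Fin te // K r = true},
        if _h : A l.1 j = true ∧ time l.1 < t then
          δ i j / (rho K v A j l * keepProb t0 γ (time l.1)) *
            (if assign x δ t0 γ K v A σ (activationTime A j) j = b then 1 else 0)
        else 0
    decide (C true < C false)
termination_by t
decreasing_by exact lt_of_le_of_lt (activationTime_le _h.1) _h.2

/-- The row `(1,0)` or `(0,1)` that encodes a side. -/
def sideRow (b : Bool) : Fin 2 → Bool := if b then ![false, true] else ![true, false]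

open Classical in
/-- The cut `z(σ)`; points that are never activated go to the `0`-side. -/
def cutOfSeed {n d te : ℕ} (x : Fin n → Fin d → ℕ) (δ : Fin n → Fin n → ℝ) (t0 : ℕ) (γ : ℝ)
    (K : Fin te → Bool) (v : Samples n K) (A : Fin te → Fin n → Bool) (σ : Seed t0 A) :
    Fin n → Fin 2 → Bool := fun i =>
  if ∃ r, A r i = true then sideRow (assign x δ t0 γ K v A σ (activationTime A i) i)
  else sideRow false

/-- The cost of the cut of the best seed (a minimum over finitely many seeds). -/
def bestSeedCost {n d te : ℕ} (x : Fin n → Fin d → ℕ) (δ : Fin n → Fin n → ℝ) (t0 : ℕ) (γ : ℝ)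
    (K : Fin te → Bool) (v : Samples n K) (A : Fin te → Fin n → Bool) : ℝ :=
  ⨅ σ : Seed t0 A, internalCost δ (cutOfSeed x δ t0 γ K v A σ)

/-- The minimum of the internal cost over all matrices without a row `(0,0)`. -/
def minCost {n : ℕ} (δ : Fin n → Fin n → ℝ) : ℝ :=
  ⨅ z : {z : Fin n → Fin 2 → Bool // ∀ i, z i ≠ ![false, false]}, internalCost δ z.1

end CorrelatedMaxCut

end

noncomputable section

namespace CorrelatedMaxCut

/-! ### Finite metrics and the cost of a cut -/

/-! With sides encoded as signs, the cost of a cut is `(W + quad) / 4`, where `W` is the sum of all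
distances, so only the quadratic form has to be controlled. Start from the signs of an optimal cut
and follow a fictitious fractional cut `y` in `[-1,1]^n`. Up to time `t0` it does not move. After
that, in step `t`, an inactive point either is activated and jumps to its greedy side, or drifts
towards that side at the rate `blend`, chosen so that its expected move is exactly `1/t` of the gap.
At time `te`, every activated point has the side that the greedy rule gives it when the seed is read
off from the optimal cut. The never activated points carry little distance.

Because of this rate, `T * y_j` grows in expectation by the side that `j` would take now (`target`).
The importance-weighted sum `S_j` used by the greedy rule grows in expectation by almost the same
amount, so `S_j` estimates `T * y_j`. The greedy side does not increase the estimated cost. In one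
step the quadratic form therefore grows in expectation by at most a second-order term `4W/t^2` plus
`4/(tT)` times the total estimation error (`Step.Valid.sum_quad_le`). That error is bounded in
second moment: its variance is small because `δ i j * W ≤ 4 * degree i * degree j`, which gives `∑
j, δ i j ^ 2 / q j ≤ 4 * degree i ^ 2`, and because point `j` is still inactive after `T` steps with
probability `O(D / (q j * T))`.

The law of a sample depends on the total number of kept times, hence on the future of the mask. So
the mask is fixed first and the process is analysed given the mask. The fluctuation of "kept" around
its probability given the earlier mask and the total count (`predicted`) is collected in `N`. This
is a martingale once the mask is averaged (`sum_expect_noise_sq_le`). The deviation of `predicted`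
from the prior `γ^t` is an information cost. By the chain rule, the relative entropies of all
entries add up to the entropy of the count, at most `log (te + 1)`. Relative entropy dominates
squared Hellinger distance, and Cauchy-Schwarz gives a total relative deviation, weighted by `1/t`,
of `O(log te / √γ)` (`sum_deviation_div_le`).

Finally, the reported probability may be random given the sampled point. It is disintegrated: one
independent value is drawn in advance for every (count, rank, point). For almost every such draw the
reported probability is a function of the point, everything is finite, and the bound above holds.
Integrating it gives the theorem. -/

/-- A pseudometric on `Fin n`, given by its distance matrix. -/
structure IsFinMetric {n : ℕ} (δ : Fin n → Fin n → ℝ) : Prop where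
  nonneg : ∀ i j, 0 ≤ δ i j
  diag : ∀ i, δ i i = 0
  symm : ∀ i j, δ i j = δ j i
  triangle : ∀ i j k, δ i k ≤ δ i j + δ j k

/-- The sum of the distances to point `i`. -/
def degree {n : ℕ} (δ : Fin n → Fin n → ℝ) (i : Fin n) : ℝ := ∑ j, δ i j

/-- The quadratic form of the distance matrix. -/
def quad {n : ℕ} (δ : Fin n → Fin n → ℝ) (y : Fin n → ℝ) : ℝ := ∑ i, ∑ j, δ i j * (y i * y j)

/-- The sign `±1` that encodes a side. -/
def sign (b : Bool) : ℝ := if b then 1 else -1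

theorem abs_sign (b : Bool) : |sign b| = 1 := by cases b <;> simp [sign]

section Metric

variable {n : ℕ} {δ : Fin n → Fin n → ℝ}

theorem totalDist_eq_sum_degree (δ : Fin n → Fin n → ℝ) : totalDist δ = ∑ i, degree δ i := rfl

theorem distShare_mul_totalDist (hW : totalDist δ ≠ 0) (i : Fin n) :
    distShare δ i * totalDist δ = degree δ i := by
  unfold distShare degree; field_simp

theorem sum_distShare (hW : totalDist δ ≠ 0) : ∑ i, distShare δ i = 1 := by
  unfold distShare
  rw [← Finset.sum_div, div_eq_one_iff_eq hW]; rfl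

theorem IsFinMetric.degree_nonneg (h : IsFinMetric δ) (i : Fin n) : 0 ≤ degree δ i :=
  Finset.sum_nonneg fun j _ => h.nonneg i j

theorem IsFinMetric.totalDist_nonneg (h : IsFinMetric δ) : 0 ≤ totalDist δ :=
  Finset.sum_nonneg fun i _ => h.degree_nonneg i

/-- Every distance is routed through the point `i`. -/
theorem IsFinMetric.totalDist_le (h : IsFinMetric δ) (i : Fin n) :
    totalDist δ ≤ 2 * n * degree δ i := by
  calc totalDist δ ≤ ∑ j, ∑ k, (δ i j + δ i k) :=
        Finset.sum_le_sum fun j _ => Finset.sum_le_sum fun k _ => by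
          rw [h.symm i j]; exact h.triangle j i k
    _ = 2 * n * degree δ i := by
        simp only [Finset.sum_add_distrib, Finset.sum_const, Finset.card_univ, Fintype.card_fin,
          nsmul_eq_mul, ← Finset.mul_sum]
        unfold degree; ring

theorem IsFinMetric.card_mul_le (h : IsFinMetric δ) (i j : Fin n) :
    n * δ i j ≤ degree δ i + degree δ j := by
  calc (n : ℝ) * δ i j = ∑ _k : Fin n, δ i j := by simp
    _ ≤ ∑ k, (δ i k + δ j k) := Finset.sum_le_sum fun k _ => by
        rw [h.symm j k]; exact h.triangle i k j
    _ = degree δ i + degree δ j := by simp [Finset.sum_add_distrib, degree]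

/-- Multiply `n * δ i j ≤ degree i + degree j` by `W`, and bound `W` by `2n` times the other degree
in each term. This domination makes sampling in proportion to the distance shares accurate. -/
theorem IsFinMetric.mul_totalDist_le (h : IsFinMetric δ) (i j : Fin n) :
    δ i j * totalDist δ ≤ 4 * (degree δ i * degree δ j) := by
  have hn : (0 : ℝ) < n := by exact_mod_cast i.pos
  have h1 := mul_le_mul_of_nonneg_right (h.card_mul_le i j) h.totalDist_nonneg
  have h2 := mul_le_mul_of_nonneg_left (h.totalDist_le j) (h.degree_nonneg i)
  have h3 := mul_le_mul_of_nonneg_left (h.totalDist_le i) (h.degree_nonneg j)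
  refine le_of_mul_le_mul_left ?_ hn
  nlinarith

theorem IsFinMetric.distShare_pos (h : IsFinMetric δ) (hW : 0 < totalDist δ) (i : Fin n) :
    0 < distShare δ i := by
  have hn : (0 : ℝ) < n := by exact_mod_cast i.pos
  refine div_pos ?_ hW
  by_contra hc
  have := h.totalDist_le i
  have h2 : 2 * n * degree δ i ≤ 0 := mul_nonpos_of_nonneg_of_nonpos (by positivity) (not_lt.1 hc)
  linarith

/-- This is the second moment of the importance-sampling estimate of the degree of `i` when `j` is
drawn with probability `distShare δ j`. It exceeds the squared mean by a constant factor only. -/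
theorem IsFinMetric.sum_sq_div_distShare_le (h : IsFinMetric δ) (hW : 0 < totalDist δ)
    (i : Fin n) : ∑ j, δ i j ^ 2 / distShare δ j ≤ 4 * degree δ i ^ 2 := by
  calc ∑ j, δ i j ^ 2 / distShare δ j ≤ ∑ j, 4 * degree δ i * δ i j := by
        refine Finset.sum_le_sum fun j _ => ?_
        have hq := h.distShare_pos hW j
        rw [div_le_iff₀ hq]
        have h1 := h.mul_totalDist_le i j
        rw [← distShare_mul_totalDist hW.ne' j] at h1
        have h2 : δ i j ≤ 4 * (degree δ i * distShare δ j) := by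
          refine le_of_mul_le_mul_right ?_ hW
          linarith
        have := mul_le_mul_of_nonneg_left h2 (h.nonneg i j)
        linarith
    _ = 4 * degree δ i ^ 2 := by rw [← Finset.mul_sum]; change _ * degree δ i = _; ring

theorem abs_sum_mul_le_degree (h : IsFinMetric δ) {x : Fin n → ℝ} (hx : ∀ i, |x i| ≤ 1)
    (i : Fin n) : |∑ j, δ i j * x j| ≤ degree δ i := by
  refine (Finset.abs_sum_le_sum_abs _ _).trans (Finset.sum_le_sum fun j _ => ?_)
  rw [abs_mul, abs_of_nonneg (h.nonneg i j)]
  exact mul_le_of_le_one_right (h.nonneg i j) (hx j)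

/-- In the unit box a product changes by at most the sum of the changes of its factors. Symmetry of
`δ` merges the two resulting sums. -/
theorem quad_le_add (h : IsFinMetric δ) {y z : Fin n → ℝ} (hy : ∀ i, |y i| ≤ 1)
    (hz : ∀ i, |z i| ≤ 1) : quad δ z ≤ quad δ y + 2 * ∑ i, degree δ i * |z i - y i| := by
  have key : ∀ i j, δ i j * (z i * z j) ≤
      δ i j * (y i * y j) + (δ i j * |z i - y i| + δ i j * |z j - y j|) := by
    intro i j
    have h1 : z i * z j - y i * y j = (z i - y i) * z j + y i * (z j - y j) := by ring
    have h2 : z i * z j - y i * y j ≤ |z i - y i| + |z j - y j| := by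
      rw [h1]
      refine (le_abs_self _).trans ((abs_add_le _ _).trans ?_)
      rw [abs_mul, abs_mul]
      exact add_le_add (mul_le_of_le_one_right (abs_nonneg _) (hz j))
        (mul_le_of_le_one_left (abs_nonneg _) (hy i))
    have := mul_le_mul_of_nonneg_left h2 (h.nonneg i j)
    linarith
  have e1 : ∑ i, ∑ j, δ i j * |z i - y i| = ∑ i, degree δ i * |z i - y i| := by
    simp only [← Finset.sum_mul]; rfl
  have e2 : ∑ i, ∑ j, δ i j * |z j - y j| = ∑ i, degree δ i * |z i - y i| := by
    rw [Finset.sum_comm, ← e1]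
    refine Finset.sum_congr rfl fun i _ => Finset.sum_congr rfl fun j _ => by rw [h.symm]
  calc quad δ z ≤ ∑ i, ∑ j, (δ i j * (y i * y j) + (δ i j * |z i - y i| + δ i j * |z j - y j|)) :=
        Finset.sum_le_sum fun i _ => Finset.sum_le_sum fun j _ => key i j
    _ = _ := by
        simp only [Finset.sum_add_distrib, e1, e2]
        unfold quad; ring

theorem internalCost_sideRow (δ : Fin n → Fin n → ℝ) (s : Fin n → Bool) :
    internalCost δ (fun i => sideRow (s i)) = (totalDist δ + quad δ fun i => sign (s i)) / 4 := by
  unfold internalCost totalDist quad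
  rw [← Finset.sum_add_distrib, Finset.mul_sum, Finset.sum_div]
  refine Finset.sum_congr rfl fun i _ => ?_
  rw [← Finset.sum_add_distrib, Finset.mul_sum, Finset.sum_div]
  refine Finset.sum_congr rfl fun j _ => ?_
  cases hi : s i <;> cases hj : s j <;> simp [sideRow, sign, hi, hj] <;> ring

theorem internalCost_mono (h : IsFinMetric δ) {z z' : Fin n → Fin 2 → Bool}
    (hz : ∀ i k, z i k = true → z' i k = true) : internalCost δ z ≤ internalCost δ z' := by
  have hle : ∀ i k, ((z i k).toNat : ℝ) ≤ ((z' i k).toNat : ℝ) := by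
    intro i k
    have := hz i k
    cases h1 : z i k <;> cases h2 : z' i k <;> simp_all
  refine mul_le_mul_of_nonneg_left (Finset.sum_le_sum fun i _ => Finset.sum_le_sum fun j _ =>
    mul_le_mul_of_nonneg_left ?_ (h.nonneg i j)) (by norm_num)
  refine add_le_add ?_ ?_ <;>
    exact mul_le_mul (hle _ _) (hle _ _) (Nat.cast_nonneg _) (Nat.cast_nonneg _)

/-- A row `(1,1)` only pays more than `(1,0)`, so an optimal matrix may be trimmed to a genuine cut.
-/
theorem exists_sign_cost_le_minCost (h : IsFinMetric δ) :
    ∃ s : Fin n → Bool, (totalDist δ + quad δ fun i => sign (s i)) / 4 ≤ minCost δ := by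
  have : Nonempty {z : Fin n → Fin 2 → Bool // ∀ i, z i ≠ ![false, false]} :=
    ⟨⟨fun _ => ![true, true], fun i hi => by simpa using congrFun hi 0⟩⟩
  obtain ⟨z, hz⟩ := exists_eq_ciInf_of_finite
    (f := fun z : {z : Fin n → Fin 2 → Bool // ∀ i, z i ≠ ![false, false]} => internalCost δ z.1)
  refine ⟨fun i => !(z.1 i 0), ?_⟩
  rw [← internalCost_sideRow]
  change _ ≤ ⨅ z : {z : Fin n → Fin 2 → Bool // ∀ i, z i ≠ ![false, false]}, internalCost δ z.1
  rw [← hz]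
  refine internalCost_mono h fun i k hk => ?_
  have hne := z.2 i
  cases h0 : z.1 i 0 <;> cases h1 : z.1 i 1
  · exact absurd (funext fun k => by fin_cases k <;> simp [h0, h1]) hne
  all_goals fin_cases k <;> simp_all [sideRow]

end Metric

/-! ### Random subsets with at most pairwise independent entries -/

/-- The indicator of a Boolean. -/
def ind (b : Bool) : ℝ := if b then 1 else 0

theorem ind_mul_self (b : Bool) : ind b * ind b = ind b := by cases b <;> simp [ind]

theorem bern_nonneg {q : ℝ} (h0 : 0 ≤ q) (h1 : q ≤ 1) (b : Bool) : 0 ≤ bern q b := by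
  cases b <;> simp [bern] <;> linarith

theorem sum_prod_bern_mul {n : ℕ} (e : Fin n → ℝ) (h : Fin n → Bool → ℝ) :
    ∑ a : Fin n → Bool, (∏ i, bern (e i) (a i)) * ∏ i, h i (a i) =
      ∏ i, (e i * h i true + (1 - e i) * h i false) := by
  have := Finset.prod_univ_sum (fun _ : Fin n => (Finset.univ : Finset Bool))
    (fun i b => bern (e i) b * h i b)
  rw [Fintype.piFinset_univ] at this
  simp only [← Finset.prod_mul_distrib]
  rw [← this]
  exact Finset.prod_congr rfl fun i _ => by simp [bern]

theorem sum_prod_bern {n : ℕ} (e : Fin n → ℝ) :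
    ∑ a : Fin n → Bool, ∏ i, bern (e i) (a i) = 1 := by
  simpa using sum_prod_bern_mul e fun _ _ => 1

theorem sum_prod_bern_ind {n : ℕ} (e : Fin n → ℝ) (i : Fin n) :
    ∑ a : Fin n → Bool, (∏ k, bern (e k) (a k)) * ind (a i) = e i := by
  have := sum_prod_bern_mul e fun k b => if k = i then ind b else 1
  simp only [Finset.prod_ite_eq', Finset.mem_univ, if_true] at this
  rw [this, Finset.prod_eq_single i] <;> simp +contextual [ind]

theorem sum_prod_bern_ind_mul {n : ℕ} (e : Fin n → ℝ) {i j : Fin n} (hij : i ≠ j) :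
    ∑ a : Fin n → Bool, (∏ k, bern (e k) (a k)) * (ind (a i) * ind (a j)) = e i * e j := by
  have := sum_prod_bern_mul e fun k b => (if k = i then ind b else 1) * if k = j then ind b else 1
  simp only [Finset.prod_mul_distrib, Finset.prod_ite_eq', Finset.mem_univ, if_true] at this
  rw [this, Fintype.prod_eq_mul i j hij]
  · simp [ind, hij, hij.symm]
  · rintro k ⟨hki, hkj⟩
    simp [hki, hkj]

/-- `V` is a probability weight on subsets with inclusion probabilities `π`, for which distinct
inclusions have joint probability `θ π_i π_j`. -/
structure IsSparse {n : ℕ} (V : (Fin n → Bool) → ℝ) (π : Fin n → ℝ) (θ : ℝ) : Prop where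
  nonneg : ∀ a, 0 ≤ V a
  sum_eq_one : ∑ a, V a = 1
  theta_nonneg : 0 ≤ θ
  theta_le_one : θ ≤ 1
  sum_ind : ∀ i, ∑ a, V a * ind (a i) = π i
  sum_ind_mul : ∀ i j, i ≠ j → ∑ a, V a * (ind (a i) * ind (a j)) = θ * (π i * π j)

namespace IsSparse

variable {n : ℕ} {V : (Fin n → Bool) → ℝ} {π : Fin n → ℝ} {θ : ℝ}

theorem prob_nonneg (h : IsSparse V π θ) (i : Fin n) : 0 ≤ π i := by
  rw [← h.sum_ind]
  exact Finset.sum_nonneg fun a _ => mul_nonneg (h.nonneg a) (by unfold ind; split <;> norm_num)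

theorem sum_linear (h : IsSparse V π θ) (c : Fin n → ℝ) :
    ∑ a, V a * ∑ j, c j * ind (a j) = ∑ j, c j * π j := by
  simp only [Finset.mul_sum]
  rw [Finset.sum_comm]
  refine Finset.sum_congr rfl fun j _ => ?_
  rw [← h.sum_ind, Finset.mul_sum]
  exact Finset.sum_congr rfl fun a _ => by ring

theorem sum_sq_linear (h : IsSparse V π θ) (c : Fin n → ℝ) :
    ∑ a, V a * (∑ j, c j * ind (a j)) ^ 2 =
      θ * (∑ j, c j * π j) ^ 2 + ∑ j, c j ^ 2 * (π j - θ * π j ^ 2) := by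
  have hpair : ∀ i j, ∑ a, V a * (ind (a i) * ind (a j)) =
      θ * (π i * π j) + if i = j then π i - θ * π i ^ 2 else 0 := by
    intro i j
    split_ifs with hij
    · subst hij
      simp only [ind_mul_self, h.sum_ind]; ring
    · rw [h.sum_ind_mul i j hij, add_zero]
  calc ∑ a, V a * (∑ j, c j * ind (a j)) ^ 2
      = ∑ i, ∑ j, c i * c j * ∑ a, V a * (ind (a i) * ind (a j)) := by
        have hsq : ∀ a : Fin n → Bool, (∑ j, c j * ind (a j)) ^ 2 =
            ∑ i, ∑ j, (c i * ind (a i)) * (c j * ind (a j)) := fun a => by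
          rw [sq, Finset.sum_mul_sum]
        simp only [hsq, Finset.mul_sum]
        rw [Finset.sum_comm]
        refine Finset.sum_congr rfl fun i _ => ?_
        rw [Finset.sum_comm]
        exact Finset.sum_congr rfl fun j _ => Finset.sum_congr rfl fun a _ => by ring
    _ = ∑ i, ∑ j, (θ * ((c i * π i) * (c j * π j)) +
          if i = j then c i * c j * (π i - θ * π i ^ 2) else 0) := by
        refine Finset.sum_congr rfl fun i _ => Finset.sum_congr rfl fun j _ => ?_
        rw [hpair]
        split_ifs <;> ring
    _ = _ := by
        simp only [Finset.sum_add_distrib, ← Finset.mul_sum, Finset.sum_ite_eq, Finset.mem_univ,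
          if_true, ← Finset.sum_mul]
        simp only [sq]

/-- Since `0 ≤ θ ≤ 1`, correlations between distinct points can only be dropped: the second moment
of a linear statistic is at most the squared mean plus the diagonal terms. For the affine one, the
constant only shifts the mean. -/
theorem sum_sq_affine_le (h : IsSparse V π θ) (C : ℝ) (c : Fin n → ℝ) :
    ∑ a, V a * (C + ∑ j, c j * ind (a j)) ^ 2 ≤
      (C + ∑ j, c j * π j) ^ 2 + ∑ j, c j ^ 2 * π j := by
  have e : ∑ a, V a * (C + ∑ j, c j * ind (a j)) ^ 2 =
      C ^ 2 + 2 * C * (∑ j, c j * π j) + ∑ a, V a * (∑ j, c j * ind (a j)) ^ 2 := by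
    rw [← h.sum_linear c, Finset.mul_sum]
    have : C ^ 2 = ∑ a, V a * C ^ 2 := by rw [← Finset.sum_mul, h.sum_eq_one, one_mul]
    rw [this, ← Finset.sum_add_distrib, ← Finset.sum_add_distrib]
    exact Finset.sum_congr rfl fun a _ => by ring
  rw [e, h.sum_sq_linear]
  have h1 : ∑ j, c j ^ 2 * (π j - θ * π j ^ 2) ≤ ∑ j, c j ^ 2 * π j :=
    Finset.sum_le_sum fun j _ => mul_le_mul_of_nonneg_left
      (by have := mul_nonneg h.theta_nonneg (sq_nonneg (π j)); linarith) (sq_nonneg _)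
  have h2 : θ * (∑ j, c j * π j) ^ 2 ≤ (∑ j, c j * π j) ^ 2 :=
    mul_le_of_le_one_left (sq_nonneg _) h.theta_le_one
  nlinarith

/-- The expected product of two increments of the form `k (b + (1 - b) 1_i)`. -/
theorem sum_increment_mul_le (h : IsSparse V π θ) {b : Fin n → ℝ} (hb0 : ∀ i, 0 ≤ b i)
    (hb1 : ∀ i, b i ≤ 1) {i j : Fin n} (hij : i ≠ j) (k l : ℝ) :
    ∑ a, V a * ((k * (b i + (1 - b i) * ind (a i))) * (l * (b j + (1 - b j) * ind (a j)))) ≤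
      |k * l| * ((b i + (1 - b i) * π i) * (b j + (1 - b j) * π j)) := by
  have e : ∑ a, V a * ((k * (b i + (1 - b i) * ind (a i))) * (l * (b j + (1 - b j) * ind (a j))))
      = k * l * (b i * b j + b i * (1 - b j) * π j + b j * (1 - b i) * π i +
        (1 - b i) * (1 - b j) * (θ * (π i * π j))) := by
    rw [← h.sum_ind_mul i j hij]
    have h1 : b i * b j = ∑ a, V a * (b i * b j) := by
      rw [← Finset.sum_mul, h.sum_eq_one, one_mul]
    rw [h1, ← h.sum_ind i, ← h.sum_ind j]
    simp only [Finset.mul_sum, ← Finset.sum_add_distrib]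
    exact Finset.sum_congr rfl fun a _ => by ring
  rw [e]
  have hi := h.prob_nonneg i
  have hj := h.prob_nonneg j
  have bi := hb0 i
  have bj := hb0 j
  have ci : 0 ≤ 1 - b i := by linarith [hb1 i]
  have cj : 0 ≤ 1 - b j := by linarith [hb1 j]
  have hθ := h.theta_nonneg
  have hnn : 0 ≤ b i * b j + b i * (1 - b j) * π j + b j * (1 - b i) * π i +
        (1 - b i) * (1 - b j) * (θ * (π i * π j)) := by positivity
  refine (mul_le_mul_of_nonneg_right (le_abs_self _) hnn).trans
    (mul_le_mul_of_nonneg_left ?_ (abs_nonneg _))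
  have : (1 - b i) * (1 - b j) * (θ * (π i * π j)) ≤ (1 - b i) * (1 - b j) * (π i * π j) :=
    mul_le_mul_of_nonneg_left (mul_le_of_le_one_left (by positivity) h.theta_le_one)
      (by positivity)
  nlinarith

end IsSparse

/-! ### One step of the activation process -/

/-- The data of one step of the process. -/
structure Step (n : ℕ) where
  /-- the time of the step -/
  time : ℝ
  /-- whether the seed still decides -/
  early : Bool
  /-- whether the step is kept by the mask -/
  kept : Bool
  /-- the prior probability to be kept -/
  rate : ℝ
  /-- the predicted probability to be kept -/
  pred : ℝ
  /-- the law of the sampled point -/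
  prob : Option (Fin n) → ℝ
  /-- the reported probability of the sampled point -/
  est : Fin n → ℝ
  /-- the weights of the points -/
  weight : Fin n → ℝ

/-- The state of the process: the fictitious cut `y`, the set of activated points, the estimates
`S` of the contribution of each point, and the accumulated noise `N` of the mask. -/
structure State (n : ℕ) where
  y : Fin n → ℝ
  act : Fin n → Bool
  S : Fin n → ℝ
  N : Fin n → ℝ

/-- A step with admissible data. -/
structure Step.Valid {n : ℕ} (q : Fin n → ℝ) (D η : ℝ) (p : Step n) : Prop where
  one_le_time : 1 ≤ p.time
  rate_pos : 0 < p.rate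
  prob_nonneg : p.kept = true → ∀ o, 0 ≤ p.prob o
  sum_prob : p.kept = true → ∑ o, p.prob o = 1
  le_prob : p.kept = true → ∀ i, q i / D ≤ p.prob (some i)
  prob_le_est : p.kept = true → ∀ i, p.prob (some i) ≤ p.est i
  est_le : p.kept = true → ∀ i, p.est i ≤ (1 + η) * p.prob (some i)
  le_weight : ∀ i, q i / (2 * D) ≤ p.weight i
  weight_le : ∀ i, p.weight i ≤ 1

namespace Step

variable {n : ℕ} (δ : Fin n → Fin n → ℝ) (p : Step n) (s : State n)

/-- The probability that point `i` gets entry `1`, given the sampled point `o`. -/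
def entry (act : Fin n → Bool) (o : Option (Fin n)) (i : Fin n) : ℝ :=
  if p.kept then
    if o = some i then if act i then 1 else min (1 / (p.time * p.est i)) 1 else 0
  else if act i then p.weight i else min (p.weight i) (1 / p.time)

/-- The probability of the column `a`. -/
def colWeight (act : Fin n → Bool) (a : Fin n → Bool) : ℝ :=
  if p.kept then ∑ o, p.prob o * ∏ i, bern (p.entry act o i) (a i)
  else ∏ i, bern (p.entry act none i) (a i)

/-- The probability that point `i` gets entry `1`. -/
def marg (act : Fin n → Bool) (i : Fin n) : ℝ :=
  if p.kept then p.prob (some i) * p.entry act (some i) i else p.entry act none i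

/-- The probability that point `i` gets entry `1` if it is not yet activated. -/
def fresh (i : Fin n) : ℝ := p.marg (fun _ => false) i

/-- The rate at which the fictitious side of a point that stays inactive moves. -/
def blend (i : Fin n) : ℝ := (1 / p.time - p.fresh i) / (1 - p.fresh i)

/-- The side that the greedy rule (or the seed) gives to point `i`. -/
def greedy (i : Fin n) : ℝ :=
  if p.early then s.y i else if ∑ j, δ i j * s.S j < 0 then 1 else -1

/-- The side of point `i` if it gets entry `1`. -/
def target (i : Fin n) : ℝ := if s.act i then s.y i else p.greedy δ s i

/-- The estimate of the probability that point `j` gets entry `1`. -/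
def est' (act : Fin n → Bool) (j : Fin n) : ℝ :=
  if act j then p.est j else min (p.est j) (1 / p.time)

/-- The state after the step with column `a`. -/
def next (a : Fin n → Bool) : State n where
  y i := if s.act i then s.y i else if a i then p.greedy δ s i
    else s.y i + p.blend i * (p.greedy δ s i - s.y i)
  act i := s.act i || a i
  S j := s.S j + ind (a j) * if p.kept then p.target δ s j / (p.est' s.act j * p.rate) else 0
  N i := s.N i + (ind p.kept - p.pred) / p.rate * ∑ j, δ i j * p.target δ s j

variable {δ p s}

section Valid

variable {q : Fin n → ℝ} {D η : ℝ}

theorem Valid.time_pos (h : p.Valid q D η) : 0 < p.time := lt_of_lt_of_le one_pos h.one_le_time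

theorem Valid.est_pos (h : p.Valid q D η) (hq : ∀ i, 0 < q i) (hD : 0 < D) (hk : p.kept = true)
    (i : Fin n) : 0 < p.est i :=
  lt_of_lt_of_le (div_pos (hq i) hD) ((h.le_prob hk i).trans (h.prob_le_est hk i))

theorem Valid.entry_mem (h : p.Valid q D η) (hq : ∀ i, 0 < q i) (hD : 0 < D)
    (act : Fin n → Bool) (o : Option (Fin n)) (i : Fin n) :
    0 ≤ p.entry act o i ∧ p.entry act o i ≤ 1 := by
  have ht := h.time_pos
  have hw : 0 ≤ p.weight i := (div_pos (hq i) (by positivity)).le.trans (h.le_weight i)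
  unfold entry
  split_ifs with hk
  · norm_num
  · have := h.est_pos hq hD hk i
    exact ⟨le_min (by positivity) zero_le_one, min_le_right _ _⟩
  · norm_num
  · exact ⟨hw, h.weight_le i⟩
  · exact ⟨le_min hw (by positivity), (min_le_left _ _).trans (h.weight_le i)⟩

theorem Valid.colWeight_nonneg (h : p.Valid q D η) (hq : ∀ i, 0 < q i) (hD : 0 < D)
    (act a : Fin n → Bool) : 0 ≤ p.colWeight act a := by
  have hb : ∀ o i, 0 ≤ bern (p.entry act o i) (a i) := fun o i =>
    bern_nonneg (h.entry_mem hq hD act o i).1 (h.entry_mem hq hD act o i).2 _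
  unfold colWeight
  split_ifs with hk
  · exact Finset.sum_nonneg fun o _ => mul_nonneg (h.prob_nonneg hk o)
      (Finset.prod_nonneg fun i _ => hb o i)
  · exact Finset.prod_nonneg fun i _ => hb none i

/-- In a kept step only the sampled point can have entry `1`, so two entries never occur together
and `θ = 0`. In other steps the entries are independent and `θ = 1`. -/
theorem Valid.isSparse (h : p.Valid q D η) (hq : ∀ i, 0 < q i) (hD : 0 < D)
    (act : Fin n → Bool) :
    IsSparse (p.colWeight act) (p.marg act) (if p.kept then 0 else 1) := by
  have hswap : p.kept = true → ∀ f : (Fin n → Bool) → ℝ, ∑ a, p.colWeight act a * f a =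
      ∑ o, p.prob o * ∑ a, (∏ i, bern (p.entry act o i) (a i)) * f a := by
    intro hk f
    simp only [colWeight, hk, if_true, Finset.sum_mul, Finset.mul_sum]
    rw [Finset.sum_comm]
    exact Finset.sum_congr rfl fun o _ => Finset.sum_congr rfl fun a _ => by ring
  refine ⟨h.colWeight_nonneg hq hD act, ?_, by split_ifs <;> norm_num,
    by split_ifs <;> norm_num, fun i => ?_, fun i j hij => ?_⟩
  · by_cases hk : p.kept = true
    · have := hswap hk fun _ => 1
      simp only [mul_one, sum_prod_bern] at this
      rw [this, h.sum_prob hk]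
    · simp only [colWeight, hk, if_false, Bool.false_eq_true, sum_prod_bern]
  · by_cases hk : p.kept = true
    · rw [hswap hk]
      simp only [sum_prod_bern_ind, marg, hk, if_true]
      refine Finset.sum_eq_single (some i) (fun o _ ho => ?_) (by simp)
      simp [entry, hk, ho]
    · simp only [colWeight, marg, hk, if_false, Bool.false_eq_true, sum_prod_bern_ind]
  · by_cases hk : p.kept = true
    · rw [hswap hk]
      simp only [sum_prod_bern_ind_mul _ hij, hk, if_true, zero_mul]
      refine Finset.sum_eq_zero fun o _ => ?_
      by_cases ho : o = some i
      · have : o ≠ some j := fun h' => hij (Option.some_injective _ (ho.symm.trans h'))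
        simp [entry, hk, this]
      · simp [entry, hk, ho]
    · simp only [colWeight, marg, hk, if_false, Bool.false_eq_true, sum_prod_bern_ind_mul _ hij,
        one_mul]

theorem marg_eq_fresh {act : Fin n → Bool} {i : Fin n} (hi : act i = false) :
    p.marg act i = p.fresh i := by
  simp [fresh, marg, entry, hi]

/-- The reported probability overestimates the true one, so thinning by `1 / (t * est)` never
activates with probability above `1/t`. This keeps `blend` nonnegative. -/
theorem Valid.fresh_le (h : p.Valid q D η) (hq : ∀ i, 0 < q i) (hD : 0 < D) (i : Fin n) :
    p.fresh i ≤ 1 / p.time := by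
  have ht := h.time_pos
  unfold fresh marg entry
  by_cases hk : p.kept = true
  · simp only [hk, if_true, Bool.false_eq_true, if_false]
    have he := h.est_pos hq hD hk i
    calc p.prob (some i) * min (1 / (p.time * p.est i)) 1
        ≤ p.est i * (1 / (p.time * p.est i)) :=
          mul_le_mul (h.prob_le_est hk i) (min_le_left _ _)
            (le_min (by positivity) zero_le_one) he.le
      _ = 1 / p.time := by field_simp
  · simp only [hk, if_false, Bool.false_eq_true]
    exact min_le_right _ _

/-- Conversely, the overestimate costs at most a factor `1 + η`, and where the thinning is capped at
`1` (or the weight is the smaller term) the compatibility with the distance shares takes over. -/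
theorem Valid.le_fresh (h : p.Valid q D η) (hq : ∀ i, 0 < q i) (hD : 0 < D) (hη : 0 ≤ η)
    (i : Fin n) : min (1 / ((1 + η) * p.time)) (q i / (2 * D)) ≤ p.fresh i := by
  have ht := h.time_pos
  unfold fresh marg entry
  by_cases hk : p.kept = true
  · simp only [hk, if_true, Bool.false_eq_true, if_false]
    have hp : 0 < p.prob (some i) := lt_of_lt_of_le (div_pos (hq i) hD) (h.le_prob hk i)
    have he := h.est_pos hq hD hk i
    rw [mul_min_of_nonneg _ _ hp.le]
    refine min_le_min ?_ ?_
    · rw [mul_one_div, div_le_div_iff₀ (by positivity) (by positivity)]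
      have := mul_le_mul_of_nonneg_left (h.est_le hk i) ht.le
      linarith
    · rw [mul_one]
      refine le_trans ?_ (h.le_prob hk i)
      exact div_le_div_of_nonneg_left (hq i).le hD (by linarith)
  · simp only [hk, if_false, Bool.false_eq_true]
    rw [min_comm]
    refine min_le_min (h.le_weight i) ?_
    refine one_div_le_one_div_of_le ht ?_
    nlinarith

theorem Valid.blend_mem (h : p.Valid q D η) (hq : ∀ i, 0 < q i) (hD : 0 < D) (i : Fin n) :
    0 ≤ p.blend i ∧ p.blend i ≤ 1 := by
  have h1 := h.fresh_le hq hD i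
  have h2 : 1 / p.time ≤ 1 := by rw [div_le_one h.time_pos]; exact h.one_le_time
  exact ⟨div_nonneg (by linarith) (by linarith), div_le_one_of_le₀ (by linarith) (by linarith)⟩

/-- The identity for which `blend` is defined: drift and activation together move an inactive point
by `1/t` of its gap in expectation. -/
theorem Valid.blend_add (h : p.Valid q D η) (hq : ∀ i, 0 < q i) (hD : 0 < D) (i : Fin n) :
    p.blend i + (1 - p.blend i) * p.fresh i = 1 / p.time := by
  have h1 := h.fresh_le hq hD i
  have h2 : 1 / p.time ≤ 1 := by rw [div_le_one h.time_pos]; exact h.one_le_time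
  by_cases h3 : p.fresh i = 1
  -- Division by zero makes `blend` vanish here. As `fresh ≤ 1/t ≤ 1`, this case forces `1/t = 1`.
  · have : p.blend i = 0 := by simp [blend, h3]
    rw [this, h3]; linarith
  · have h4 : 1 - p.fresh i ≠ 0 := fun h => h3 (by linarith)
    unfold blend
    field_simp
    ring

end Valid

theorem abs_greedy_le (hy : ∀ i, |s.y i| ≤ 1) (i : Fin n) : |p.greedy δ s i| ≤ 1 := by
  unfold greedy
  split_ifs
  · exact hy i
  · simp
  · simp

theorem abs_target_le (hy : ∀ i, |s.y i| ≤ 1) (i : Fin n) : |p.target δ s i| ≤ 1 := by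
  unfold target
  split_ifs
  · exact hy i
  · exact abs_greedy_le hy i

/-- The drift direction of the fictitious side. -/
def gap (δ : Fin n → Fin n → ℝ) (p : Step n) (s : State n) (i : Fin n) : ℝ :=
  if s.act i then 0 else p.greedy δ s i - s.y i

/-- Writes the jump and the drift as one affine function of the entry, so that the moments in
`IsSparse` apply. -/
theorem next_y_eq (a : Fin n → Bool) (i : Fin n) :
    (p.next δ s a).y i =
      s.y i + p.gap δ s i * (p.blend i + (1 - p.blend i) * ind (a i)) := by
  unfold next gap
  by_cases h : s.act i = true <;> by_cases h' : a i = true <;> simp [h, h', ind] <;> ring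

theorem abs_gap_le (hy : ∀ i, |s.y i| ≤ 1) (i : Fin n) : |p.gap δ s i| ≤ 2 := by
  unfold gap
  split_ifs
  · simp
  · have := abs_greedy_le (δ := δ) (p := p) hy i
    have := hy i
    rw [abs_le] at *
    constructor <;> linarith

theorem Valid.abs_next_y_le {q : Fin n → ℝ} {D η : ℝ} (h : p.Valid q D η) (hq : ∀ i, 0 < q i)
    (hD : 0 < D) (hy : ∀ i, |s.y i| ≤ 1) (a : Fin n → Bool) (i : Fin n) :
    |(p.next δ s a).y i| ≤ 1 := by
  unfold next
  have hg := abs_greedy_le (δ := δ) (p := p) hy i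
  have hb := h.blend_mem hq hD i
  have hy' := hy i
  dsimp only
  split_ifs
  · exact hy'
  · exact hg
  · rw [abs_le] at *
    constructor <;> nlinarith

theorem Valid.gap_mul_marg {q : Fin n → ℝ} {D η : ℝ} (h : p.Valid q D η) (hq : ∀ i, 0 < q i)
    (hD : 0 < D) (i : Fin n) :
    p.gap δ s i * (p.blend i + (1 - p.blend i) * p.marg s.act i) = p.gap δ s i * (1 / p.time) := by
  cases hi : s.act i
  · rw [marg_eq_fresh hi, h.blend_add hq hD]
  · simp [gap, hi]

end Step

/-! ### Conditional drift of the cost and of the estimation error in one step -/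

namespace Step

variable {n : ℕ} {δ : Fin n → Fin n → ℝ} {p : Step n} {s : State n} {q : Fin n → ℝ} {D η : ℝ}

theorem quad_add (hδ : IsFinMetric δ) (y u : Fin n → ℝ) :
    quad δ (fun i => y i + u i) =
      quad δ y + 2 * ∑ i, (∑ j, δ i j * y j) * u i + ∑ i, ∑ j, δ i j * (u i * u j) := by
  have e : ∑ i, ∑ j, δ i j * (y i * u j) = ∑ i, (∑ j, δ i j * y j) * u i := by
    rw [Finset.sum_comm]
    refine Finset.sum_congr rfl fun i _ => ?_
    rw [Finset.sum_mul]
    exact Finset.sum_congr rfl fun j _ => by rw [hδ.symm]; ring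
  have e' : ∑ i, ∑ j, δ i j * (u i * y j) = ∑ i, (∑ j, δ i j * y j) * u i := by
    refine Finset.sum_congr rfl fun i _ => ?_
    rw [Finset.sum_mul]
    exact Finset.sum_congr rfl fun j _ => by ring
  calc _ = ∑ i, ∑ j, (δ i j * (y i * y j) + δ i j * (y i * u j) + δ i j * (u i * y j) +
        δ i j * (u i * u j)) :=
        Finset.sum_congr rfl fun i _ => Finset.sum_congr rfl fun j _ => by ring
    _ = _ := by
        simp only [Finset.sum_add_distrib, e, e']
        unfold quad; ring

/-- The greedy choice does not increase the estimated cost. -/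
theorem gap_mul_le (he : p.early = false) (hs : ∀ i, |s.y i| ≤ 1) {T : ℝ} (hT : 0 < T)
    (i : Fin n) :
    (∑ j, δ i j * s.y j) * p.gap δ s i ≤ 2 / T * |∑ j, δ i j * (s.S j - T * s.y j)| := by
  set c := ∑ j, δ i j * s.S j with hc
  set z := ∑ j, δ i j * s.y j with hz
  have e : ∑ j, δ i j * (s.S j - T * s.y j) = c - T * z := by
    rw [hc, hz, Finset.mul_sum, ← Finset.sum_sub_distrib]
    exact Finset.sum_congr rfl fun j _ => by ring
  rw [e]
  have h1 : p.gap δ s i * c ≤ 0 := by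
    have hy := abs_le.1 (hs i)
    unfold gap greedy
    simp only [he, Bool.false_eq_true, if_false, ← hc]
    split_ifs with h1 h2
    · simp
    · nlinarith
    · nlinarith
  have h2 := abs_gap_le (δ := δ) (p := p) hs i
  have h3 : (-(p.gap δ s i)) * (c - T * z) ≤ 2 * |c - T * z| := by
    refine (le_abs_self _).trans ?_
    rw [abs_mul, abs_neg]
    exact mul_le_mul_of_nonneg_right h2 (abs_nonneg _)
  rw [div_mul_eq_mul_div, le_div_iff₀ hT]
  nlinarith

/-- Expand the quadratic form around `y`. The linear term has mean `2/t` times the correlation of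
the gap with the true contributions, which the greedy rule makes nonpositive up to the estimation
error. The quadratic term involves pairs of distinct points, whose joint moves are of order `1/t^2`.
-/
theorem Valid.sum_quad_le (h : p.Valid q D η) (hq : ∀ i, 0 < q i) (hD : 0 < D)
    (hδ : IsFinMetric δ) (he : p.early = false) (hs : ∀ i, |s.y i| ≤ 1) {T : ℝ} (hT : 0 < T) :
    ∑ a, p.colWeight s.act a * quad δ (p.next δ s a).y ≤
      quad δ s.y + 4 * totalDist δ / p.time ^ 2 +
        4 / (p.time * T) * ∑ i, |∑ j, δ i j * (s.S j - T * s.y j)| := by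
  have ht := h.time_pos
  have hsp := h.isSparse hq hD s.act
  set u : (Fin n → Bool) → Fin n → ℝ := fun a i =>
    p.gap δ s i * (p.blend i + (1 - p.blend i) * ind (a i)) with hu
  have hy : ∀ a, (p.next δ s a).y = fun i => s.y i + u a i := fun a => funext fun i =>
    next_y_eq a i
  have hE : ∀ i, ∑ a, p.colWeight s.act a * u a i = p.gap δ s i * (1 / p.time) := by
    intro i
    rw [← h.gap_mul_marg hq hD]
    calc _ = ∑ a, (p.colWeight s.act a * (p.gap δ s i * p.blend i) +
          p.gap δ s i * (1 - p.blend i) * (p.colWeight s.act a * ind (a i))) :=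
          Finset.sum_congr rfl fun a _ => by rw [hu]; ring
      _ = _ := by
          rw [Finset.sum_add_distrib, ← Finset.sum_mul, hsp.sum_eq_one, ← Finset.mul_sum,
            hsp.sum_ind]
          ring
  have hE2 : ∀ i j, δ i j * ∑ a, p.colWeight s.act a * (u a i * u a j) ≤
      δ i j * (4 / p.time ^ 2) := by
    intro i j
    by_cases hij : i = j
    -- The zero diagonal is essential here: the squared move of a single point can have expectation
    -- of order `1/t`, not `1/t^2`.
    · simp [hij, hδ.diag]
    refine mul_le_mul_of_nonneg_left ?_ (hδ.nonneg i j)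
    refine (hsp.sum_increment_mul_le (fun i => (h.blend_mem hq hD i).1)
      (fun i => (h.blend_mem hq hD i).2) hij _ _).trans ?_
    have e : ∀ k l a b : ℝ, |k * l| * (a * b) ≤ |k * a * (l * b)| := by
      intro k l a b
      have : k * a * (l * b) = (k * l) * (a * b) := by ring
      rw [this, abs_mul (k * l)]
      exact mul_le_mul_of_nonneg_left (le_abs_self _) (abs_nonneg _)
    refine (e _ _ _ _).trans ?_
    rw [h.gap_mul_marg hq hD, h.gap_mul_marg hq hD, abs_mul, abs_mul, abs_mul,
      abs_of_pos (one_div_pos.2 ht)]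
    have h1 := abs_gap_le (δ := δ) (p := p) hs i
    have h2 := abs_gap_le (δ := δ) (p := p) hs j
    calc _ = |p.gap δ s i| * |p.gap δ s j| / p.time ^ 2 := by field_simp
      _ ≤ 2 * 2 / p.time ^ 2 := by gcongr
      _ = _ := by norm_num
  have hmain : ∑ a, p.colWeight s.act a * quad δ (p.next δ s a).y =
      quad δ s.y + 2 * ∑ i, (∑ j, δ i j * s.y j) * (p.gap δ s i * (1 / p.time)) +
        ∑ i, ∑ j, δ i j * ∑ a, p.colWeight s.act a * (u a i * u a j) := by
    have e0 : ∑ a, p.colWeight s.act a * quad δ s.y = quad δ s.y := by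
      rw [← Finset.sum_mul, hsp.sum_eq_one, one_mul]
    have e1 : ∑ a, p.colWeight s.act a * (2 * ∑ i, (∑ j, δ i j * s.y j) * u a i) =
        2 * ∑ i, (∑ j, δ i j * s.y j) * (p.gap δ s i * (1 / p.time)) := by
      simp only [← hE, Finset.mul_sum (Finset.univ : Finset (Fin n → Bool))]
      simp only [Finset.mul_sum (Finset.univ : Finset (Fin n))]
      rw [Finset.sum_comm]
      refine Finset.sum_congr rfl fun i _ => ?_
      rw [Finset.mul_sum]
      refine Finset.sum_congr rfl fun a _ => by ring
    have e2 : ∑ a, p.colWeight s.act a * (∑ i, ∑ j, δ i j * (u a i * u a j)) =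
        ∑ i, ∑ j, δ i j * ∑ a, p.colWeight s.act a * (u a i * u a j) := by
      simp only [Finset.mul_sum]
      rw [Finset.sum_comm]
      refine Finset.sum_congr rfl fun i _ => ?_
      rw [Finset.sum_comm]
      exact Finset.sum_congr rfl fun j _ => Finset.sum_congr rfl fun a _ => by ring
    simp only [hy, quad_add hδ, mul_add, Finset.sum_add_distrib, e0, e2]
    rw [e1]
  rw [hmain]
  have h1 : ∑ i, (∑ j, δ i j * s.y j) * (p.gap δ s i * (1 / p.time)) ≤
      2 / (p.time * T) * ∑ i, |∑ j, δ i j * (s.S j - T * s.y j)| := by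
    rw [Finset.mul_sum]
    refine Finset.sum_le_sum fun i _ => ?_
    have := mul_le_mul_of_nonneg_right (gap_mul_le (δ := δ) he hs hT i) (one_div_pos.2 ht).le
    calc _ = (∑ j, δ i j * s.y j) * p.gap δ s i * (1 / p.time) := by ring
      _ ≤ _ := this
      _ = _ := by field_simp
  have h2 : ∑ i, ∑ j, δ i j * ∑ a, p.colWeight s.act a * (u a i * u a j) ≤
      4 * totalDist δ / p.time ^ 2 := by
    refine (Finset.sum_le_sum fun i _ => Finset.sum_le_sum fun j _ => hE2 i j).trans ?_
    simp only [← Finset.sum_mul]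
    exact le_of_eq (by unfold totalDist; ring)
  have h3 : 4 / (p.time * T) = 2 * (2 / (p.time * T)) := by ring
  rw [h3]
  linarith

/-- The deviation of the estimated contributions from the fictitious ones at time `T`, without the
noise of the mask. -/
def residual (δ : Fin n → Fin n → ℝ) (s : State n) (T : ℝ) (i : Fin n) : ℝ :=
  ∑ j, δ i j * (s.S j - T * s.y j) - s.N i

/-- A bound on the drift of the residual, relative to the degree. -/
def bias (p : Step n) (η : ℝ) : ℝ := ind p.kept / p.rate * η + |p.pred / p.rate - 1|

/-- A bound on the conditional variance of the residual. -/
def spread (δ : Fin n → Fin n → ℝ) (q : Fin n → ℝ) (D : ℝ) (p : Step n) (s : State n)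
    (i : Fin n) : ℝ :=
  ∑ j, δ i j ^ 2 * (2 * (ind p.kept / p.rate ^ 2 * (D / q j + p.time * ind (!s.act j))) +
    8 * (p.time * ind (!s.act j)))

/-- The increment of the estimated contribution of point `j` if it gets entry `1`. -/
def jump (δ : Fin n → Fin n → ℝ) (p : Step n) (s : State n) (j : Fin n) : ℝ :=
  if p.kept then p.target δ s j / (p.est' s.act j * p.rate) else 0

/-- The denominator `est'` is the activation probability computed with the reported probability in
place of the true one. It therefore cancels up to the ratio `prob / est`, for active and inactive
points alike. -/
theorem Valid.jump_mul_marg (h : p.Valid q D η) (hq : ∀ i, 0 < q i) (hD : 0 < D) (j : Fin n) :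
    p.jump δ s j * p.marg s.act j =
      p.target δ s j * (ind p.kept / p.rate * (p.prob (some j) / p.est j)) := by
  have ht := h.time_pos
  have hr := h.rate_pos
  unfold jump marg
  by_cases hk : p.kept = true
  · have he := h.est_pos hq hD hk j
    simp only [hk, if_true, ind, est', entry]
    split_ifs
    · field_simp
    · have e1 : min (1 / (p.time * p.est j)) 1 = min (p.est j) (1 / p.time) / p.est j := by
        rw [← min_div_div_right he.le, div_self he.ne', min_comm, div_div]
      have hm : 0 < min (p.est j) (1 / p.time) := lt_min he (one_div_pos.2 ht)
      rw [e1]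
      field_simp
  · simp [hk, ind]

/-- One factor of the jump cancels against the probability and leaves `1 / est'`. This is at most `D
/ q j` for active points and `max (D / q j) t` for inactive ones. -/
theorem Valid.jump_sq_mul_marg_le (h : p.Valid q D η) (hq : ∀ i, 0 < q i) (hD : 0 < D)
    (hs : ∀ i, |s.y i| ≤ 1) (j : Fin n) :
    p.jump δ s j ^ 2 * p.marg s.act j ≤
      ind p.kept / p.rate ^ 2 * (D / q j + p.time * ind (!s.act j)) := by
  have ht := h.time_pos
  have hr := h.rate_pos
  by_cases hk : p.kept = true
  · have he := h.est_pos hq hD hk j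
    have hx := abs_target_le (δ := δ) (p := p) hs j
    have hρ : 0 < p.est' s.act j := by
      unfold est'; split_ifs
      exacts [he, lt_min he (one_div_pos.2 ht)]
    have h1 : p.jump δ s j ^ 2 * p.marg s.act j =
        p.target δ s j ^ 2 * (p.prob (some j) / p.est j) / (p.est' s.act j * p.rate ^ 2) := by
      rw [sq, mul_assoc, h.jump_mul_marg hq hD]
      simp only [jump, hk, if_true, ind]
      field_simp
    have h2 : p.target δ s j ^ 2 * (p.prob (some j) / p.est j) ≤ 1 := by
      refine mul_le_one₀ ((sq_le_one_iff_abs_le_one _).2 hx)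
        (div_nonneg (h.prob_nonneg hk _) he.le) ?_
      rw [div_le_one he]
      exact h.prob_le_est hk j
    have h3 : 1 / p.est j ≤ D / q j := by
      rw [← one_div_div (q j) D]
      exact one_div_le_one_div_of_le (div_pos (hq j) hD)
        ((h.le_prob hk j).trans (h.prob_le_est hk j))
    have h4 : 1 / p.est' s.act j ≤ D / q j + p.time * ind (!s.act j) := by
      unfold est'
      cases s.act j
      · simp only [Bool.false_eq_true, if_false, ind, Bool.not_false, if_true, mul_one]
        rcases min_cases (p.est j) (1 / p.time) with hm | hm
        · rw [hm.1]; linarith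
        · rw [hm.1, one_div_one_div]
          have := div_pos hD (hq j)
          linarith
      · simpa [ind] using h3
    rw [h1]
    simp only [ind, hk, if_true]
    calc _ ≤ 1 / (p.est' s.act j * p.rate ^ 2) := by gcongr
      _ = 1 / p.rate ^ 2 * (1 / p.est' s.act j) := by field_simp
      _ ≤ _ := mul_le_mul_of_nonneg_left h4 (by positivity)
  · simp [jump, hk, ind]

theorem Valid.gap_sq_mul_marg_le (h : p.Valid q D η) (hq : ∀ i, 0 < q i) (hD : 0 < D)
    (hs : ∀ i, |s.y i| ≤ 1) (j : Fin n) :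
    (p.time * (p.gap δ s j * (1 - p.blend j))) ^ 2 * p.marg s.act j ≤
      4 * (p.time * ind (!s.act j)) := by
  have ht := h.time_pos
  cases hj : s.act j
  · have h1 := abs_gap_le (δ := δ) (p := p) hs j
    have h2 := h.blend_mem hq hD j
    have h3 := h.fresh_le hq hD j
    have h0 : 0 ≤ p.fresh j := by rw [← marg_eq_fresh hj]; exact (h.isSparse hq hD _).prob_nonneg j
    have h4 : (p.gap δ s j * (1 - p.blend j)) ^ 2 ≤ 4 := by
      have : |p.gap δ s j * (1 - p.blend j)| ≤ 2 := by
        rw [abs_mul, abs_of_nonneg (by linarith : 0 ≤ 1 - p.blend j)]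
        nlinarith [abs_nonneg (p.gap δ s j)]
      nlinarith [abs_le.1 this]
    rw [marg_eq_fresh hj, mul_pow]
    calc _ ≤ p.time ^ 2 * 4 * (1 / p.time) := by gcongr
      _ = _ := by simp [ind]; field_simp
  · simp [gap, hj, ind]

/-- The new residual is an affine function of the column, so `IsSparse.sum_sq_affine_le` splits its
second moment into the square of a mean and a variance. The mean is the old residual plus two small
drifts: the overestimate of the sampling probability and the gap between predicted and prior keeping
probability. The fluctuation of the mask has been moved into `N`. -/
theorem Valid.sum_residual_sq_le (h : p.Valid q D η) (hq : ∀ i, 0 < q i) (hD : 0 < D)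
    (hη : 0 ≤ η) (hδ : IsFinMetric δ) (hs : ∀ i, |s.y i| ≤ 1) (i : Fin n) :
    ∑ a, p.colWeight s.act a * residual δ (p.next δ s a) p.time i ^ 2 ≤
      (|residual δ s (p.time - 1) i| + degree δ i * p.bias η) ^ 2 + spread δ q D p s i := by
  have ht := h.time_pos
  have hr := h.rate_pos
  have hsp := h.isSparse hq hD s.act
  set c : Fin n → ℝ := fun j =>
    δ i j * (p.jump δ s j - p.time * (p.gap δ s j * (1 - p.blend j))) with hc
  set C : ℝ := ∑ j, δ i j * (s.S j - p.time * (s.y j + p.gap δ s j * p.blend j)) -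
    (s.N i + (ind p.kept - p.pred) / p.rate * ∑ j, δ i j * p.target δ s j) with hC
  have e1 : ∀ a, residual δ (p.next δ s a) p.time i = C + ∑ j, c j * ind (a j) := by
    intro a
    have : ∀ j, δ i j * ((p.next δ s a).S j - p.time * (p.next δ s a).y j) =
        δ i j * (s.S j - p.time * (s.y j + p.gap δ s j * p.blend j)) + c j * ind (a j) := by
      intro j
      rw [next_y_eq]
      simp only [next, hc]
      change δ i j * (s.S j + ind (a j) * p.jump δ s j - _) = _
      ring
    simp only [residual, this, Finset.sum_add_distrib, hC]
    simp only [next]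
    ring
  -- Gives `t * y + gap = (t - 1) * y + target`: the growth of `t * y_j` is the side for which `S_j`
  -- is credited.
  have htar : ∀ j, s.y j + p.gap δ s j = p.target δ s j := by
    intro j; unfold gap target; split_ifs <;> ring
  have e2 : C + ∑ j, c j * p.marg s.act j = residual δ s (p.time - 1) i +
      ∑ j, δ i j * (p.target δ s j * (ind p.kept / p.rate * (p.prob (some j) / p.est j - 1) +
        (p.pred / p.rate - 1))) := by
    have : ∀ j, δ i j * (s.S j - p.time * (s.y j + p.gap δ s j * p.blend j)) +
        c j * p.marg s.act j = δ i j * (s.S j - (p.time - 1) * s.y j) +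
          δ i j * (p.target δ s j * (ind p.kept / p.rate * (p.prob (some j) / p.est j) - 1)) := by
      intro j
      have g1 := h.gap_mul_marg (δ := δ) (s := s) hq hD j
      have g2 := h.jump_mul_marg (δ := δ) (s := s) hq hD j
      have g3 := htar j
      have g4 : p.time * (p.gap δ s j * (1 / p.time)) = p.gap δ s j := by field_simp
      rw [← g1] at g4
      simp only [hc]
      linear_combination δ i j * g2 - δ i j * g4 - δ i j * g3
    calc _ = ∑ j, (δ i j * (s.S j - p.time * (s.y j + p.gap δ s j * p.blend j)) +
          c j * p.marg s.act j) -
          (s.N i + (ind p.kept - p.pred) / p.rate * ∑ j, δ i j * p.target δ s j) := by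
          rw [hC, Finset.sum_add_distrib]; ring
      _ = _ := by
          simp only [this, Finset.sum_add_distrib, residual, Finset.mul_sum]
          rw [← sub_sub, add_sub_right_comm, add_sub_assoc, ← Finset.sum_sub_distrib]
          congr 1
          exact Finset.sum_congr rfl fun j _ => by ring
  have e3 : |∑ j, δ i j * (p.target δ s j * (ind p.kept / p.rate *
      (p.prob (some j) / p.est j - 1) + (p.pred / p.rate - 1)))| ≤ degree δ i * p.bias η := by
    refine (Finset.abs_sum_le_sum_abs _ _).trans ?_
    unfold degree
    rw [Finset.sum_mul]
    refine Finset.sum_le_sum fun j _ => ?_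
    rw [abs_mul, abs_of_nonneg (hδ.nonneg i j), abs_mul]
    refine mul_le_mul_of_nonneg_left ?_ (hδ.nonneg i j)
    refine (mul_le_of_le_one_left (abs_nonneg _) (abs_target_le hs j)).trans ?_
    refine (abs_add_le _ _).trans (add_le_add_left ?_ _)
    by_cases hk : p.kept = true
    · have he := h.est_pos hq hD hk j
      rw [abs_mul, abs_of_nonneg (div_nonneg (by simp [ind, hk]) hr.le)]
      refine mul_le_mul_of_nonneg_left ?_ (div_nonneg (by simp [ind, hk]) hr.le)
      have h1 := h.prob_le_est hk j
      have h2 := h.est_le hk j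
      have h3 := h.prob_nonneg hk (some j)
      rw [abs_le]
      constructor
      · have : (1 - η) * p.est j ≤ p.prob (some j) := by
          nlinarith [mul_nonneg hη (sub_nonneg.2 h1)]
        have := (le_div_iff₀ he).2 this
        linarith
      · have := (div_le_one he).2 h1
        linarith
    · simp [hk, ind]
  have e4 : ∑ j, c j ^ 2 * p.marg s.act j ≤ spread δ q D p s i := by
    refine Finset.sum_le_sum fun j _ => ?_
    simp only [hc, mul_pow, mul_assoc]
    refine mul_le_mul_of_nonneg_left ?_ (sq_nonneg _)
    have g1 := h.jump_sq_mul_marg_le (δ := δ) hq hD hs j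
    have g2 := h.gap_sq_mul_marg_le (δ := δ) hq hD hs j
    have g3 := hsp.prob_nonneg j
    have g4 : (p.jump δ s j - p.time * (p.gap δ s j * (1 - p.blend j))) ^ 2 ≤
        2 * p.jump δ s j ^ 2 + 2 * (p.time * (p.gap δ s j * (1 - p.blend j))) ^ 2 := by
      nlinarith [sq_nonneg (p.jump δ s j + p.time * (p.gap δ s j * (1 - p.blend j)))]
    nlinarith [mul_le_mul_of_nonneg_right g4 g3]
  simp only [e1]
  refine (hsp.sum_sq_affine_le C c).trans (add_le_add ?_ e4)
  rw [e2, ← sq_abs]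
  refine pow_le_pow_left₀ (abs_nonneg _) ((abs_add_le _ _).trans ?_) 2
  exact add_le_add_right e3 _

end Step

/-! ### Expectations over the activation process -/

/-- A run: the step with index `r` is admissible and happens at time `r + 1`. -/
structure IsRun {n : ℕ} (q : Fin n → ℝ) (D η : ℝ) (p : ℕ → Step n) : Prop where
  valid : ∀ r, (p r).Valid q D η
  time_eq : ∀ r, (p r).time = r + 1

/-- The state before the first step. -/
def State.init {n : ℕ} (y : Fin n → ℝ) : State n := ⟨y, fun _ => false, fun _ => 0, fun _ => 0⟩

/-- The expectation of a function of the state after `T` steps. -/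
def expect {n : ℕ} (δ : Fin n → Fin n → ℝ) (p : ℕ → Step n) (s₀ : State n) :
    ℕ → (State n → ℝ) → ℝ
  | 0, F => F s₀
  | T + 1, F => expect δ p s₀ T fun s =>
      ∑ a, (p T).colWeight s.act a * F ((p T).next δ s a)

section Expect

variable {n : ℕ} {δ : Fin n → Fin n → ℝ} {p : ℕ → Step n} {s₀ : State n} {q : Fin n → ℝ}
  {D η : ℝ}

/-- Used to see that an expectation up to a given time depends on the mask only through its past and
its count. -/
theorem expect_congr {p' : ℕ → Step n} {T : ℕ} (h : ∀ r < T, p r = p' r) (F : State n → ℝ) :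
    expect δ p s₀ T F = expect δ p' s₀ T F := by
  induction T generalizing F with
  | zero => rfl
  | succ T ih =>
    simp only [expect]
    rw [ih fun r hr => h r (by omega), h T (by omega)]

theorem expect_add (T : ℕ) (F G : State n → ℝ) :
    expect δ p s₀ T (fun s => F s + G s) = expect δ p s₀ T F + expect δ p s₀ T G := by
  induction T generalizing F G with
  | zero => rfl
  | succ T ih =>
    simp only [expect]
    rw [← ih]
    simp only [mul_add, Finset.sum_add_distrib]

theorem expect_const_mul (T : ℕ) (c : ℝ) (F : State n → ℝ) :
    expect δ p s₀ T (fun s => c * F s) = c * expect δ p s₀ T F := by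
  induction T generalizing F with
  | zero => rfl
  | succ T ih =>
    simp only [expect]
    rw [← ih]
    simp only [Finset.mul_sum, mul_left_comm]

theorem expect_sum {ι : Type*} (u : Finset ι) (T : ℕ) (F : ι → State n → ℝ) :
    expect δ p s₀ T (fun s => ∑ i ∈ u, F i s) = ∑ i ∈ u, expect δ p s₀ T (F i) := by
  classical
  induction u using Finset.induction_on with
  | empty =>
    have := expect_const_mul (δ := δ) (p := p) (s₀ := s₀) T 0 fun _ => 0
    simpa using this
  | insert i u hi ih => simp only [Finset.sum_insert hi, expect_add, ih]

variable (hp : IsRun q D η p) (hq : ∀ i, 0 < q i) (hD : 1 ≤ D) (hs₀ : ∀ i, |s₀.y i| ≤ 1)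

include hp hq hD in
theorem expect_const (T : ℕ) (c : ℝ) : expect δ p s₀ T (fun _ => c) = c := by
  induction T with
  | zero => rfl
  | succ T ih =>
    simp only [expect, ← Finset.sum_mul,
      ((hp.valid T).isSparse hq (by linarith) _).sum_eq_one, one_mul, ih]

include hp hq hD hs₀ in
-- The comparison is needed only for states with `y` in the unit box, since every step preserves the
-- box.
theorem expect_mono (T : ℕ) {F G : State n → ℝ} (h : ∀ s, (∀ i, |s.y i| ≤ 1) → F s ≤ G s) :
    expect δ p s₀ T F ≤ expect δ p s₀ T G := by
  induction T generalizing F G with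
  | zero => exact h _ hs₀
  | succ T ih =>
    refine ih fun s hs => Finset.sum_le_sum fun a _ => mul_le_mul_of_nonneg_left ?_
      ((hp.valid T).colWeight_nonneg hq (by linarith) _ _)
    exact h _ ((hp.valid T).abs_next_y_le hq (by linarith) hs a)

include hp hq hD hs₀ in
theorem expect_sq_le (T : ℕ) (F : State n → ℝ) :
    expect δ p s₀ T F ^ 2 ≤ expect δ p s₀ T fun s => F s ^ 2 := by
  have h0 : expect δ p s₀ T (fun _ => 0) ≤
      expect δ p s₀ T fun s => (F s ^ 2 + (-2 * expect δ p s₀ T F) * F s) +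
        expect δ p s₀ T F ^ 2 :=
    expect_mono hp hq hD hs₀ T fun s _ => by nlinarith [sq_nonneg (F s - expect δ p s₀ T F)]
  rw [expect_const hp hq hD, expect_add, expect_add, expect_const_mul,
    expect_const hp hq hD] at h0
  nlinarith

include hp hq hD hs₀ in
theorem expect_abs_le_of_sq_le (T : ℕ) {F : State n → ℝ} {B : ℝ} (hB : 0 ≤ B)
    (h : expect δ p s₀ T (fun s => F s ^ 2) ≤ B ^ 2) :
    expect δ p s₀ T (fun s => |F s|) ≤ B := by
  have h1 := expect_sq_le (δ := δ) hp hq hD hs₀ T fun s => |F s|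
  simp only [sq_abs] at h1
  exact le_of_abs_le (abs_le_of_sq_le_sq (h1.trans h) hB)

/-! ### Inactive points -/

include hp hq hD in
theorem expect_inactive_succ (T : ℕ) (i : Fin n) :
    expect δ p s₀ (T + 1) (fun s => ind (!s.act i)) =
      (1 - (p T).fresh i) * expect δ p s₀ T fun s => ind (!s.act i) := by
  simp only [expect]
  rw [← expect_const_mul]
  congr 1
  funext s
  have hsp := (hp.valid T).isSparse hq (by linarith) s.act
  have e : ∀ a, ind (!((p T).next δ s a).act i) = ind (!s.act i) * (1 - ind (a i)) := by
    intro a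
    simp only [Step.next]
    cases s.act i <;> cases a i <;> simp [ind]
  have e1 : ∑ a, (p T).colWeight s.act a * (1 - ind (a i)) = 1 - (p T).marg s.act i := by
    simp only [mul_sub, mul_one, Finset.sum_sub_distrib, hsp.sum_eq_one, hsp.sum_ind]
  simp only [e, mul_left_comm _ (ind (!s.act i)), ← Finset.mul_sum, e1]
  cases h : s.act i
  · rw [Step.marg_eq_fresh h]; ring
  · simp [ind]

include hp hq hD hs₀ in
-- With activation probability exactly `1/t`, survival to time `T` would decay like `1/T`, so `T`
-- times it would not grow. The factor `1 + η` in the estimates lets it grow by `1 + η/T` per step.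
-- While `T` is at most `2D / q i` the bound is trivial.
theorem expect_inactive_mul_le (hq1 : ∀ i, q i ≤ 1) (hη : 0 ≤ η) (T : ℕ) (i : Fin n) :
    q i / (2 * D) * (T * expect δ p s₀ T fun s => ind (!s.act i)) ≤
      ∏ k ∈ Finset.range T, (1 + η / k) := by
  have hκ : 0 < q i / (2 * D) := div_pos (hq i) (by linarith)
  have hκ1 : q i / (2 * D) ≤ 1 := by
    rw [div_le_one (by linarith)]; linarith [hq1 i]
  have hprod : ∀ T : ℕ, 1 ≤ ∏ k ∈ Finset.range T, (1 + η / (k : ℝ)) := fun T => by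
    have h := Finset.prod_le_prod (s := Finset.range T) (f := fun _ : ℕ => (1 : ℝ))
      (g := fun k : ℕ => 1 + η / (k : ℝ)) (fun _ _ => zero_le_one)
      (fun k _ => by have : 0 ≤ η / (k : ℝ) := by positivity
                     linarith)
    simpa using h
  have hu0 : ∀ T, 0 ≤ expect δ p s₀ T fun s => ind (!s.act i) := fun T => by
    rw [← expect_const (δ := δ) (s₀ := s₀) hp hq hD T 0]
    exact expect_mono hp hq hD hs₀ T fun s _ => by unfold ind; split_ifs <;> norm_num
  have hu1 : ∀ T, (expect δ p s₀ T fun s => ind (!s.act i)) ≤ 1 := fun T => by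
    rw [← expect_const (δ := δ) (s₀ := s₀) hp hq hD T 1]
    exact expect_mono hp hq hD hs₀ T fun s _ => by unfold ind; split_ifs <;> norm_num
  induction T with
  | zero => simp
  | succ T ih =>
    set κ := q i / (2 * D)
    set u := expect δ p s₀ T fun s => ind (!s.act i)
    -- In the second case `κ (T + 1) > 1`, so the term `1 / ((1 + η) t)` attains the minimum in
    -- `le_fresh`. Since `κ ≤ 1` this also excludes `T = 0`, where the factor `1 + η / 0` is `1`.
    by_cases hc : κ * ((T + 1 : ℕ) : ℝ) ≤ 1
    · refine le_trans ?_ (hprod (T + 1))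
      rw [← mul_assoc]
      exact mul_le_one₀ hc (hu0 _) (hu1 _)
    · rw [not_le] at hc
      have hT : (1 : ℝ) ≤ T := by
        by_contra hT
        have : T = 0 := by
          by_contra h0
          exact hT (by exact_mod_cast Nat.one_le_iff_ne_zero.2 h0)
        rw [this] at hc
        norm_num at hc
        linarith
      have hf : 1 / ((1 + η) * (T + 1)) ≤ (p T).fresh i := by
        have := (hp.valid T).le_fresh hq (by linarith) hη i
        rw [hp.time_eq] at this
        refine le_trans (le_of_eq ?_) this
        rw [min_eq_left]
        push_cast at hc
        rw [div_le_iff₀ (by positivity)]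
        have : (0 : ℝ) ≤ κ * (T + 1) * η := by positivity
        change 1 ≤ κ * _
        nlinarith
      rw [expect_inactive_succ hp hq hD, Finset.prod_range_succ]
      have h1 : ((T + 1 : ℕ) : ℝ) * (1 - (p T).fresh i) ≤ T * (1 + η / T) := by
        push_cast
        have h2 := mul_le_mul_of_nonneg_left hf (by positivity : (0 : ℝ) ≤ T + 1)
        have h3 : (T + 1 : ℝ) * (1 / ((1 + η) * (T + 1))) = 1 / (1 + η) := by field_simp
        have h4 : 1 - η ≤ 1 / (1 + η) := by
          rw [le_div_iff₀ (by linarith)]; nlinarith [sq_nonneg η]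
        have h5 : (T : ℝ) * (1 + η / T) = T + η := by field_simp
        rw [h5]
        linarith
      calc κ * (((T + 1 : ℕ) : ℝ) * ((1 - (p T).fresh i) * u))
          = κ * u * (((T + 1 : ℕ) : ℝ) * (1 - (p T).fresh i)) := by ring
        _ ≤ κ * u * (T * (1 + η / T)) := mul_le_mul_of_nonneg_left h1 (mul_nonneg hκ.le (hu0 T))
        _ = κ * (T * u) * (1 + η / T) := by ring
        _ ≤ _ := mul_le_mul_of_nonneg_right ih (by positivity)

/-- The product is at most `exp (η * H)` for a harmonic number `H ≤ 1 + log te`, hence at most `e^2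
< 8`. The factor at `k = 0` equals `1`. -/
theorem prod_one_add_div_le (hη : 0 ≤ η) {te : ℕ} (hη1 : η ≤ 1) (hηl : η * Real.log te ≤ 1)
    (hte : 1 ≤ te) {T : ℕ} (hT : T ≤ te) : ∏ k ∈ Finset.range T, (1 + η / (k : ℝ)) ≤ 8 := by
  have h1 : ∏ k ∈ Finset.range T, (1 + η / (k : ℝ)) ≤
      Real.exp (∑ k ∈ Finset.range T, η / (k : ℝ)) := by
    rw [Real.exp_sum]
    refine Finset.prod_le_prod (fun k _ => by positivity) fun k _ => ?_
    rw [add_comm]; exact Real.add_one_le_exp _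
  have h2 : ∑ k ∈ Finset.range T, η / (k : ℝ) ≤ 2 := by
    cases T with
    | zero => simp
    | succ T =>
      have h3 : ∑ k ∈ Finset.range (T + 1), η / (k : ℝ) = η * (harmonic T : ℝ) := by
        rw [Finset.sum_range_succ']
        simp [harmonic, Finset.mul_sum, div_eq_mul_inv]
      have h4 := harmonic_le_one_add_log T
      have h5 : Real.log T ≤ Real.log te := by
        rcases Nat.eq_zero_or_pos T with h0 | h0
        · simp only [h0, Nat.cast_zero, Real.log_zero]
          exact Real.log_nonneg (by exact_mod_cast hte)
        · exact Real.log_le_log (by exact_mod_cast h0) (by exact_mod_cast (by omega : T ≤ te))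
      rw [h3]
      nlinarith
  refine h1.trans ((Real.exp_le_exp.2 h2).trans ?_)
  have h6 := Real.exp_one_lt_d9
  have h7 : Real.exp 2 = Real.exp 1 * Real.exp 1 := by rw [← Real.exp_add]; norm_num
  rw [h7]
  nlinarith [Real.exp_pos 1]

/-! ### Residuals -/

include hp hq hD hs₀ in
-- The bound has the shape of Minkowski's inequality: drifts add up linearly, conditional variances
-- add up under the root. The induction uses the second-moment bound also for the mean absolute
-- residual in the cross term.
theorem expect_residual_sq_le (hη : 0 ≤ η) (hδ : IsFinMetric δ) (i : Fin n)
    (hinit : Step.residual δ s₀ 0 i = 0) {v : ℕ → ℝ} {te : ℕ} (hv0 : ∀ T, 0 ≤ v T)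
    (hv : ∀ T < te, expect δ p s₀ T (fun s => (p T).spread δ q D s i) ≤ v T) {T : ℕ}
    (hT : T ≤ te) (hrate : ∀ r, 0 ≤ (p r).bias η) :
    expect δ p s₀ T (fun s => Step.residual δ s T i ^ 2) ≤
      (degree δ i * ∑ r ∈ Finset.range T, (p r).bias η +
        Real.sqrt (∑ r ∈ Finset.range T, v r)) ^ 2 := by
  induction T with
  | zero => simp [expect, hinit]
  | succ T ih =>
    specialize ih (by omega)
    set E := degree δ i * ∑ r ∈ Finset.range T, (p r).bias η with hE
    set V := ∑ r ∈ Finset.range T, v r with hV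
    set e := degree δ i * (p T).bias η with he
    have hE0 : 0 ≤ E := mul_nonneg (hδ.degree_nonneg i) (Finset.sum_nonneg fun r _ => hrate r)
    have he0 : 0 ≤ e := mul_nonneg (hδ.degree_nonneg i) (hrate T)
    have hV0 : 0 ≤ V := Finset.sum_nonneg fun r _ => hv0 r
    have h1 : expect δ p s₀ (T + 1) (fun s => Step.residual δ s ((T + 1 : ℕ) : ℝ) i ^ 2) ≤
        expect δ p s₀ T fun s => (Step.residual δ s T i ^ 2 +
          (2 * e) * |Step.residual δ s T i|) + (e ^ 2 + (p T).spread δ q D s i) := by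
      refine expect_mono hp hq hD hs₀ T fun s hs => ?_
      have := (hp.valid T).sum_residual_sq_le hq (by linarith) hη hδ hs i
      rw [hp.time_eq, add_sub_cancel_right] at this
      push_cast
      refine this.trans (le_of_eq ?_)
      rw [add_sq, sq_abs]
      ring
    rw [expect_add, expect_add, expect_add, expect_const_mul, expect_const hp hq hD] at h1
    have h2 := expect_abs_le_of_sq_le hp hq hD hs₀ T (by positivity) ih
    have h3 := hv T (by omega)
    have h4 := mul_le_mul_of_nonneg_left h2 (by positivity : 0 ≤ 2 * e)
    rw [Finset.sum_range_succ, Finset.sum_range_succ, mul_add]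
    change _ ≤ (E + e + Real.sqrt (V + v T)) ^ 2
    have h5 := Real.sq_sqrt hV0
    have h6 := Real.sq_sqrt (add_nonneg hV0 (hv0 T))
    have h7 : Real.sqrt V ≤ Real.sqrt (V + v T) := Real.sqrt_le_sqrt (by linarith [hv0 T])
    have h8 : 2 * (E + e) * Real.sqrt V ≤ 2 * (E + e) * Real.sqrt (V + v T) :=
      mul_le_mul_of_nonneg_left h7 (by positivity)
    nlinarith

include hp hq hD in
-- Active points contribute `D / q j`, inactive ones `t` times their survival probability, which is
-- also `O(D / q j)`. Then the sum of `δ i j ^ 2 / q j` collapses to the squared degree.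
theorem expect_spread_le {T : ℕ} {i : Fin n} {B : ℝ}
    (hsum : ∑ j, δ i j ^ 2 / q j ≤ 4 * degree δ i ^ 2) (hB : 0 ≤ B)
    (hu : ∀ j, (T + 1) * expect δ p s₀ T (fun s => ind (!s.act j)) ≤ B * (D / q j)) :
    expect δ p s₀ T (fun s => (p T).spread δ q D s i) ≤
      8 * (1 + 4 * B) * D * degree δ i ^ 2 * (1 + ind (p T).kept / (p T).rate ^ 2) := by
  have hr := (hp.valid T).rate_pos
  set k := ind (p T).kept / (p T).rate ^ 2 with hk
  have hk0 : 0 ≤ k := div_nonneg (by unfold ind; split_ifs <;> norm_num) (by positivity)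
  have e : ∀ s : State n, (p T).spread δ q D s i = ∑ j, (δ i j ^ 2 * (2 * (k * (D / q j))) +
      (δ i j ^ 2 * (2 * k + 8) * (T + 1)) * ind (!s.act j)) := by
    intro s
    unfold Step.spread
    rw [hp.time_eq]
    exact Finset.sum_congr rfl fun j _ => by rw [← hk]; ring
  simp only [e, expect_sum, expect_add, expect_const hp hq hD, expect_const_mul]
  have hle : ∀ j, δ i j ^ 2 * (2 * (k * (D / q j))) + δ i j ^ 2 * (2 * k + 8) * (T + 1) *
      expect δ p s₀ T (fun s => ind (!s.act j)) ≤
      (2 * (1 + 4 * B) * D * (1 + k)) * (δ i j ^ 2 / q j) := by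
    intro j
    have h1 := mul_le_mul_of_nonneg_left (hu j)
      (by positivity : 0 ≤ δ i j ^ 2 * (2 * k + 8))
    have h2 : 0 ≤ δ i j ^ 2 / q j := div_nonneg (sq_nonneg _) (hq j).le
    calc _ ≤ δ i j ^ 2 * (2 * (k * (D / q j))) + δ i j ^ 2 * (2 * k + 8) * (B * (D / q j)) := by
          linarith
      _ = (2 * k + (2 * k + 8) * B) * (D * (δ i j ^ 2 / q j)) := by ring
      _ ≤ (2 * (1 + 4 * B) * (1 + k)) * (D * (δ i j ^ 2 / q j)) := by
          refine mul_le_mul_of_nonneg_right ?_ (mul_nonneg (by linarith) h2)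
          nlinarith [mul_nonneg hB hk0]
      _ = _ := by ring
  refine (Finset.sum_le_sum fun j _ => hle j).trans ?_
  rw [← Finset.mul_sum]
  refine (mul_le_mul_of_nonneg_left hsum (by positivity)).trans (le_of_eq ?_)
  ring

/-! ### The cost of the fictitious cut -/

include hp hq hD hs₀ in
-- Sums the one-step drifts. The estimation error is split into the residual, controlled for each
-- mask, and the noise `N`, which is small only on average over masks.
theorem expect_quad_le (hδ : IsFinMetric δ) {t0 : ℕ} (ht0 : 1 ≤ t0)
    (hearly : ∀ r, (p r).early = decide (r < t0)) (T : ℕ) :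
    expect δ p s₀ T (fun s => quad δ s.y) ≤ quad δ s₀.y +
      ∑ r ∈ Finset.Ico t0 T, (4 * totalDist δ / (r + 1) ^ 2 + 4 / ((r + 1) * r) *
        ∑ i, (expect δ p s₀ r (fun s => |Step.residual δ s r i|) +
          expect δ p s₀ r (fun s => |s.N i|))) := by
  induction T with
  | zero => simp [expect]
  | succ T ih =>
    by_cases hT : T < t0
    · have : expect δ p s₀ (T + 1) (fun s => quad δ s.y) =
          expect δ p s₀ T (fun s => quad δ s.y) := by
        simp only [expect]
        congr 1
        funext s
        -- In the early phase the prescribed side is the current fictitious side itself, so nothing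
        -- moves.
        have hy : ∀ a, ((p T).next δ s a).y = s.y := fun a => funext fun i => by
          rw [Step.next_y_eq]
          simp [Step.gap, Step.greedy, hearly, hT]
        simp only [hy, ← Finset.sum_mul,
          ((hp.valid T).isSparse hq (by linarith) _).sum_eq_one, one_mul]
      rw [this, Finset.Ico_eq_empty (by omega)]
      rwa [Finset.Ico_eq_empty (by omega)] at ih
    · rw [not_lt] at hT
      rw [Finset.sum_Ico_succ_top hT]
      have hTpos : (0 : ℝ) < T := by exact_mod_cast (by omega : 0 < T)
      have h1 : expect δ p s₀ (T + 1) (fun s => quad δ s.y) ≤ expect δ p s₀ T fun s =>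
          (quad δ s.y + 4 * totalDist δ / (T + 1) ^ 2) + 4 / ((T + 1) * T) *
            ∑ i, (|Step.residual δ s T i| + |s.N i|) := by
        refine expect_mono hp hq hD hs₀ T fun s hs => ?_
        have := (hp.valid T).sum_quad_le hq (by linarith) hδ (by simp [hearly, hT]) hs hTpos
        rw [hp.time_eq] at this
        refine this.trans (add_le_add_right (mul_le_mul_of_nonneg_left
          (Finset.sum_le_sum fun i _ => ?_) (by positivity)) _)
        have e : ∑ j, δ i j * (s.S j - T * s.y j) = Step.residual δ s T i + s.N i := by
          unfold Step.residual; ring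
        rw [e]
        exact abs_add_le _ _
      rw [expect_add, expect_add, expect_const hp hq hD, expect_const_mul, expect_sum] at h1
      simp only [expect_add] at h1
      linarith

end Expect

/-! ### Conditional averages over a finite weighted set -/

section CondAvg

variable {Ω X : Type*} [Fintype Ω] [DecidableEq X]

/-- The total weight of the class of `ω`. -/
def classMass (m : Ω → ℝ) (π : Ω → X) (ω : Ω) : ℝ := ∑ ω', if π ω' = π ω then m ω' else 0

/-- The average of `f` over the class of `ω`. -/
def condAvg (m : Ω → ℝ) (π : Ω → X) (f : Ω → ℝ) (ω : Ω) : ℝ :=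
  (∑ ω', if π ω' = π ω then m ω' * f ω' else 0) / classMass m π ω

variable {m : Ω → ℝ} {π : Ω → X}

theorem le_classMass (hm : ∀ ω, 0 ≤ m ω) (ω : Ω) : m ω ≤ classMass m π ω := by
  have := Finset.single_le_sum (f := fun ω' => if π ω' = π ω then m ω' else 0)
    (fun ω' _ => by split_ifs; exacts [hm _, le_rfl]) (Finset.mem_univ ω)
  simpa [classMass] using this

theorem classMass_congr {ω ω' : Ω} (h : π ω = π ω') : classMass m π ω = classMass m π ω' := by
  unfold classMass; rw [h]

theorem condAvg_congr {f : Ω → ℝ} {ω ω' : Ω} (h : π ω = π ω') :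
    condAvg m π f ω = condAvg m π f ω' := by
  unfold condAvg; rw [h, classMass_congr h]

/-- The tower property. Classes of mass zero, where `condAvg` is a division by zero, contain only
points of weight zero. -/
theorem sum_condAvg_mul (hm : ∀ ω, 0 ≤ m ω) (f : Ω → ℝ) {Φ : Ω → ℝ}
    (hΦ : ∀ ω ω', π ω = π ω' → Φ ω = Φ ω') :
    ∑ ω, m ω * (condAvg m π f ω * Φ ω) = ∑ ω, m ω * (f ω * Φ ω) := by
  calc ∑ ω, m ω * (condAvg m π f ω * Φ ω)
      = ∑ ω, ∑ ω', (if π ω' = π ω then m ω' * f ω' else 0) * (m ω * (Φ ω / classMass m π ω)) := by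
        refine Finset.sum_congr rfl fun ω _ => ?_
        unfold condAvg
        rw [← Finset.sum_mul]; ring
    _ = ∑ ω', ∑ ω, (if π ω = π ω' then m ω else 0) *
          (m ω' * f ω' * (Φ ω' / classMass m π ω')) := by
        rw [Finset.sum_comm]
        refine Finset.sum_congr rfl fun ω' _ => Finset.sum_congr rfl fun ω _ => ?_
        by_cases h : π ω' = π ω
        · rw [if_pos h, if_pos h.symm, hΦ _ _ h, classMass_congr h]; ring
        · rw [if_neg h, if_neg (Ne.symm h)]; ring
    _ = ∑ ω', m ω' * (f ω' * Φ ω') := by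
        refine Finset.sum_congr rfl fun ω' _ => ?_
        rw [← Finset.sum_mul]
        change classMass m π ω' * _ = _
        by_cases h : classMass m π ω' = 0
        · have : m ω' = 0 := le_antisymm (h ▸ le_classMass hm ω') (hm ω')
          simp [this]
        · field_simp

theorem condAvg_nonneg (hm : ∀ ω, 0 ≤ m ω) {f : Ω → ℝ} (hf : ∀ ω, 0 ≤ f ω) (ω : Ω) :
    0 ≤ condAvg m π f ω :=
  div_nonneg (Finset.sum_nonneg fun ω' _ => by split_ifs; exacts [mul_nonneg (hm _) (hf _), le_rfl])
    ((hm ω).trans (le_classMass hm ω))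

theorem condAvg_le_one (hm : ∀ ω, 0 ≤ m ω) {f : Ω → ℝ} (hf : ∀ ω, f ω ≤ 1) (ω : Ω) :
    condAvg m π f ω ≤ 1 := by
  refine div_le_one_of_le₀ (Finset.sum_le_sum fun ω' _ => ?_) ((hm ω).trans (le_classMass hm ω))
  split_ifs
  exacts [mul_le_of_le_one_right (hm _) (hf _), le_rfl]

/-- Refining the classes by a Boolean `k` multiplies the mass by the conditional probability. -/
theorem classMass_refine {Y : Type*} [DecidableEq Y] {π' : Ω → Y} {k : Ω → Bool} {ω : Ω}
    (hm : ∀ ω, 0 ≤ m ω) (hπ : ∀ ω', π' ω' = π' ω ↔ π ω' = π ω ∧ k ω' = k ω) (hω : 0 < m ω) :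
    classMass m π' ω = classMass m π ω * bern (condAvg m π (fun ω' => ind (k ω')) ω) (k ω) := by
  have hpos : classMass m π ω ≠ 0 := (hω.trans_le (le_classMass hm ω)).ne'
  have h1 : classMass m π ω * condAvg m π (fun ω' => ind (k ω')) ω =
      ∑ ω', if π ω' = π ω then m ω' * ind (k ω') else 0 := by
    unfold condAvg; field_simp
  cases hk : k ω
  · simp only [bern, Bool.false_eq_true, if_false, mul_sub, mul_one, h1]
    unfold classMass
    rw [← Finset.sum_sub_distrib]
    refine Finset.sum_congr rfl fun ω' _ => ?_
    by_cases h : π ω' = π ω <;> cases h' : k ω' <;> simp [hπ, h, h', hk, ind]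
  · simp only [bern, if_true, h1]
    unfold classMass
    refine Finset.sum_congr rfl fun ω' _ => ?_
    by_cases h : π ω' = π ω <;> cases h' : k ω' <;> simp [hπ, h, h', hk, ind]

/-- The squared Hellinger distance is bounded by the relative entropy. -/
theorem sum_sqrt_sub_sq_le (hm : ∀ ω, 0 ≤ m ω) (k : Ω → Bool) {g : ℝ} (hg0 : 0 ≤ g)
    (hg1 : g ≤ 1) (hpos : ∀ ω, 0 < m ω → 0 < bern g (k ω)) :
    ∑ ω, m ω * (Real.sqrt (condAvg m π (fun ω => ind (k ω)) ω) - Real.sqrt g) ^ 2 ≤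
      ∑ ω, m ω * (Real.log (bern (condAvg m π (fun ω => ind (k ω)) ω) (k ω)) -
        Real.log (bern g (k ω))) := by
  set c := condAvg m π fun ω => ind (k ω) with hc
  have hind0 : ∀ ω, 0 ≤ ind (k ω) := fun ω => by unfold ind; split_ifs <;> norm_num
  have hind1 : ∀ ω, ind (k ω) ≤ 1 := fun ω => by unfold ind; split_ifs <;> norm_num
  have hc0 : ∀ ω, 0 ≤ c ω := condAvg_nonneg hm hind0
  have hc1 : ∀ ω, c ω ≤ 1 := condAvg_le_one hm hind1
  have hcc : ∀ ω ω', π ω = π ω' → c ω = c ω' := fun ω ω' h => condAvg_congr h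
  set Φ₁ : Ω → ℝ := fun ω => Real.sqrt (g / c ω) with hΦ₁
  set Φ₂ : Ω → ℝ := fun ω => Real.sqrt ((1 - g) / (1 - c ω)) with hΦ₂
  -- The mean of the root of the likelihood ratio is the Bhattacharyya coefficient: given the class,
  -- `k` is Bernoulli with parameter `c`, so its indicator may be replaced by `c`.
  have key : ∑ ω, m ω * Real.sqrt (bern g (k ω) / bern (c ω) (k ω)) =
      ∑ ω, m ω * (Real.sqrt (c ω * g) + Real.sqrt ((1 - c ω) * (1 - g))) := by
    have e1 : ∀ ω, m ω * Real.sqrt (bern g (k ω) / bern (c ω) (k ω)) =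
        m ω * (ind (k ω) * (Φ₁ ω - Φ₂ ω)) + m ω * Φ₂ ω := by
      intro ω
      cases h : k ω
      · simp [bern, ind, hΦ₂]
      · simp only [bern, ind, hΦ₁, hΦ₂, if_true]
        ring
    have e2 : ∀ a b : ℝ, 0 ≤ a → a * Real.sqrt (b / a) = Real.sqrt (a * b) := by
      intro a b ha
      rcases ha.eq_or_lt with h0 | h0
      · simp [← h0]
      · rw [Real.sqrt_div' _ ha, Real.sqrt_mul ha]
        have := Real.mul_self_sqrt ha
        have hne := (Real.sqrt_pos.2 h0).ne'
        field_simp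
        rw [sq, this, mul_comm]
    simp only [e1, Finset.sum_add_distrib]
    rw [← sum_condAvg_mul (π := π) hm (fun ω => ind (k ω)) (Φ := fun ω => Φ₁ ω - Φ₂ ω)
      (fun ω ω' h => by simp only [hΦ₁, hΦ₂, hcc ω ω' h]), ← Finset.sum_add_distrib]
    refine Finset.sum_congr rfl fun ω _ => ?_
    rw [← e2 _ g (hc0 ω), ← e2 _ (1 - g) (by linarith [hc1 ω])]
    change m ω * (c ω * (Φ₁ ω - Φ₂ ω)) + m ω * Φ₂ ω = m ω * (c ω * Φ₁ ω + (1 - c ω) * Φ₂ ω)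
    ring
  -- Apply `log u ≤ u - 1` to the root of the likelihood ratio.
  have hlog : ∀ ω, m ω * (2 * (1 - Real.sqrt (bern g (k ω) / bern (c ω) (k ω)))) ≤
      m ω * (Real.log (bern (c ω) (k ω)) - Real.log (bern g (k ω))) := by
    intro ω
    rcases (hm ω).eq_or_lt with h0 | h0
    · simp [← h0]
    refine mul_le_mul_of_nonneg_left ?_ (hm ω)
    have h1 := hpos ω h0
    have h2 : 0 < bern (c ω) (k ω) := by
      have hb := classMass_refine (π := π) (π' := fun ω => (π ω, k ω)) (k := k) (ω := ω) hm
        (fun ω' => by simp) h0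
      have h3 := h0.trans_le (le_classMass (π := fun ω => (π ω, k ω)) hm ω)
      rw [hb] at h3
      exact pos_of_mul_pos_right h3 ((hm ω).trans (le_classMass hm ω))
    have h4 := Real.log_le_sub_one_of_pos (Real.sqrt_pos.2 (div_pos h1 h2))
    rw [Real.log_sqrt (div_pos h1 h2).le, Real.log_div h1.ne' h2.ne'] at h4
    linarith
  have hsq : ∀ ω, (Real.sqrt (c ω) - Real.sqrt g) ^ 2 ≤
      2 - 2 * (Real.sqrt (c ω * g) + Real.sqrt ((1 - c ω) * (1 - g))) := by
    intro ω
    have hc' : 0 ≤ 1 - c ω := by linarith [hc1 ω]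
    rw [Real.sqrt_mul (hc0 ω), Real.sqrt_mul hc']
    nlinarith [Real.sq_sqrt (hc0 ω), Real.sq_sqrt hg0, Real.sq_sqrt hc',
      Real.sq_sqrt (by linarith : 0 ≤ 1 - g),
      sq_nonneg (Real.sqrt (1 - c ω) - Real.sqrt (1 - g))]
  calc _ ≤ ∑ ω, m ω * (2 - 2 * (Real.sqrt (c ω * g) + Real.sqrt ((1 - c ω) * (1 - g)))) :=
        Finset.sum_le_sum fun ω _ => mul_le_mul_of_nonneg_left (hsq ω) (hm ω)
    _ = ∑ ω, m ω * (2 * (1 - Real.sqrt (bern g (k ω) / bern (c ω) (k ω)))) := by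
        simp only [mul_sub, Finset.sum_sub_distrib, mul_left_comm (m _) 2, ← Finset.mul_sum, key,
          mul_one]
    _ ≤ _ := Finset.sum_le_sum fun ω _ => hlog ω

/-- The entropy of a random variable with at most `N` values is at most `log N`. -/
theorem sum_neg_log_classMass_le (hm : ∀ ω, 0 ≤ m ω) (hm1 : ∑ ω, m ω = 1) {u : Finset X}
    (hu : ∀ ω, π ω ∈ u) :
    ∑ ω, m ω * (-Real.log (classMass m π ω)) ≤ Real.log u.card := by
  have hne : Nonempty Ω := by
    by_contra h
    rw [not_nonempty_iff] at h
    simp at hm1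
  have hN : (0 : ℝ) < u.card := by
    exact_mod_cast Finset.card_pos.2 ⟨_, hu hne.some⟩
  -- Apply `log u ≤ u - 1` to the ratio of the uniform mass `1/N` and the class mass. Averaging then
  -- makes the linear terms cancel.
  have h1 : ∀ ω, m ω * (-Real.log (classMass m π ω)) ≤
      m ω * (1 / classMass m π ω) * (1 / u.card) + m ω * (Real.log u.card - 1) := by
    intro ω
    rcases (hm ω).eq_or_lt with h0 | h0
    · simp [← h0]
    have hh := h0.trans_le (le_classMass (π := π) hm ω)
    have h2 := Real.log_le_sub_one_of_pos (one_div_pos.2 (mul_pos hh hN))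
    rw [one_div, Real.log_inv, Real.log_mul hh.ne' hN.ne'] at h2
    have h3 : -Real.log (classMass m π ω) ≤
        1 / classMass m π ω * (1 / u.card) + (Real.log u.card - 1) := by
      rw [one_div_mul_one_div, one_div]; linarith
    have := mul_le_mul_of_nonneg_left h3 (hm ω)
    linarith
  have h2 : ∑ ω, m ω * (1 / classMass m π ω) ≤ u.card := by
    rw [← Finset.sum_fiberwise_of_maps_to (s := Finset.univ) (t := u) (g := π) fun ω _ => hu ω]
    calc _ ≤ ∑ _x ∈ u, (1 : ℝ) := by
          refine Finset.sum_le_sum fun x _ => ?_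
          by_cases hx : ∃ ω, π ω = x
          · obtain ⟨ω₀, rfl⟩ := hx
            have e : ∀ ω ∈ Finset.univ.filter (fun ω => π ω = π ω₀),
                m ω * (1 / classMass m π ω) = m ω * (1 / classMass m π ω₀) := by
              intro ω hω
              rw [classMass_congr (Finset.mem_filter.1 hω).2]
            rw [Finset.sum_congr rfl e, ← Finset.sum_mul, Finset.sum_filter]
            change classMass m π ω₀ * _ ≤ 1
            rw [mul_one_div]
            exact div_self_le_one _
          · rw [Finset.filter_false_of_mem (fun ω _ h => hx ⟨ω, h⟩)]
            simp
      _ = u.card := by simp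
  calc _ ≤ ∑ ω, (m ω * (1 / classMass m π ω) * (1 / u.card) + m ω * (Real.log u.card - 1)) :=
        Finset.sum_le_sum fun ω _ => h1 ω
    _ = (∑ ω, m ω * (1 / classMass m π ω)) * (1 / u.card) + (Real.log u.card - 1) := by
        rw [Finset.sum_add_distrib, ← Finset.sum_mul, ← Finset.sum_mul, hm1, one_mul]
    _ ≤ u.card * (1 / u.card) + (Real.log u.card - 1) := by gcongr
    _ = Real.log u.card := by field_simp; ring

end CondAvg

/-! ### The mask -/

section Mask

variable {te : ℕ} {t0 : ℕ} {γ : ℝ}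

/-- Whether the time with index `r` is kept; times outside the range are not. -/
def keptAt (K : Fin te → Bool) (r : ℕ) : Bool := if h : r < te then K ⟨r, h⟩ else false

/-- The number of kept times, and the mask before the time with index `r`. -/
def maskPast (r : ℕ) (K : Fin te → Bool) : ℕ × (Fin te → Bool) :=
  (numKept K, fun r' => if (r' : ℕ) < r then K r' else false)

/-- The probability that the time with index `r` is kept, given the earlier part of the mask and
the total number of kept times. -/
def predicted (t0 : ℕ) (γ : ℝ) (K : Fin te → Bool) (r : ℕ) : ℝ :=
  condAvg (maskProb t0 γ) (maskPast r) (fun K' => ind (keptAt K' r)) K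

theorem keepProb_pos (hγ : 0 < γ) {t : ℕ} (ht : 0 < t) : 0 < keepProb t0 γ t := by
  unfold keepProb
  split_ifs
  · exact one_pos
  · exact lt_min (div_pos hγ (by exact_mod_cast ht)) one_pos

theorem keepProb_le_one (t : ℕ) : keepProb t0 γ t ≤ 1 := by
  unfold keepProb
  split_ifs
  exacts [le_rfl, min_le_right _ _]

theorem maskProb_nonneg (hγ : 0 < γ) (K : Fin te → Bool) : 0 ≤ maskProb t0 γ K :=
  Finset.prod_nonneg fun _ _ =>
    bern_nonneg (keepProb_pos hγ (Nat.succ_pos _)).le (keepProb_le_one _) _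

theorem sum_maskProb : ∑ K : Fin te → Bool, maskProb t0 γ K = 1 := sum_prod_bern _

theorem sum_maskProb_kept {r : ℕ} (hr : r < te) :
    ∑ K : Fin te → Bool, maskProb t0 γ K * ind (keptAt K r) = keepProb t0 γ (r + 1) := by
  simp only [keptAt, hr, dif_pos]
  exact sum_prod_bern_ind (fun r : Fin te => keepProb t0 γ (time r)) ⟨r, hr⟩

theorem maskPast_succ_eq_iff {r : ℕ} (hr : r < te) (K K' : Fin te → Bool) :
    maskPast (r + 1) K' = maskPast (r + 1) K ↔
      maskPast r K' = maskPast r K ∧ keptAt K' r = keptAt K r := by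
  simp only [maskPast, Prod.mk.injEq, keptAt, hr, dif_pos, and_assoc]
  refine and_congr_right fun _ => ⟨fun h => ⟨funext fun r' => ?_, ?_⟩, fun h => funext fun r' => ?_⟩
  · have := congrFun h r'
    by_cases hlt : (r' : ℕ) < r
    · simpa [hlt, Nat.lt_succ_of_lt hlt] using this
    · simp [hlt]
  · simpa using congrFun h ⟨r, hr⟩
  · rcases lt_trichotomy (r' : ℕ) r with hlt | heq | hgt
    · simpa [hlt, Nat.lt_succ_of_lt hlt] using congrFun h.1 r'
    · have : r' = ⟨r, hr⟩ := Fin.ext heq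
      simpa [this] using h.2
    · simp [show ¬ ((r' : ℕ) < r + 1) by omega]

theorem predicted_nonneg (hγ : 0 < γ) (K : Fin te → Bool) (r : ℕ) : 0 ≤ predicted t0 γ K r :=
  condAvg_nonneg (maskProb_nonneg hγ) (fun _ => by unfold ind; split_ifs <;> norm_num) _

theorem predicted_le_one (hγ : 0 < γ) (K : Fin te → Bool) (r : ℕ) : predicted t0 γ K r ≤ 1 :=
  condAvg_le_one (maskProb_nonneg hγ) (fun _ => by unfold ind; split_ifs <;> norm_num) _

theorem sum_predicted_mul (hγ : 0 < γ) (r : ℕ) {Φ : (Fin te → Bool) → ℝ}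
    (hΦ : ∀ K K', maskPast r K = maskPast r K' → Φ K = Φ K') :
    ∑ K, maskProb t0 γ K * (predicted t0 γ K r * Φ K) =
      ∑ K, maskProb t0 γ K * (ind (keptAt K r) * Φ K) :=
  sum_condAvg_mul (maskProb_nonneg hγ) _ hΦ

theorem sum_predicted (hγ : 0 < γ) {r : ℕ} (hr : r < te) :
    ∑ K : Fin te → Bool, maskProb t0 γ K * predicted t0 γ K r = keepProb t0 γ (r + 1) := by
  have := sum_predicted_mul (te := te) (t0 := t0) hγ r (Φ := fun _ => 1) fun _ _ _ => rfl
  simpa [sum_maskProb_kept hr] using this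

/-- The mean squared Hellinger distance between the predicted and the prior law of one entry of
the mask. -/
def hellinger (te t0 : ℕ) (γ : ℝ) (r : ℕ) : ℝ :=
  ∑ K : Fin te → Bool, maskProb t0 γ K *
    (Real.sqrt (predicted t0 γ K r) - Real.sqrt (keepProb t0 γ (r + 1))) ^ 2

theorem hellinger_nonneg (hγ : 0 < γ) (r : ℕ) : 0 ≤ hellinger te t0 γ r :=
  Finset.sum_nonneg fun K _ => mul_nonneg (maskProb_nonneg hγ K) (sq_nonneg _)

/-- The chain rule of probability: first reveal the count (`maskPast 0`), then the entries one by
one, each with its predicted probability. -/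
theorem classMass_maskPast (hγ : 0 < γ) (K : Fin te → Bool) (hK : 0 < maskProb t0 γ K) {r : ℕ}
    (hr : r ≤ te) : classMass (maskProb t0 γ) (maskPast r) K =
      classMass (maskProb t0 γ) (maskPast 0) K *
        ∏ l ∈ Finset.range r, bern (predicted t0 γ K l) (keptAt K l) := by
  induction r with
  | zero => simp
  | succ r ih =>
    rw [Finset.prod_range_succ, ← mul_assoc, ← ih (by omega)]
    exact classMass_refine (maskProb_nonneg hγ) (maskPast_succ_eq_iff (by omega) K) hK

/-- Each squared Hellinger distance is at most the relative entropy of the predicted against the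
prior law of that entry. Their sum telescopes through the chain rule to the mean of `-log` of the
probability of the count, its entropy. The count takes at most `te + 1` values. -/
theorem sum_hellinger_le (hγ : 0 < γ) :
    ∑ r ∈ Finset.range te, hellinger te t0 γ r ≤ Real.log (te + 1) := by
  have hm := maskProb_nonneg (te := te) (t0 := t0) hγ
  have hmask : ∀ K : Fin te → Bool, maskProb t0 γ K =
      ∏ r ∈ Finset.range te, bern (keepProb t0 γ (r + 1)) (keptAt K r) := by
    intro K
    rw [Finset.prod_range]
    refine Finset.prod_congr rfl fun r _ => ?_
    simp [keptAt, time]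
  have hbpos : ∀ K : Fin te → Bool, 0 < maskProb t0 γ K → ∀ r < te,
      0 < bern (keepProb t0 γ (r + 1)) (keptAt K r) := by
    intro K hK r hr
    refine lt_of_le_of_ne (bern_nonneg (keepProb_pos hγ (Nat.succ_pos _)).le
      (keepProb_le_one _) _) fun h => hK.ne' ?_
    rw [hmask]
    exact Finset.prod_eq_zero (Finset.mem_range.2 hr) h.symm
  calc ∑ r ∈ Finset.range te, hellinger te t0 γ r
      ≤ ∑ r ∈ Finset.range te, ∑ K : Fin te → Bool, maskProb t0 γ K *
          (Real.log (bern (predicted t0 γ K r) (keptAt K r)) -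
            Real.log (bern (keepProb t0 γ (r + 1)) (keptAt K r))) :=
        Finset.sum_le_sum fun r hr => sum_sqrt_sub_sq_le hm (fun K => keptAt K r)
          (keepProb_pos hγ (Nat.succ_pos _)).le (keepProb_le_one _)
          fun K hK => hbpos K hK r (Finset.mem_range.1 hr)
    _ = ∑ K : Fin te → Bool, maskProb t0 γ K *
          (-Real.log (classMass (maskProb t0 γ) (maskPast 0) K)) := by
        rw [Finset.sum_comm]
        refine Finset.sum_congr rfl fun K _ => ?_
        rw [← Finset.mul_sum]
        rcases (hm K).eq_or_lt with h0 | h0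
        · simp [← h0]
        congr 1
        have h1 := classMass_maskPast hγ K h0 le_rfl
        have h2 : classMass (maskProb t0 γ) (maskPast te) K = maskProb t0 γ K := by
          have hinj : ∀ K' : Fin te → Bool, maskPast te K' = maskPast te K ↔ K' = K := by
            refine fun K' => ⟨fun h => funext fun r => ?_, fun h => by rw [h]⟩
            simpa [maskPast] using congrFun (Prod.mk.inj h).2 r
          simp [classMass, hinj]
        rw [h2] at h1
        have hc := h0.trans_le (le_classMass (π := maskPast 0) hm K)
        have h3 : 0 < ∏ l ∈ Finset.range te, bern (predicted t0 γ K l) (keptAt K l) := by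
          rw [h1] at h0
          exact pos_of_mul_pos_right h0 hc.le
        have h4 := congrArg Real.log h1
        rw [Real.log_mul hc.ne' h3.ne', Real.log_prod
          (fun l hl h => h3.ne' (Finset.prod_eq_zero hl h)), hmask, Real.log_prod
          (fun l hl => (hbpos K h0 l (Finset.mem_range.1 hl)).ne')] at h4
        rw [Finset.sum_sub_distrib]
        linarith
    _ ≤ Real.log (te + 1) := by
        have h5 := sum_neg_log_classMass_le (π := maskPast (te := te) 0) hm sum_maskProb
          (u := (Finset.range (te + 1)).image fun s => (s, fun _ => false)) (fun K => by
            refine Finset.mem_image.2 ⟨numKept K, Finset.mem_range.2 ?_, by simp [maskPast]⟩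
            have := Finset.card_filter_le (Finset.univ : Finset (Fin te)) fun r => K r = true
            rw [Finset.card_univ, Fintype.card_fin] at this
            exact Nat.lt_succ_of_le this)
        rw [Finset.card_image_of_injective _ fun a b h => (Prod.mk.inj h).1,
          Finset.card_range] at h5
        simpa using h5

/-- The mean relative deviation between the predicted and the prior probability to be kept. -/
def deviation (te t0 : ℕ) (γ : ℝ) (r : ℕ) : ℝ :=
  ∑ K : Fin te → Bool, maskProb t0 γ K * |predicted t0 γ K r / keepProb t0 γ (r + 1) - 1|

theorem deviation_nonneg (hγ : 0 < γ) (r : ℕ) : 0 ≤ deviation te t0 γ r :=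
  Finset.sum_nonneg fun K _ => mul_nonneg (maskProb_nonneg hγ K) (abs_nonneg _)

/-- Factor the difference as a difference times a sum of square roots and apply Cauchy-Schwarz. The
first factor gives the Hellinger distance, the second is at most `2 √g`. Dividing by `g * (r + 1) =
γ` leaves the root of `1 / (r + 1)`. -/
theorem deviation_div_le (hγ : 0 < γ) {r : ℕ} (hr : r < te) :
    deviation te t0 γ r / (r + 1) ≤
      2 / Real.sqrt γ * (Real.sqrt (hellinger te t0 γ r) * Real.sqrt (1 / (r + 1))) := by
  set g := keepProb t0 γ (r + 1) with hg
  have hg0 : 0 < g := keepProb_pos hγ (Nat.succ_pos _)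
  have hm := maskProb_nonneg (te := te) (t0 := t0) hγ
  have hdev : deviation te t0 γ r =
      1 / g * ∑ K : Fin te → Bool, maskProb t0 γ K * |predicted t0 γ K r - g| := by
    unfold deviation
    rw [Finset.mul_sum]
    refine Finset.sum_congr rfl fun K _ => ?_
    rw [← hg, div_sub_one hg0.ne', abs_div, abs_of_pos hg0]; ring
  -- If the prior is `1`, the prediction is at most `1` with mean `1`, so the mean deviation is
  -- zero.
  rcases (keepProb_le_one (t0 := t0) (γ := γ) (r + 1)).eq_or_lt with h1 | h1
  · have : deviation te t0 γ r = 0 := by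
      have e : ∀ K : Fin te → Bool, maskProb t0 γ K * |predicted t0 γ K r - g| =
          maskProb t0 γ K - maskProb t0 γ K * predicted t0 γ K r := by
        intro K
        rw [hg, h1, abs_of_nonpos (by linarith [predicted_le_one (t0 := t0) hγ K r])]; ring
      rw [hdev]
      simp only [e, Finset.sum_sub_distrib, sum_maskProb, sum_predicted hγ hr, h1, sub_self,
        mul_zero]
    rw [this, zero_div]
    positivity
  · have hg' : g = γ / (r + 1) := by
      rw [hg] at *
      unfold keepProb at h1 ⊢
      split_ifs at h1 ⊢ with h
      · exact absurd h1 (lt_irrefl _)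
      · rw [min_eq_left (le_of_not_ge fun h' => by rw [min_eq_right h'] at h1; exact lt_irrefl _ h1)]
        push_cast; rfl
    have hcs : (∑ K : Fin te → Bool, maskProb t0 γ K * |predicted t0 γ K r - g|) ^ 2 ≤
        hellinger te t0 γ r * (4 * g) := by
      have h2 := Finset.sum_mul_sq_le_sq_mul_sq (Finset.univ : Finset (Fin te → Bool))
        (fun K => Real.sqrt (maskProb t0 γ K) * |Real.sqrt (predicted t0 γ K r) - Real.sqrt g|)
        (fun K => Real.sqrt (maskProb t0 γ K) * (Real.sqrt (predicted t0 γ K r) + Real.sqrt g))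
      have e1 : ∀ K : Fin te → Bool, Real.sqrt (maskProb t0 γ K) *
          |Real.sqrt (predicted t0 γ K r) - Real.sqrt g| * (Real.sqrt (maskProb t0 γ K) *
            (Real.sqrt (predicted t0 γ K r) + Real.sqrt g)) =
          maskProb t0 γ K * |predicted t0 γ K r - g| := by
        intro K
        have hp := predicted_nonneg (t0 := t0) hγ K r
        have : predicted t0 γ K r - g = (Real.sqrt (predicted t0 γ K r) - Real.sqrt g) *
            (Real.sqrt (predicted t0 γ K r) + Real.sqrt g) := by
          nlinarith [Real.sq_sqrt hp, Real.sq_sqrt hg0.le]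
        rw [this, abs_mul, abs_of_nonneg (add_nonneg (Real.sqrt_nonneg _) (Real.sqrt_nonneg g))]
        linear_combination |Real.sqrt (predicted t0 γ K r) - Real.sqrt g| *
          (Real.sqrt (predicted t0 γ K r) + Real.sqrt g) * Real.mul_self_sqrt (hm K)
      have e2 : ∀ K : Fin te → Bool, (Real.sqrt (maskProb t0 γ K) *
          |Real.sqrt (predicted t0 γ K r) - Real.sqrt g|) ^ 2 =
          maskProb t0 γ K * (Real.sqrt (predicted t0 γ K r) - Real.sqrt g) ^ 2 := by
        intro K; rw [mul_pow, Real.sq_sqrt (hm K), sq_abs]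
      have e3 : ∑ K : Fin te → Bool, (Real.sqrt (maskProb t0 γ K) *
          (Real.sqrt (predicted t0 γ K r) + Real.sqrt g)) ^ 2 ≤ 4 * g := by
        calc _ ≤ ∑ K : Fin te → Bool, (2 * (maskProb t0 γ K * predicted t0 γ K r) +
              2 * g * maskProb t0 γ K) := by
              refine Finset.sum_le_sum fun K _ => ?_
              have hp := predicted_nonneg (t0 := t0) hγ K r
              rw [mul_pow, Real.sq_sqrt (hm K)]
              have : (Real.sqrt (predicted t0 γ K r) + Real.sqrt g) ^ 2 ≤
                  2 * predicted t0 γ K r + 2 * g := by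
                nlinarith [Real.sq_sqrt hp, Real.sq_sqrt hg0.le,
                  sq_nonneg (Real.sqrt (predicted t0 γ K r) - Real.sqrt g)]
              have := mul_le_mul_of_nonneg_left this (hm K)
              linarith
          _ = 4 * g := by
              rw [Finset.sum_add_distrib, ← Finset.mul_sum, ← Finset.mul_sum, sum_maskProb,
                sum_predicted hγ hr]
              ring
      simp only [e1, e2] at h2
      exact h2.trans (mul_le_mul_of_nonneg_left e3 (hellinger_nonneg hγ r))
    have h3 := Real.le_sqrt_of_sq_le hcs
    rw [Real.sqrt_mul (hellinger_nonneg hγ r), Real.sqrt_mul (by norm_num),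
      show (4 : ℝ) = 2 ^ 2 by norm_num, Real.sqrt_sq (by norm_num)] at h3
    have hr1 : (0 : ℝ) < r + 1 := by positivity
    have hsg : Real.sqrt g = Real.sqrt γ * Real.sqrt (1 / (r + 1)) := by
      rw [hg', div_eq_mul_one_div, Real.sqrt_mul hγ.le]
    have h4 : 1 / g * (1 / (r + 1)) = 1 / γ := by rw [hg']; field_simp
    have hsγ := Real.sqrt_pos.2 hγ
    calc deviation te t0 γ r / (r + 1) = (1 / g * (1 / (r + 1))) *
          ∑ K : Fin te → Bool, maskProb t0 γ K * |predicted t0 γ K r - g| := by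
          rw [hdev]; ring
      _ ≤ 1 / γ * (Real.sqrt (hellinger te t0 γ r) * (2 * Real.sqrt g)) := by
          rw [h4]; exact mul_le_mul_of_nonneg_left h3 (by positivity)
      _ = _ := by
          rw [hsg]
          have := Real.mul_self_sqrt hγ.le
          field_simp
          rw [sq, this, mul_comm]

/-- Cauchy-Schwarz over the times: the Hellinger distances sum to at most `2 log te` and the
harmonic sum is at most `3 log te`. Both use `te ≥ 2`. -/
theorem sum_deviation_div_le (hγ : 0 < γ) (hte : 2 ≤ te) :
    ∑ r ∈ Finset.range te, deviation te t0 γ r / (r + 1) ≤ 6 * Real.log te / Real.sqrt γ := by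
  have hte' : (2 : ℝ) ≤ te := by exact_mod_cast hte
  have hl2 : Real.log 2 ≤ Real.log te := Real.log_le_log (by norm_num) hte'
  have hl := Real.log_two_gt_d9
  have hL1 : Real.log (te + 1) ≤ 2 * Real.log te := by
    have h : Real.log (te + 1) ≤ Real.log ((te : ℝ) ^ 2) :=
      Real.log_le_log (by linarith) (by nlinarith)
    rw [Real.log_pow] at h
    exact_mod_cast h
  have hL2 : ∑ r ∈ Finset.range te, (1 / ((r : ℝ) + 1)) ≤ 3 * Real.log te := by
    have h := harmonic_le_one_add_log te
    have e : ((harmonic te : ℚ) : ℝ) = ∑ r ∈ Finset.range te, (1 / ((r : ℝ) + 1)) := by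
      simp [harmonic]
    rw [e] at h
    linarith
  calc ∑ r ∈ Finset.range te, deviation te t0 γ r / (r + 1)
      ≤ ∑ r ∈ Finset.range te, 2 / Real.sqrt γ *
          (Real.sqrt (hellinger te t0 γ r) * Real.sqrt (1 / (r + 1))) :=
        Finset.sum_le_sum fun r hr => deviation_div_le hγ (Finset.mem_range.1 hr)
    _ ≤ 2 / Real.sqrt γ * (3 * Real.log te) := by
        rw [← Finset.mul_sum]
        refine mul_le_mul_of_nonneg_left ?_ (by positivity)
        have h := Finset.sum_mul_sq_le_sq_mul_sq (Finset.range te)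
          (fun r => Real.sqrt (hellinger te t0 γ r)) (fun r : ℕ => Real.sqrt (1 / ((r : ℝ) + 1)))
        simp only [Real.sq_sqrt (hellinger_nonneg hγ _)] at h
        have e : ∀ r : ℕ, Real.sqrt (1 / ((r : ℝ) + 1)) ^ 2 = 1 / ((r : ℝ) + 1) := fun r =>
          Real.sq_sqrt (by positivity)
        simp only [e] at h
        refine le_of_abs_le (abs_le_of_sq_le_sq (h.trans ?_) (by linarith))
        have h1 := mul_le_mul ((sum_hellinger_le (te := te) (t0 := t0) hγ).trans hL1) hL2
          (Finset.sum_nonneg fun r _ => by positivity) (by linarith)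
        nlinarith
    _ = _ := by ring

end Mask

/-! ### The noise of the mask -/

section Noise

variable {n te t0 : ℕ} {γ : ℝ} {δ : Fin n → Fin n → ℝ} {q : Fin n → ℝ} {D η : ℝ}

/-- Averaged over the mask, `N` is a martingale for the filtration of mask pasts enlarged by the
count, so its second moment is a sum of conditional variances. Each is at most the squared degree
times `1 / γ^t`, since the variance of the entry is at most `γ^t`. -/
theorem sum_expect_noise_sq_le (hγ : 0 < γ) {p : (Fin te → Bool) → ℕ → Step n}
    (hp : ∀ K, IsRun q D η (p K)) (hq : ∀ i, 0 < q i) (hD : 1 ≤ D) (hδ : IsFinMetric δ)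
    {s₀ : State n} (hs₀ : ∀ i, |s₀.y i| ≤ 1) (hN : ∀ i, s₀.N i = 0)
    (hpast : ∀ r K K', maskPast r K = maskPast r K' → ∀ l < r, p K l = p K' l)
    (hearly : ∀ K r, (p K r).early = decide (r < t0)) (hkept : ∀ K r, (p K r).kept = keptAt K r)
    (hrate : ∀ K r, (p K r).rate = keepProb t0 γ (r + 1))
    (hpred : ∀ K r, (p K r).pred = predicted t0 γ K r) (i : Fin n) {T : ℕ} (hT : T ≤ te) :
    ∑ K, maskProb t0 γ K * expect δ (p K) s₀ T (fun s => s.N i ^ 2) ≤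
      degree δ i ^ 2 * ∑ r ∈ Finset.range T, 1 / keepProb t0 γ (r + 1) := by
  induction T with
  | zero => simp [expect, hN]
  | succ T ih =>
    specialize ih (by omega)
    set g := keepProb t0 γ (T + 1)
    have hg : 0 < g := keepProb_pos hγ (Nat.succ_pos _)
    have hm := maskProb_nonneg (te := te) (t0 := t0) hγ
    -- Given the state, the target sides depend on the time but not on the mask, so the same `H`
    -- serves all masks.
    set H : State n → ℝ := fun s => ∑ j, δ i j *
      (if s.act j then s.y j else
        if decide (T < t0) then s.y j else if ∑ k, δ j k * s.S k < 0 then 1 else -1) with hH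
    have hHeq : ∀ K s, H s = ∑ j, δ i j * (p K T).target δ s j := by
      intro K s
      simp only [hH, Step.target, Step.greedy, hearly]
    have hHle : ∀ s : State n, (∀ i, |s.y i| ≤ 1) → H s ^ 2 ≤ degree δ i ^ 2 := by
      intro s hs
      rw [hHeq (fun _ => false) s, ← sq_abs]
      exact pow_le_pow_left₀ (abs_nonneg _)
        (abs_sum_mul_le_degree hδ (fun j => Step.abs_target_le hs j) i) 2
    set k : (Fin te → Bool) → ℝ := fun K => ind (keptAt K T)
    set c : (Fin te → Bool) → ℝ := fun K => predicted t0 γ K T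
    set Φ : (Fin te → Bool) → ℝ := fun K => expect δ (p K) s₀ T fun s => s.N i * H s with hΦ
    have hΦc : ∀ K K', maskPast T K = maskPast T K' → Φ K = Φ K' := fun K K' h =>
      expect_congr (hpast T K K' h) _
    have hcc : ∀ K K' : Fin te → Bool, maskPast T K = maskPast T K' → c K = c K' :=
      fun K K' h => condAvg_congr h
    have hstep : ∀ K, expect δ (p K) s₀ (T + 1) (fun s => s.N i ^ 2) ≤
        (expect δ (p K) s₀ T (fun s => s.N i ^ 2) + 2 * ((k K - c K) / g) * Φ K) +
          ((k K - c K) / g) ^ 2 * degree δ i ^ 2 := by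
      intro K
      have h1 : expect δ (p K) s₀ (T + 1) (fun s => s.N i ^ 2) ≤ expect δ (p K) s₀ T fun s =>
          (s.N i ^ 2 + 2 * ((k K - c K) / g) * (s.N i * H s)) +
            ((k K - c K) / g) ^ 2 * degree δ i ^ 2 := by
        refine expect_mono (hp K) hq hD hs₀ T fun s hs => ?_
        simp only [Step.next, ← hHeq K s, hkept, hrate, hpred]
        rw [← Finset.sum_mul, (((hp K).valid T).isSparse hq (by linarith) _).sum_eq_one, one_mul]
        have := mul_le_mul_of_nonneg_left (hHle s hs) (sq_nonneg ((k K - c K) / g))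
        change (s.N i + (k K - c K) / g * H s) ^ 2 ≤ _
        nlinarith
      rwa [expect_add, expect_add, expect_const_mul, expect_const (hp K) hq hD] at h1
    -- Orthogonality: `Φ` depends on the mask only through `maskPast T`, given which the kept
    -- indicator has mean `predicted`.
    have hcross : ∑ K, maskProb t0 γ K * (2 * ((k K - c K) / g) * Φ K) = 0 := by
      have h1 := sum_predicted_mul (t0 := t0) hγ T hΦc
      have e : ∀ K, maskProb t0 γ K * (2 * ((k K - c K) / g) * Φ K) =
          2 / g * (maskProb t0 γ K * (k K * Φ K) - maskProb t0 γ K * (c K * Φ K)) := by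
        intro K; ring
      simp only [e, ← Finset.mul_sum, Finset.sum_sub_distrib]
      rw [h1, sub_self, mul_zero]
    have hvar : ∑ K, maskProb t0 γ K * (k K - c K) ^ 2 ≤ g := by
      have h1 := sum_predicted_mul (t0 := t0) hγ T hcc
      have h2 : ∑ K, maskProb t0 γ K * k K = g := sum_maskProb_kept (by omega)
      have e : ∀ K, maskProb t0 γ K * (k K - c K) ^ 2 = maskProb t0 γ K * k K -
          2 * (maskProb t0 γ K * (k K * c K)) + maskProb t0 γ K * (c K * c K) := by
        intro K
        have : k K * k K = k K := ind_mul_self _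
        linear_combination maskProb t0 γ K * this
      simp only [e, Finset.sum_add_distrib, Finset.sum_sub_distrib, ← Finset.mul_sum]
      have h3 : 0 ≤ ∑ K, maskProb t0 γ K * (c K * c K) :=
        Finset.sum_nonneg fun K _ => mul_nonneg (hm K) (mul_self_nonneg _)
      change ∑ K, maskProb t0 γ K * (c K * c K) = ∑ K, maskProb t0 γ K * (k K * c K) at h1
      linarith
    have hvar' : ∑ K, maskProb t0 γ K * (((k K - c K) / g) ^ 2 * degree δ i ^ 2) ≤
        degree δ i ^ 2 * (1 / g) := by
      have e : ∀ K, maskProb t0 γ K * (((k K - c K) / g) ^ 2 * degree δ i ^ 2) =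
          degree δ i ^ 2 / g ^ 2 * (maskProb t0 γ K * (k K - c K) ^ 2) := by
        intro K; field_simp
      simp only [e, ← Finset.mul_sum]
      refine (mul_le_mul_of_nonneg_left hvar (by positivity)).trans (le_of_eq ?_)
      field_simp
    rw [Finset.sum_range_succ, mul_add]
    calc _ ≤ ∑ K, maskProb t0 γ K * ((expect δ (p K) s₀ T (fun s => s.N i ^ 2) +
          2 * ((k K - c K) / g) * Φ K) + ((k K - c K) / g) ^ 2 * degree δ i ^ 2) :=
          Finset.sum_le_sum fun K _ => mul_le_mul_of_nonneg_left (hstep K) (hm K)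
      _ = ∑ K, maskProb t0 γ K * expect δ (p K) s₀ T (fun s => s.N i ^ 2) +
          ∑ K, maskProb t0 γ K * (2 * ((k K - c K) / g) * Φ K) +
          ∑ K, maskProb t0 γ K * (((k K - c K) / g) ^ 2 * degree δ i ^ 2) := by
          simp only [mul_add, Finset.sum_add_distrib]
      _ ≤ _ := by rw [hcross, add_zero]; exact add_le_add ih hvar'

end Noise

/-! ### Summing up the errors -/

theorem sum_Ico_one_div_sq_le {t0 : ℕ} (ht0 : 1 ≤ t0) (te : ℕ) :
    ∑ r ∈ Finset.Ico t0 te, 1 / ((r : ℝ) + 1) ^ 2 ≤ 1 / (t0 : ℝ) := by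
  have h0 : (0 : ℝ) < t0 := by exact_mod_cast ht0
  rcases le_total te t0 with h | h
  · rw [Finset.Ico_eq_empty (by omega)]; simp
  have key : ∑ r ∈ Finset.Ico t0 te, 1 / ((r : ℝ) + 1) ^ 2 ≤ 1 / (t0 : ℝ) - 1 / te := by
    induction te, h using Nat.le_induction with
    | base => simp
    | succ T hT ih =>
      rw [Finset.sum_Ico_succ_top hT]
      have hT0 : (0 : ℝ) < T := by exact_mod_cast (by omega : 0 < T)
      have : 1 / ((T : ℝ) + 1) ^ 2 ≤ 1 / T - 1 / ((T + 1 : ℕ) : ℝ) := by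
        push_cast
        rw [div_sub_div _ _ hT0.ne' (by positivity), div_le_div_iff₀ (by positivity) (by positivity)]
        nlinarith
      linarith
  have : (0 : ℝ) ≤ 1 / te := by positivity
  linarith

/-- Telescoping against `2 / √r`. -/
theorem sum_Ico_sqrt_div_le {t0 : ℕ} (ht0 : 1 ≤ t0) (te : ℕ) :
    ∑ r ∈ Finset.Ico t0 te, Real.sqrt r / (((r : ℝ) + 1) * r) ≤ 2 / Real.sqrt t0 := by
  rcases le_total te t0 with h | h
  · rw [Finset.Ico_eq_empty (by omega), Finset.sum_empty]; positivity
  have key : ∑ r ∈ Finset.Ico t0 te, Real.sqrt r / (((r : ℝ) + 1) * r) ≤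
      2 / Real.sqrt t0 - 2 / Real.sqrt te := by
    induction te, h using Nat.le_induction with
    | base => simp
    | succ T hT ih =>
      rw [Finset.sum_Ico_succ_top hT]
      have hT0 : (0 : ℝ) < T := by exact_mod_cast (by omega : 0 < T)
      have : Real.sqrt T / (((T : ℝ) + 1) * T) ≤
          2 / Real.sqrt T - 2 / Real.sqrt ((T + 1 : ℕ) : ℝ) := by
        push_cast
        set a := Real.sqrt T with ha
        set b := Real.sqrt ((T : ℝ) + 1) with hb
        have ha0 : 0 < a := Real.sqrt_pos.2 hT0
        have hb0 : 0 < b := Real.sqrt_pos.2 (by positivity)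
        have ha2 : (T : ℝ) = a ^ 2 := (Real.sq_sqrt hT0.le).symm
        have hb2 : (T : ℝ) + 1 = b ^ 2 := (Real.sq_sqrt (by positivity)).symm
        have hab : a ≤ b := Real.sqrt_le_sqrt (by linarith)
        rw [hb2, ha2, div_sub_div _ _ ha0.ne' hb0.ne', div_le_div_iff₀ (by positivity)
          (by positivity)]
        have h1 : (b - a) * (b + a) = 1 := by nlinarith
        have h2 : 1 ≤ 2 * b * (b - a) := by nlinarith
        have h3 : 0 < a ^ 2 * b := by positivity
        nlinarith [mul_le_mul_of_nonneg_left h2 h3.le]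
      linarith
  have : (0 : ℝ) ≤ 2 / Real.sqrt te := by positivity
  linarith

/-- Exchange the sums: the weights `1 / (r (r + 1))` over `r > l` telescope to at most `1 / (l +
1)`. The induction carries the boundary term. -/
theorem sum_Ico_partial_sum_le {t0 : ℕ} (ht0 : 1 ≤ t0) (te : ℕ) {d : ℕ → ℝ} (hd : ∀ r, 0 ≤ d r) :
    ∑ r ∈ Finset.Ico t0 te, 1 / (((r : ℝ) + 1) * r) * ∑ l ∈ Finset.range r, d l ≤
      ∑ r ∈ Finset.range te, d r / (r + 1) := by
  rcases le_total te t0 with h | h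
  · rw [Finset.Ico_eq_empty (by omega), Finset.sum_empty]
    exact Finset.sum_nonneg fun r _ => div_nonneg (hd r) (by positivity)
  have key : ∑ r ∈ Finset.Ico t0 te, 1 / (((r : ℝ) + 1) * r) * ∑ l ∈ Finset.range r, d l ≤
      ∑ r ∈ Finset.range te, d r / (r + 1) - (∑ l ∈ Finset.range te, d l) / te := by
    induction te, h using Nat.le_induction with
    | base =>
      rw [Finset.Ico_self, Finset.sum_empty, sub_nonneg, Finset.sum_div]
      refine Finset.sum_le_sum fun r hr => div_le_div_of_nonneg_left (hd r) (by positivity) ?_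
      exact_mod_cast Finset.mem_range.1 hr
    | succ T hT ih =>
      have hT0 : (0 : ℝ) < T := by exact_mod_cast (by omega : 0 < T)
      rw [Finset.sum_Ico_succ_top hT, Finset.sum_range_succ, Finset.sum_range_succ d T]
      have : 1 / (((T : ℝ) + 1) * T) * ∑ l ∈ Finset.range T, d l =
          (∑ l ∈ Finset.range T, d l) / T + d T / (T + 1) -
            (∑ l ∈ Finset.range T, d l + d T) / ((T + 1 : ℕ) : ℝ) := by
        push_cast
        field_simp
        ring
      linarith
  have : 0 ≤ (∑ l ∈ Finset.range te, d l) / (te : ℝ) :=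
    div_nonneg (Finset.sum_nonneg fun l _ => hd l) (by positivity)
  linarith

theorem sum_range_one_div_le {te : ℕ} (hte : 2 ≤ te) :
    ∑ r ∈ Finset.range te, 1 / ((r : ℝ) + 1) ≤ 3 * Real.log te := by
  have h := harmonic_le_one_add_log te
  have e : ((harmonic te : ℚ) : ℝ) = ∑ r ∈ Finset.range te, (1 / ((r : ℝ) + 1)) := by
    simp [harmonic]
  have hl2 : Real.log 2 ≤ Real.log te := Real.log_le_log (by norm_num) (by exact_mod_cast hte)
  have hl := Real.log_two_gt_d9
  rw [e] at h
  linarith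

/-- Jensen's inequality for the square root, by Cauchy-Schwarz. -/
theorem sum_mul_sqrt_le {Ω : Type*} [Fintype Ω] {m : Ω → ℝ} (hm : ∀ ω, 0 ≤ m ω)
    (hm1 : ∑ ω, m ω = 1) {f : Ω → ℝ} (hf : ∀ ω, 0 ≤ f ω) :
    ∑ ω, m ω * Real.sqrt (f ω) ≤ Real.sqrt (∑ ω, m ω * f ω) := by
  refine Real.le_sqrt_of_sq_le ?_
  have h := Finset.sum_mul_sq_le_sq_mul_sq Finset.univ (fun ω => Real.sqrt (m ω))
    (fun ω => Real.sqrt (m ω) * Real.sqrt (f ω))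
  simp only [← mul_assoc, Real.mul_self_sqrt (hm _), mul_pow, Real.sq_sqrt (hm _),
    Real.sq_sqrt (hf _), hm1, one_mul] at h
  exact h

/-! ### The total error, averaged over the masks -/

section Total

variable {n te t0 : ℕ} {γ : ℝ} {δ : Fin n → Fin n → ℝ} {D η ε : ℝ}

/-- The runs of the process for all masks. -/
structure IsMaskedRun (q : Fin n → ℝ) (D η : ℝ) (t0 : ℕ) (γ : ℝ)
    (p : (Fin te → Bool) → ℕ → Step n) : Prop where
  isRun : ∀ K, IsRun q D η (p K)
  past : ∀ r K K', maskPast r K = maskPast r K' → ∀ l < r, p K l = p K' l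
  early : ∀ K r, (p K r).early = decide (r < t0)
  kept : ∀ K r, (p K r).kept = keptAt K r
  rate : ∀ K r, (p K r).rate = keepProb t0 γ (r + 1)
  pred : ∀ K r, (p K r).pred = predicted t0 γ K r

variable {q : Fin n → ℝ} {p : (Fin te → Bool) → ℕ → Step n} {y : Fin n → ℝ}

/-- For times up to `r`, the inverse keeping probability is at most `1 + r/γ`. A square is the
convenient form because the sum appears under roots. -/
theorem sum_inv_keepProb_le (hγ : 0 < γ) (r : ℕ) :
    ∑ l ∈ Finset.range r, (1 + 1 / keepProb t0 γ (l + 1)) ≤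
      (2 * Real.sqrt r + r / Real.sqrt γ) ^ 2 := by
  have h1 : ∀ l ∈ Finset.range r, 1 + 1 / keepProb t0 γ (l + 1) ≤ 2 + r / γ := by
    intro l hl
    have hlr : ((l + 1 : ℕ) : ℝ) ≤ r := by exact_mod_cast Finset.mem_range.1 hl
    have hl0 : (0 : ℝ) < ((l + 1 : ℕ) : ℝ) := by positivity
    have hr0 : 0 ≤ (r : ℝ) / γ := by positivity
    unfold keepProb
    split_ifs
    · norm_num; linarith
    · rcases min_cases (γ / ((l + 1 : ℕ) : ℝ)) 1 with h | h
      · rw [h.1, one_div_div]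
        have : ((l + 1 : ℕ) : ℝ) / γ ≤ r / γ := by gcongr
        linarith
      · rw [h.1]; linarith
  refine (Finset.sum_le_sum h1).trans ?_
  rw [Finset.sum_const, Finset.card_range, nsmul_eq_mul]
  have h2 := Real.sq_sqrt (Nat.cast_nonneg (α := ℝ) r)
  have h3 := Real.sq_sqrt hγ.le
  have h4 : (r / Real.sqrt γ) ^ 2 = (r : ℝ) * (r / γ) := by rw [div_pow, h3]; ring
  have h5 : 0 ≤ Real.sqrt r * (r / Real.sqrt γ) := by positivity
  nlinarith [Nat.cast_nonneg (α := ℝ) r]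

variable (hp : IsMaskedRun q D η t0 γ p) (hγ : 0 < γ) (hq : ∀ i, 0 < q i) (hD : 1 ≤ D)
  (hη : 0 ≤ η) (hδ : IsFinMetric δ) (hy : ∀ i, |y i| ≤ 1)

include hp hγ hq hD hδ hy in
theorem sum_expect_abs_noise_le (i : Fin n) {T : ℕ} (hT : T ≤ te) :
    ∑ K, maskProb t0 γ K * expect δ (p K) (State.init y) T (fun s => |s.N i|) ≤
      degree δ i * (2 * Real.sqrt T + T / Real.sqrt γ) := by
  have hm := maskProb_nonneg (te := te) (t0 := t0) hγ
  have hmono : ∀ K, 0 ≤ expect δ (p K) (State.init y) T (fun s => s.N i ^ 2) := fun K => by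
    rw [← expect_const (δ := δ) (s₀ := State.init y) (hp.isRun K) hq hD T 0]
    exact expect_mono (hp.isRun K) hq hD hy T fun s _ => sq_nonneg _
  have h1 : ∀ K, expect δ (p K) (State.init y) T (fun s => |s.N i|) ≤
      Real.sqrt (expect δ (p K) (State.init y) T fun s => s.N i ^ 2) := fun K =>
    expect_abs_le_of_sq_le (hp.isRun K) hq hD hy T (Real.sqrt_nonneg _)
      (by rw [Real.sq_sqrt (hmono K)])
  refine (Finset.sum_le_sum fun K _ => mul_le_mul_of_nonneg_left (h1 K) (hm K)).trans ?_
  refine (sum_mul_sqrt_le hm sum_maskProb hmono).trans ?_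
  refine Real.sqrt_le_iff.2 ⟨mul_nonneg (hδ.degree_nonneg i) (by positivity), ?_⟩
  refine (sum_expect_noise_sq_le hγ hp.isRun hq hD hδ hy (fun _ => rfl) hp.past hp.early hp.kept
    hp.rate hp.pred i hT).trans ?_
  rw [mul_pow]
  refine mul_le_mul_of_nonneg_left ((Finset.sum_le_sum fun r _ => ?_).trans
    (sum_inv_keepProb_le (t0 := t0) hγ T)) (sq_nonneg _)
  linarith

include hp hγ hq hD hη hδ hy in
-- The second-moment bound is applied for each mask and only then averaged. In the drift, the
-- indicator of being kept cancels `γ^t`. In the variance it removes one of the two factors `1 /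
-- γ^t`, with Jensen moving the average under the root.
theorem sum_expect_abs_residual_le (hq1 : ∀ i, q i ≤ 1) (hη1 : η ≤ 1)
    (hηl : η * Real.log te ≤ 1) (hte : 1 ≤ te)
    (hsum : ∀ i, ∑ j, δ i j ^ 2 / q j ≤ 4 * degree δ i ^ 2) (i : Fin n) {T : ℕ} (hT : T ≤ te) :
    ∑ K, maskProb t0 γ K * expect δ (p K) (State.init y) T (fun s => |Step.residual δ s T i|) ≤
      degree δ i * (∑ r ∈ Finset.range T, (η + deviation te t0 γ r) +
        24 * Real.sqrt D * (2 * Real.sqrt T + T / Real.sqrt γ)) := by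
  have hm := maskProb_nonneg (te := te) (t0 := t0) hγ
  have hdeg := hδ.degree_nonneg i
  have hg : ∀ r, 0 < keepProb t0 γ (r + 1) := fun r => keepProb_pos hγ (Nat.succ_pos _)
  have hbias : ∀ K r, (p K r).bias η = ind (keptAt K r) / keepProb t0 γ (r + 1) * η +
      |predicted t0 γ K r / keepProb t0 γ (r + 1) - 1| := fun K r => by
    rw [Step.bias, hp.kept, hp.rate, hp.pred]
  have hind : ∀ b, 0 ≤ ind b := fun b => by unfold ind; split_ifs <;> norm_num
  have hbias0 : ∀ K r, 0 ≤ (p K r).bias η := fun K r => by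
    rw [hbias]
    exact add_nonneg (mul_nonneg (div_nonneg (hind _) (hg r).le) hη) (abs_nonneg _)
  set v : (Fin te → Bool) → ℕ → ℝ := fun K r =>
    (576 * D * degree δ i ^ 2) * (1 + ind (keptAt K r) / keepProb t0 γ (r + 1) ^ 2) with hv
  have hv0 : ∀ K r, 0 ≤ v K r := fun K r =>
    mul_nonneg (by positivity) (add_nonneg zero_le_one (div_nonneg (hind _) (by positivity)))
  have hspread : ∀ K, ∀ r < te,
      expect δ (p K) (State.init y) r (fun s => (p K r).spread δ q D s i) ≤ v K r := by
    intro K r hr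
    -- The survival bound gives `2 * 8 = 16`, and passing from `r` to `r + 1` costs one more since
    -- `D / q j ≥ 1`. Then `8 * (1 + 4 * 17) = 552` is rounded up to `576 = 24 ^ 2`.
    have h := expect_spread_le (δ := δ) (s₀ := State.init y) (hp.isRun K) hq hD (T := r) (i := i)
      (B := 17) (hsum i) (by norm_num) (fun j => by
        have h1 := (expect_inactive_mul_le (δ := δ) (s₀ := State.init y) (hp.isRun K) hq hD hy
          hq1 hη r j).trans (prod_one_add_div_le hη hη1 hηl hte hr.le)
        have h2 : expect δ (p K) (State.init y) r (fun s => ind (!s.act j)) ≤ 1 := by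
          rw [← expect_const (δ := δ) (s₀ := State.init y) (hp.isRun K) hq hD r 1]
          exact expect_mono (hp.isRun K) hq hD hy r fun s _ => by
            unfold ind; split_ifs <;> norm_num
        have h3 : 1 ≤ D / q j := by rw [le_div_iff₀ (hq j)]; linarith [hq1 j]
        have h4 : (r : ℝ) * expect δ (p K) (State.init y) r (fun s => ind (!s.act j)) ≤
            16 * (D / q j) := by
          have h5 : 0 < D / q j := by linarith
          have h6 := mul_le_mul_of_nonneg_left h1 (by positivity : 0 ≤ 2 * (D / q j))
          have hqj := hq j
          calc _ = 2 * (D / q j) * (q j / (2 * D) *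
                (r * expect δ (p K) (State.init y) r (fun s => ind (!s.act j)))) := by
                field_simp
            _ ≤ _ := h6
            _ = _ := by ring
        linarith)
    refine h.trans ?_
    rw [hp.kept, hp.rate, hv]
    refine mul_le_mul_of_nonneg_right ?_
      (add_nonneg zero_le_one (div_nonneg (hind _) (by positivity)))
    have : 0 ≤ D * degree δ i ^ 2 := by positivity
    nlinarith
  have hB : ∀ K, 0 ≤ degree δ i * ∑ r ∈ Finset.range T, (p K r).bias η +
      Real.sqrt (∑ r ∈ Finset.range T, v K r) := fun K =>
    add_nonneg (mul_nonneg hdeg (Finset.sum_nonneg fun r _ => hbias0 K r)) (Real.sqrt_nonneg _)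
  have h1 : ∀ K, expect δ (p K) (State.init y) T (fun s => |Step.residual δ s T i|) ≤
      degree δ i * ∑ r ∈ Finset.range T, (p K r).bias η +
        Real.sqrt (∑ r ∈ Finset.range T, v K r) := fun K =>
    expect_abs_le_of_sq_le (hp.isRun K) hq hD hy T (hB K)
      (expect_residual_sq_le (hp.isRun K) hq hD hy hη hδ i (by simp [Step.residual, State.init])
        (hv0 K) (hspread K) hT (hbias0 K))
  have h2 : ∑ K, maskProb t0 γ K * ∑ r ∈ Finset.range T, (p K r).bias η =
      ∑ r ∈ Finset.range T, (η + deviation te t0 γ r) := by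
    simp only [Finset.mul_sum]
    rw [Finset.sum_comm]
    refine Finset.sum_congr rfl fun r hr => ?_
    have hr' : r < te := (Finset.mem_range.1 hr).trans_le hT
    have e : ∀ K, maskProb t0 γ K * (p K r).bias η =
        η / keepProb t0 γ (r + 1) * (maskProb t0 γ K * ind (keptAt K r)) +
          maskProb t0 γ K * |predicted t0 γ K r / keepProb t0 γ (r + 1) - 1| := by
      intro K; rw [hbias]; ring
    simp only [e, Finset.sum_add_distrib, ← Finset.mul_sum, sum_maskProb_kept hr']
    rw [div_mul_cancel₀ _ (hg r).ne']
    rfl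
  have h3 : ∑ K, maskProb t0 γ K * ∑ r ∈ Finset.range T, v K r =
      576 * D * degree δ i ^ 2 * ∑ r ∈ Finset.range T, (1 + 1 / keepProb t0 γ (r + 1)) := by
    simp only [Finset.mul_sum]
    rw [Finset.sum_comm]
    refine Finset.sum_congr rfl fun r hr => ?_
    have hr' : r < te := (Finset.mem_range.1 hr).trans_le hT
    have e : ∀ K, maskProb t0 γ K * v K r = 576 * D * degree δ i ^ 2 * maskProb t0 γ K +
        576 * D * degree δ i ^ 2 / keepProb t0 γ (r + 1) ^ 2 *
          (maskProb t0 γ K * ind (keptAt K r)) := by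
      intro K; rw [hv]; ring
    simp only [e, Finset.sum_add_distrib, ← Finset.mul_sum, sum_maskProb_kept hr', sum_maskProb]
    have := hg r
    field_simp
  have h4 : ∑ K, maskProb t0 γ K * Real.sqrt (∑ r ∈ Finset.range T, v K r) ≤
      degree δ i * (24 * Real.sqrt D * (2 * Real.sqrt T + T / Real.sqrt γ)) := by
    refine (sum_mul_sqrt_le hm sum_maskProb fun K => Finset.sum_nonneg fun r _ => hv0 K r).trans ?_
    rw [h3]
    refine Real.sqrt_le_iff.2 ⟨by positivity, ?_⟩
    have h5 := mul_le_mul_of_nonneg_left (sum_inv_keepProb_le (t0 := t0) hγ T)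
      (by positivity : 0 ≤ 576 * D * degree δ i ^ 2)
    refine h5.trans (le_of_eq ?_)
    have := Real.sq_sqrt (by linarith : 0 ≤ D)
    rw [mul_pow, mul_pow (24 * Real.sqrt D), mul_pow 24, this]
    ring
  calc _ ≤ ∑ K, maskProb t0 γ K * (degree δ i * ∑ r ∈ Finset.range T, (p K r).bias η +
        Real.sqrt (∑ r ∈ Finset.range T, v K r)) :=
        Finset.sum_le_sum fun K _ => mul_le_mul_of_nonneg_left (h1 K) (hm K)
    _ = degree δ i * (∑ K, maskProb t0 γ K * ∑ r ∈ Finset.range T, (p K r).bias η) +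
        ∑ K, maskProb t0 γ K * Real.sqrt (∑ r ∈ Finset.range T, v K r) := by
        rw [Finset.mul_sum, ← Finset.sum_add_distrib]
        exact Finset.sum_congr rfl fun K _ => by ring
    _ ≤ _ := by rw [h2, mul_add]; linarith

include hp hγ hD hη hδ hy in
-- The hypotheses make each error source `O(ε W)`. The size of `t0` handles the second-order term
-- and the variance of the first samples, `γ` the information cost and the mask noise, `η` the
-- overestimates, and `te` the points never activated.
theorem sum_expect_cost_le (hqd : q = distShare δ) (hW : 0 < totalDist δ) (hε : 0 < ε)
    (hε1 : ε < 1) (hη1 : η ≤ 1) (hηl : η * Real.log te ≤ ε) (hte : 2 ≤ te)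
    (hnte : n * D ≤ ε * te) (hγε : D * Real.log te + 1 ≤ ε * Real.sqrt γ)
    (ht0 : Real.sqrt γ * D ≤ ε * t0) (ht0' : 1 ≤ ε * t0) :
    ∑ K, maskProb t0 γ K * expect δ (p K) (State.init y) te
        (fun s => (totalDist δ + (quad δ s.y + 4 * ∑ i, degree δ i * ind (!s.act i))) / 4) ≤
      (totalDist δ + quad δ y) / 4 + 201 * ε * totalDist δ := by
  have hm := maskProb_nonneg (te := te) (t0 := t0) hγ
  have hq : ∀ i, 0 < q i := fun i => hqd ▸ hδ.distShare_pos hW i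
  have hqs : ∑ i, q i = 1 := hqd ▸ sum_distShare hW.ne'
  have hq1 : ∀ i, q i ≤ 1 := fun i => hqs ▸
    Finset.single_le_sum (fun j _ => (hq j).le) (Finset.mem_univ i)
  have hsum : ∀ i, ∑ j, δ i j ^ 2 / q j ≤ 4 * degree δ i ^ 2 := fun i => by
    rw [hqd]; exact hδ.sum_sq_div_distShare_le hW i
  have hdeg : ∀ i, degree δ i = q i * totalDist δ := fun i => by
    rw [hqd, distShare_mul_totalDist hW.ne']
  have ht0pos : (0 : ℝ) < t0 := by
    by_contra h
    nlinarith [not_lt.1 h]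
  have ht01 : 1 ≤ t0 := by exact_mod_cast ht0pos
  have hte' : (0 : ℝ) < te := by exact_mod_cast (by omega : 0 < te)
  have hlog : 0 ≤ Real.log te := Real.log_nonneg (by exact_mod_cast (by omega : 1 ≤ te))
  have hsγ : 0 < Real.sqrt γ := Real.sqrt_pos.2 hγ
  have hsγ1 : 1 ≤ ε * Real.sqrt γ := by nlinarith
  set L := Real.log te
  set W := totalDist δ
  -- The constant `25` absorbs the `24` of the residual and the `1` of the mask noise, as `√D ≥ 1`.
  set M : ℕ → ℝ := fun r => ∑ l ∈ Finset.range r, (η + deviation te t0 γ l) +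
    25 * Real.sqrt D * (2 * Real.sqrt r + r / Real.sqrt γ) with hM
  have hsD : 1 ≤ Real.sqrt D := Real.one_le_sqrt.2 hD
  -- the drift of the cost, averaged over the masks
  have hquad : ∑ K, maskProb t0 γ K * expect δ (p K) (State.init y) te (fun s => quad δ s.y) ≤
      quad δ y + ∑ r ∈ Finset.Ico t0 te, (4 * W / (r + 1) ^ 2 + 4 / ((r + 1) * r) * (W * M r)) := by
    have h1 := fun K => expect_quad_le (s₀ := State.init y) (hp.isRun K) hq hD hy hδ ht01
      (hp.early K) te
    refine (Finset.sum_le_sum fun K _ => mul_le_mul_of_nonneg_left (h1 K) (hm K)).trans ?_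
    have hswap : ∀ (u : ℕ → ℝ) (G : (Fin te → Bool) → ℕ → ℝ), ∑ K : Fin te → Bool,
        maskProb t0 γ K * (quad δ y + ∑ r ∈ Finset.Ico t0 te, (u r + G K r)) =
        quad δ y + ∑ r ∈ Finset.Ico t0 te, (u r + ∑ K, maskProb t0 γ K * G K r) := by
      intro u G
      simp only [mul_add, Finset.sum_add_distrib, ← Finset.sum_mul, sum_maskProb, one_mul]
      simp only [Finset.mul_sum]
      rw [Finset.sum_comm (s := Finset.univ)]
    refine (hswap _ _).le.trans (add_le_add le_rfl (Finset.sum_le_sum fun r hr =>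
      add_le_add le_rfl ?_))
    have hrte : r ≤ te := (Finset.mem_Ico.1 hr).2.le
    have hr0 : (0 : ℝ) ≤ 4 / ((r + 1) * r) := by positivity
    have e : ∀ K, maskProb t0 γ K * (4 / (((r : ℝ) + 1) * r) *
        ∑ i, (expect δ (p K) (State.init y) r (fun s => |Step.residual δ s r i|) +
          expect δ (p K) (State.init y) r fun s => |s.N i|)) =
        4 / (((r : ℝ) + 1) * r) * ∑ i, (maskProb t0 γ K *
          expect δ (p K) (State.init y) r (fun s => |Step.residual δ s r i|) +
          maskProb t0 γ K * expect δ (p K) (State.init y) r fun s => |s.N i|) := by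
      intro K
      simp only [← mul_add, ← Finset.mul_sum]
      ring
    simp only [e]
    rw [← Finset.mul_sum, Finset.sum_comm]
    refine mul_le_mul_of_nonneg_left ?_ hr0
    calc _ ≤ ∑ i, degree δ i * M r := by
          refine Finset.sum_le_sum fun i _ => ?_
          rw [Finset.sum_add_distrib]
          have a1 := sum_expect_abs_residual_le hp hγ hq hD hη hδ hy hq1 hη1
            (hηl.trans hε1.le) (by omega) hsum i hrte
          have a2 := sum_expect_abs_noise_le hp hγ hq hD hδ hy i hrte
          have a3 : 0 ≤ degree δ i * (2 * Real.sqrt r + r / Real.sqrt γ) :=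
            mul_nonneg (hδ.degree_nonneg i) (by positivity)
          have a4 := mul_le_mul_of_nonneg_right hsD a3
          simp only [hM]
          linarith
      _ = W * M r := by rw [← Finset.sum_mul, ← totalDist_eq_sum_degree]
  -- the sum of the drifts
  have hone := sum_range_one_div_le hte
  have hIco : ∑ r ∈ Finset.Ico t0 te, 1 / ((r : ℝ) + 1) ≤ 3 * L := by
    refine le_trans (Finset.sum_le_sum_of_subset_of_nonneg (fun r hr => ?_)
      fun r _ _ => by positivity) hone
    exact Finset.mem_range.2 (Finset.mem_Ico.1 hr).2
  -- Here `740 = 4 * (1 + 3 + 6 + 100 + 75)`, from the bounds `b1` to `b5`. After division by `4`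
  -- this is `185`, and the `16` of the inactive points makes `201`.
  have hdrift : ∑ r ∈ Finset.Ico t0 te, (4 * W / ((r : ℝ) + 1) ^ 2 +
      4 / ((r + 1) * r) * (W * M r)) ≤ 740 * ε * W := by
    have e : ∀ r ∈ Finset.Ico t0 te, 4 * W / ((r : ℝ) + 1) ^ 2 + 4 / ((r + 1) * r) * (W * M r) =
        4 * W * (1 / ((r : ℝ) + 1) ^ 2 + η * (1 / ((r : ℝ) + 1)) +
          1 / (((r : ℝ) + 1) * r) * ∑ l ∈ Finset.range r, deviation te t0 γ l +
          50 * Real.sqrt D * (Real.sqrt r / (((r : ℝ) + 1) * r)) +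
          25 * Real.sqrt D / Real.sqrt γ * (1 / ((r : ℝ) + 1))) := by
      intro r hr
      have hr0 : (0 : ℝ) < r := by
        exact_mod_cast (by have := (Finset.mem_Ico.1 hr).1; omega : 0 < r)
      simp only [hM, Finset.sum_add_distrib, Finset.sum_const, Finset.card_range, nsmul_eq_mul]
      field_simp
      ring
    rw [Finset.sum_congr rfl e, ← Finset.mul_sum]
    simp only [Finset.sum_add_distrib, ← Finset.mul_sum]
    have b1 : ∑ r ∈ Finset.Ico t0 te, 1 / ((r : ℝ) + 1) ^ 2 ≤ ε := by
      refine (sum_Ico_one_div_sq_le ht01 te).trans ?_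
      rw [div_le_iff₀ ht0pos]; exact ht0'
    have b2 : η * ∑ r ∈ Finset.Ico t0 te, 1 / ((r : ℝ) + 1) ≤ 3 * ε := by
      have := mul_le_mul_of_nonneg_left hIco hη
      linarith
    have b3 : ∑ r ∈ Finset.Ico t0 te,
        1 / (((r : ℝ) + 1) * r) * ∑ l ∈ Finset.range r, deviation te t0 γ l ≤ 6 * ε := by
      refine (sum_Ico_partial_sum_le ht01 te fun r => deviation_nonneg hγ r).trans
        ((sum_deviation_div_le hγ hte).trans ?_)
      rw [div_le_iff₀ hsγ]
      nlinarith
    have b4 : 50 * Real.sqrt D * ∑ r ∈ Finset.Ico t0 te, Real.sqrt r / (((r : ℝ) + 1) * r) ≤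
        100 * ε := by
      have c1 := mul_le_mul_of_nonneg_left (sum_Ico_sqrt_div_le ht01 te)
        (by positivity : 0 ≤ 50 * Real.sqrt D)
      -- From `√γ * D ≤ ε * t0` and `1 ≤ ε * √γ` follows `D ≤ ε ^ 2 * t0`.
      have c2 : Real.sqrt D ≤ ε * Real.sqrt t0 := by
        rw [← Real.sqrt_sq hε.le, ← Real.sqrt_mul (sq_nonneg ε)]
        refine Real.sqrt_le_sqrt ?_
        have c3 := mul_le_mul_of_nonneg_left ht0 hε.le
        have c4 := mul_le_mul_of_nonneg_right hsγ1 (by linarith : 0 ≤ D)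
        nlinarith
      refine c1.trans ?_
      rw [mul_div_assoc', div_le_iff₀ (Real.sqrt_pos.2 ht0pos)]
      linarith
    have b5 : 25 * Real.sqrt D / Real.sqrt γ * ∑ r ∈ Finset.Ico t0 te, 1 / ((r : ℝ) + 1) ≤
        75 * ε := by
      have c1 := mul_le_mul_of_nonneg_left hIco
        (by positivity : 0 ≤ 25 * Real.sqrt D / Real.sqrt γ)
      refine c1.trans ?_
      rw [div_mul_eq_mul_div, div_le_iff₀ hsγ]
      have c2 : Real.sqrt D ≤ D := by
        nlinarith [Real.mul_self_sqrt (by linarith : 0 ≤ D)]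
      have c3 := mul_le_mul_of_nonneg_right c2 hlog
      nlinarith
    have := mul_le_mul_of_nonneg_left
      (add_le_add (add_le_add (add_le_add (add_le_add b1 b2) b3) b4) b5)
      (by positivity : 0 ≤ 4 * W)
    refine this.trans (le_of_eq ?_)
    ring
  -- the points that are never activated
  have hinactive : ∀ K, expect δ (p K) (State.init y) te
      (fun s => ∑ i, degree δ i * ind (!s.act i)) ≤ 16 * ε * W := by
    intro K
    simp only [expect_sum, expect_const_mul]
    have h1 : ∀ i, degree δ i * expect δ (p K) (State.init y) te (fun s => ind (!s.act i)) ≤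
        16 * D * W / te := by
      intro i
      have h2 := (expect_inactive_mul_le (δ := δ) (s₀ := State.init y) (hp.isRun K) hq hD hy
        hq1 hη te i).trans (prod_one_add_div_le hη hη1 (hηl.trans hε1.le) (by omega) le_rfl)
      rw [hdeg, le_div_iff₀ hte']
      have h3 := mul_le_mul_of_nonneg_left h2 (by positivity : 0 ≤ 2 * D * W)
      calc _ = 2 * D * W * (q i / (2 * D) *
            (te * expect δ (p K) (State.init y) te (fun s => ind (!s.act i)))) := by
            field_simp
        _ ≤ _ := h3
        _ = _ := by ring
    refine (Finset.sum_le_sum fun i _ => h1 i).trans ?_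
    rw [Finset.sum_const, Finset.card_univ, Fintype.card_fin, nsmul_eq_mul, mul_div_assoc',
      div_le_iff₀ hte']
    nlinarith [mul_le_mul_of_nonneg_right hnte hW.le]
  have hfinal : ∀ K, expect δ (p K) (State.init y) te
      (fun s => (W + (quad δ s.y + 4 * ∑ i, degree δ i * ind (!s.act i))) / 4) ≤
      W / 4 + 16 * ε * W + 1 / 4 * expect δ (p K) (State.init y) te (fun s => quad δ s.y) := by
    intro K
    have e : ∀ s : State n, (W + (quad δ s.y + 4 * ∑ i, degree δ i * ind (!s.act i))) / 4 =
        (W / 4 + 1 / 4 * quad δ s.y) + ∑ i, degree δ i * ind (!s.act i) := fun s => by ring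
    simp only [e]
    rw [expect_add, expect_add, expect_const_mul, expect_const (hp.isRun K) hq hD]
    have := hinactive K
    linarith
  calc _ ≤ ∑ K, maskProb t0 γ K * (W / 4 + 16 * ε * W + 1 / 4 *
        expect δ (p K) (State.init y) te (fun s => quad δ s.y)) :=
        Finset.sum_le_sum fun K _ => mul_le_mul_of_nonneg_left (hfinal K) (hm K)
    _ = W / 4 + 16 * ε * W + 1 / 4 *
        ∑ K, maskProb t0 γ K * expect δ (p K) (State.init y) te (fun s => quad δ s.y) := by
        simp only [mul_add, Finset.sum_add_distrib, ← Finset.sum_mul, sum_maskProb, one_mul]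
        rw [Finset.mul_sum]
        congr 1
        exact Finset.sum_congr rfl fun K _ => by ring
    _ ≤ _ := by linarith

end Total

/-! ### The process along fixed timelines -/

/-- The states of the process along the columns `a`. -/
def State.run {n : ℕ} (δ : Fin n → Fin n → ℝ) (p : ℕ → Step n) (s₀ : State n)
    (a : ℕ → Fin n → Bool) : ℕ → State n
  | 0 => s₀
  | T + 1 => (p T).next δ (State.run δ p s₀ a T) (a T)

/-- Columns indexed by `Fin te`, continued by zero columns. -/
def extend {n te : ℕ} (A : Fin te → Fin n → Bool) (r : ℕ) : Fin n → Bool :=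
  if h : r < te then A ⟨r, h⟩ else fun _ => false

section Run

variable {n te : ℕ} {δ : Fin n → Fin n → ℝ} {p : ℕ → Step n} {s₀ : State n}

theorem State.run_congr {a a' : ℕ → Fin n → Bool} {T : ℕ} (h : ∀ r < T, a r = a' r) :
    State.run δ p s₀ a T = State.run δ p s₀ a' T := by
  induction T with
  | zero => rfl
  | succ T ih =>
    simp only [State.run]
    rw [ih fun r hr => h r (by omega), h T (by omega)]

theorem extend_coe (A : Fin te → Fin n → Bool) (r : Fin te) : extend A r = A r := by
  simp [extend]

theorem extend_snoc_of_lt {A : Fin te → Fin n → Bool} {a : Fin n → Bool} {r : ℕ} (hr : r < te) :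
    extend (Fin.snoc (α := fun _ => Fin n → Bool) A a) r = extend A r := by
  have h1 : r < te + 1 := by omega
  simp only [extend, hr, h1, dif_pos]
  exact Fin.snoc_castSucc (α := fun _ => Fin n → Bool) a A ⟨r, hr⟩

theorem extend_snoc_last {A : Fin te → Fin n → Bool} {a : Fin n → Bool} :
    extend (Fin.snoc (α := fun _ => Fin n → Bool) A a) te = a := by
  simp only [extend, Nat.lt_succ_self, dif_pos]
  exact Fin.snoc_last (α := fun _ => Fin n → Bool) a A

/-- The expectation as a sum over all timelines. -/
theorem expect_eq_sum (T : ℕ) (F : State n → ℝ) :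
    expect δ p s₀ T F = ∑ A : Fin T → Fin n → Bool,
      (∏ r : Fin T, (p r).colWeight (State.run δ p s₀ (extend A) r).act (A r)) *
        F (State.run δ p s₀ (extend A) T) := by
  induction T generalizing F with
  | zero => simp [expect, State.run]
  | succ T ih =>
    simp only [expect]
    rw [ih, ← (Fin.snocEquiv fun _ : Fin (T + 1) => Fin n → Bool).sum_comp,
      Fintype.sum_prod_type_right]
    refine Finset.sum_congr rfl fun A _ => ?_
    rw [Finset.mul_sum]
    refine Finset.sum_congr rfl fun a _ => ?_
    have hrun : ∀ r ≤ T, State.run δ p s₀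
        (extend (Fin.snoc (α := fun _ => Fin n → Bool) A a)) r = State.run δ p s₀ (extend A) r :=
      fun r hr => State.run_congr fun r' hr' => extend_snoc_of_lt (by omega)
    have hprod : ∏ r : Fin (T + 1), (p r).colWeight (State.run δ p s₀
        (extend (Fin.snoc (α := fun _ => Fin n → Bool) A a)) r).act
          (Fin.snoc (α := fun _ => Fin n → Bool) A a r) =
        (∏ r : Fin T, (p r).colWeight (State.run δ p s₀ (extend A) r).act (A r)) *
          (p T).colWeight (State.run δ p s₀ (extend A) T).act a := by
      rw [Fin.prod_univ_castSucc]
      congr 1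
      · refine Finset.prod_congr rfl fun r _ => ?_
        rw [Fin.snoc_castSucc, Fin.val_castSucc, hrun r r.2.le]
      · rw [Fin.snoc_last, Fin.val_last, hrun T le_rfl]
    simp only [Fin.snocEquiv, Equiv.coe_fn_mk]
    rw [hprod, State.run, hrun T le_rfl, extend_snoc_last]
    ring

end Run

/-! ### The seed of the optimal cut -/

section Seed

variable {n d te : ℕ} {x : Fin n → Fin d → ℕ}

/-- The points are distinct, so the lexicographic order on them is strict and ranks identify points.
-/
theorem lexRank_injOn (hx : Function.Injective x) {S : Finset (Fin n)} {i j : Fin n} (hi : i ∈ S)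
    (hj : j ∈ S) (h : lexRank x S i = lexRank x S j) : i = j := by
  classical
  have key : ∀ i j, i ∈ S → toLex (x i) < toLex (x j) → lexRank x S i < lexRank x S j := by
    intro i j hi hlt
    refine Finset.card_lt_card ?_
    rw [Finset.ssubset_iff_of_subset]
    · exact ⟨i, Finset.mem_filter.2 ⟨hi, hlt⟩, fun h => lt_irrefl _ (Finset.mem_filter.1 h).2⟩
    · intro k hk
      rw [Finset.mem_filter] at hk ⊢
      exact ⟨hk.1, hk.2.trans hlt⟩
  rcases lt_trichotomy (toLex (x i)) (toLex (x j)) with h' | h' | h'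
  · exact absurd h (key i j hi h').ne
  · exact hx (toLex.injective h')
  · exact absurd h (key j i hj h').ne'

open Classical in
/-- The seed that agrees with the sides `b`. -/
def seedOf (x : Fin n → Fin d → ℕ) (t0 : ℕ) (A : Fin te → Fin n → Bool) (b : Fin n → Bool) :
    Seed t0 A := fun k =>
  decide (∃ i ∈ seedSet t0 A, lexRank x (seedSet t0 A) i = k ∧ b i = true)

theorem seedSide_seedOf (hx : Function.Injective x) {t0 : ℕ} {A : Fin te → Fin n → Bool}
    {b : Fin n → Bool} {i : Fin n} (hi : i ∈ seedSet t0 A) :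
    seedSide x t0 A (seedOf x t0 A b) i = b i := by
  classical
  simp only [seedSide, hi, dif_pos, seedOf]
  cases hb : b i
  · rw [decide_eq_false_iff_not]
    rintro ⟨j, hj, hji, hbj⟩
    rw [lexRank_injOn hx hj hi hji, hb] at hbj
    exact absurd hbj (by simp)
  · rw [decide_eq_true_eq]
    exact ⟨i, hi, rfl, hb⟩

end Seed

/-! ### The greedy assignment and the states of the process -/

section Link

variable {n d te : ℕ} {x : Fin n → Fin d → ℕ} {δ : Fin n → Fin n → ℝ} {t0 : ℕ} {γ : ℝ}
  {K : Fin te → Bool} {v : Samples n K} {A : Fin te → Fin n → Bool} {σ : Seed t0 A}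

theorem activationTime_eq {i : Fin n} {r : Fin te} (hr : A r i = true)
    (hmin : ∀ r' < r, A r' i ≠ true) : activationTime A i = time r := by
  refine le_antisymm (activationTime_le hr) ?_
  refine le_csInf ⟨_, r, rfl, hr⟩ ?_
  rintro t ⟨r', rfl, hr'⟩
  by_contra h
  exact hmin r' (by unfold time at h; exact Fin.lt_def.2 (by omega)) hr'

theorem assign_of_le {t : ℕ} (ht : t ≤ t0) (i : Fin n) :
    assign x δ t0 γ K v A σ t i = seedSide x t0 A σ i := by
  rw [assign, if_pos ht]

/-- The two estimated contributions enter the rule only through `C_1 - C_0`, in which every earlier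
point counts with its sign. -/
theorem sign_assign_of_lt {t : ℕ} (ht : t0 < t) (i : Fin n) :
    sign (assign x δ t0 γ K v A σ t i) =
      if ∑ j, δ i j * ∑ l : {r : Fin te // K r = true}, (if A l.1 j = true ∧ time l.1 < t then
        sign (assign x δ t0 γ K v A σ (activationTime A j) j) /
          (rho K v A j l * keepProb t0 γ (time l.1)) else 0) < 0 then 1 else -1 := by
  classical
  rw [assign, if_neg (not_le.2 ht)]
  simp only [sign, decide_eq_true_eq]
  refine if_congr ?_ rfl rfl
  rw [← sub_neg, ← Finset.sum_sub_distrib]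
  simp only [← Finset.sum_sub_distrib, Finset.mul_sum]
  refine iff_of_eq (congrArg (· < 0) (Finset.sum_congr rfl fun j _ =>
    Finset.sum_congr rfl fun l _ => ?_))
  split_ifs with h1 h2 <;> simp_all <;> ring

variable {p : ℕ → Step n} {b : Fin n → Bool}

/-- The columns are consistent with the sampled points. -/
def IsConsistent {n te : ℕ} {K : Fin te → Bool} (v : Samples n K) (A : Fin te → Fin n → Bool) :
    Prop :=
  ∀ (l : {r : Fin te // K r = true}) (i : Fin n), A l.1 i = true → (v l).1 = some i

theorem run_act (T : ℕ) (hT : T ≤ te) (i : Fin n) :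
    (State.run δ p (State.init fun i => sign (b i)) (extend A) T).act i = true ↔
      ∃ r : Fin te, (r : ℕ) < T ∧ A r i = true := by
  induction T with
  | zero => simp [State.run, State.init]
  | succ T ih =>
    simp only [State.run, Step.next, Bool.or_eq_true, ih (by omega)]
    have hT' : T < te := by omega
    simp only [extend, hT', dif_pos]
    constructor
    · rintro (⟨r, hr, h⟩ | h)
      · exact ⟨r, by omega, h⟩
      · exact ⟨⟨T, hT'⟩, by simp, h⟩
    · rintro ⟨r, hr, h⟩
      rcases (Nat.lt_succ_iff_lt_or_eq.1 hr) with hlt | heq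
      · exact Or.inl ⟨r, hlt, h⟩
      · right
        have : r = ⟨T, hT'⟩ := Fin.ext heq
        rwa [← this]

/-- The three claims need a joint induction. The sums `S` agree with the estimates of the greedy
rule because earlier activated points have their final sides, and a newly activated point gets its
final side because `S` is right. Until `t0` the fictitious cut is still the optimum, with which the
seed agrees. -/
theorem run_spec (hx : Function.Injective x) (hearly : ∀ r, (p r).early = decide (r < t0))
    (hkept : ∀ r, (p r).kept = keptAt K r) (hrate : ∀ r, (p r).rate = keepProb t0 γ (r + 1))
    (htime : ∀ r, (p r).time = r + 1) (hcons : IsConsistent v A)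
    (hest : ∀ (l : {r : Fin te // K r = true}) i, (v l).1 = some i → (v l).2 = (p l.1).est i)
    (T : ℕ) (hT : T ≤ te) :
    (∀ i, (State.run δ p (State.init fun i => sign (b i)) (extend A) T).act i = true →
      (State.run δ p (State.init fun i => sign (b i)) (extend A) T).y i =
        sign (assign x δ t0 γ K v A (seedOf x t0 A b) (activationTime A i) i)) ∧
    (∀ j, (State.run δ p (State.init fun i => sign (b i)) (extend A) T).S j =
      ∑ l : {r : Fin te // K r = true}, (if A l.1 j = true ∧ time l.1 < T + 1 then
        sign (assign x δ t0 γ K v A (seedOf x t0 A b) (activationTime A j) j) /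
          (rho K v A j l * keepProb t0 γ (time l.1)) else 0)) ∧
    (T ≤ t0 → ∀ i, (State.run δ p (State.init fun i => sign (b i)) (extend A) T).y i =
      sign (b i)) := by
  classical
  induction T with
  | zero =>
    refine ⟨fun i h => by simp [State.run, State.init] at h, fun j => ?_, fun _ i => rfl⟩
    rw [Finset.sum_eq_zero]
    · rfl
    · intro l _
      rw [if_neg]
      simp [time]
  | succ T ih =>
    obtain ⟨ih1, ih2, ih3⟩ := ih (by omega)
    have hT' : T < te := by omega
    have hact := run_act (δ := δ) (p := p) (b := b) (A := A) T (by omega)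
    set s := State.run δ p (State.init fun i => sign (b i)) (extend A) T with hs
    have hext : extend A T = A ⟨T, hT'⟩ := extend_coe A ⟨T, hT'⟩
    have hrun : State.run δ p (State.init fun i => sign (b i)) (extend A) (T + 1) =
        (p T).next δ s (A ⟨T, hT'⟩) := by rw [State.run, hext]
    -- a point that becomes active now gets its final side
    have hnew : ∀ i, s.act i = false → A ⟨T, hT'⟩ i = true →
        activationTime A i = T + 1 ∧ (p T).greedy δ s i =
          sign (assign x δ t0 γ K v A (seedOf x t0 A b) (activationTime A i) i) := by
      intro i hi hAi
      have ht : activationTime A i = T + 1 := activationTime_eq (r := ⟨T, hT'⟩) hAi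
        fun r' hr' h => by
          have : s.act i = true := (hact i).2 ⟨r', Fin.lt_def.1 hr', h⟩
          rw [hi] at this
          exact absurd this (by simp)
      refine ⟨ht, ?_⟩
      rw [ht]
      by_cases hlt : T < t0
      · rw [assign_of_le (by omega), seedSide_seedOf hx]
        · simp only [Step.greedy, hearly, hlt, decide_true, if_true]
          exact ih3 hlt.le i
        · simp only [seedSet, Finset.mem_filter, Finset.mem_univ, true_and]
          exact ⟨⟨T, hT'⟩, by simp only [time]; omega, hAi⟩
      · rw [sign_assign_of_lt (by omega)]
        simp only [Step.greedy, hearly, hlt, decide_false, Bool.false_eq_true, if_false, ih2]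
    have htarget : ∀ i, A ⟨T, hT'⟩ i = true → (p T).target δ s i =
        sign (assign x δ t0 γ K v A (seedOf x t0 A b) (activationTime A i) i) := by
      intro i hAi
      unfold Step.target
      split_ifs with h
      · exact ih1 i h
      · exact (hnew i (by simpa using h) hAi).2
    rw [hrun]
    refine ⟨fun i hi => ?_, fun j => ?_, fun hle i => ?_⟩
    · simp only [Step.next, Bool.or_eq_true] at hi ⊢
      split_ifs with h1 h2
      · exact ih1 i h1
      · exact (hnew i (by simpa using h1) h2).2
      · tauto
    · simp only [Step.next]
      rw [ih2 j]
      have hsplit : ∀ l : {r : Fin te // K r = true},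
          (if A l.1 j = true ∧ time l.1 < T + 1 + 1 then
            sign (assign x δ t0 γ K v A (seedOf x t0 A b) (activationTime A j) j) /
              (rho K v A j l * keepProb t0 γ (time l.1)) else 0) =
          (if A l.1 j = true ∧ time l.1 < T + 1 then
            sign (assign x δ t0 γ K v A (seedOf x t0 A b) (activationTime A j) j) /
              (rho K v A j l * keepProb t0 γ (time l.1)) else 0) +
          (if A l.1 j = true ∧ (l.1 : ℕ) = T then
            sign (assign x δ t0 γ K v A (seedOf x t0 A b) (activationTime A j) j) /
              (rho K v A j l * keepProb t0 γ (time l.1)) else 0) := by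
        intro l
        simp only [time]
        by_cases hA : A l.1 j = true
        · rcases lt_trichotomy (l.1 : ℕ) T with h | h | h
          · simp [hA, h, h.ne, not_lt.2 h.le]
          · simp [hA, h]
          · simp [hA, h.ne', not_le.2 h, not_lt.2 h.le]
        · simp [hA]
      rw [Finset.sum_congr rfl fun l _ => hsplit l, Finset.sum_add_distrib]
      congr 1
      by_cases hk : K ⟨T, hT'⟩ = true
      · rw [Finset.sum_eq_single ⟨⟨T, hT'⟩, hk⟩]
        · cases hA : A ⟨T, hT'⟩ j
          · simp [ind]
          · have hk' : (p T).kept = true := by rw [hkept]; simpa [keptAt, hT'] using hk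
            have hv := hest ⟨⟨T, hT'⟩, hk⟩ j (hcons ⟨⟨T, hT'⟩, hk⟩ j hA)
            -- The case split in `rho` on the activation time is the split in `est'` on having been
            -- active before this step.
            have hρ : (p T).est' s.act j = rho K v A j ⟨⟨T, hT'⟩, hk⟩ := by
              unfold Step.est' rho
              rw [hv, htime]
              cases hj : s.act j
              · simp [(hnew j hj hA).1, time]
              · obtain ⟨r, hr, hrj⟩ := (hact j).1 hj
                have := activationTime_le hrj
                rw [if_pos rfl, if_neg]
                simp only [time] at this ⊢
                omega
            simp only [ind, if_true, one_mul, hk', htarget j hA, hρ, hrate, and_self, time]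
        · intro l _ hl
          rw [if_neg]
          rintro ⟨_, h⟩
          exact hl (Subtype.ext (Fin.ext h))
        · simp
      · have hk' : (p T).kept = false := by rw [hkept]; simpa [keptAt, hT'] using hk
        rw [Finset.sum_eq_zero]
        · simp [hk']
        · intro l _
          rw [if_neg]
          rintro ⟨_, h⟩
          have : l.1 = ⟨T, hT'⟩ := Fin.ext h
          exact hk (this ▸ l.2)
    · rw [Step.next_y_eq]
      have : (p T).gap δ s i = 0 := by
        simp [Step.gap, Step.greedy, hearly, show T < t0 by omega]
      rw [this, zero_mul, add_zero]
      exact ih3 (by omega) i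

/-- The cost of the best seed is at most the cost of the fictitious cut at the end, up to the points
that are never activated. -/
theorem bestSeedCost_le (hδ : IsFinMetric δ) (hx : Function.Injective x)
    (hearly : ∀ r, (p r).early = decide (r < t0))
    (hkept : ∀ r, (p r).kept = keptAt K r) (hrate : ∀ r, (p r).rate = keepProb t0 γ (r + 1))
    (htime : ∀ r, (p r).time = r + 1) (hcons : IsConsistent v A)
    (hest : ∀ (l : {r : Fin te // K r = true}) i, (v l).1 = some i → (v l).2 = (p l.1).est i)
    (hbox : ∀ i, |(State.run δ p (State.init fun i => sign (b i)) (extend A) te).y i| ≤ 1) :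
    bestSeedCost x δ t0 γ K v A ≤ (totalDist δ +
      (quad δ (State.run δ p (State.init fun i => sign (b i)) (extend A) te).y +
        4 * ∑ i, degree δ i *
          ind (!(State.run δ p (State.init fun i => sign (b i)) (extend A) te).act i))) / 4 := by
  classical
  refine (ciInf_le (Set.finite_range _).bddBelow (seedOf x t0 A b)).trans ?_
  have hact := run_act (δ := δ) (p := p) (b := b) (A := A) te le_rfl
  obtain ⟨h1, -, -⟩ := run_spec (b := b) hx hearly hkept hrate htime hcons hest te le_rfl
  set s := State.run δ p (State.init fun i => sign (b i)) (extend A) te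
  set side : Fin n → Bool := fun i => if ∃ r, A r i = true then
    assign x δ t0 γ K v A (seedOf x t0 A b) (activationTime A i) i else false with hside
  have hcut : cutOfSeed x δ t0 γ K v A (seedOf x t0 A b) = fun i => sideRow (side i) := by
    funext i
    simp only [cutOfSeed, hside]
    split_ifs <;> rfl
  rw [hcut, internalCost_sideRow]
  refine div_le_div_of_nonneg_right (add_le_add le_rfl ?_) (by norm_num)
  refine (quad_le_add hδ hbox (z := fun i => sign (side i))
    fun i => (abs_sign _).le).trans (add_le_add le_rfl ?_)
  have : ∀ i, degree δ i * |sign (side i) - s.y i| ≤ 2 * (degree δ i * ind (!s.act i)) := by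
    intro i
    cases hi : s.act i
    -- A never activated point is put on the `0`-side whatever its fictitious side is; both lie in
    -- the unit interval around zero.
    · have h2 : |sign (side i) - s.y i| ≤ 2 :=
        (abs_sub _ _).trans (by rw [abs_sign]; linarith [hbox i])
      have := mul_le_mul_of_nonneg_left h2 (hδ.degree_nonneg i)
      simp only [ind, Bool.not_false, if_true]
      linarith
    · obtain ⟨r, -, hr⟩ := (hact i).1 hi
      have : side i = assign x δ t0 γ K v A (seedOf x t0 A b) (activationTime A i) i :=
        if_pos ⟨r, hr⟩
      simp [h1 i hi, this, ind]
  have h3 := Finset.sum_le_sum fun i (_ : i ∈ Finset.univ) => this i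
  rw [← Finset.mul_sum] at h3
  linarith

end Link

/-! ### The finite process of a mask -/

/-- The reported probability is a fixed function of the sampled point: `P` is the law of the
sampled point, and `φ` the reported probability. -/
structure IsFiniteSampler {n : ℕ} (q : Fin n → ℝ) (D η : ℝ) (P φ : Option (Fin n) → ℝ) : Prop where
  nonneg : ∀ o, 0 ≤ P o
  sum_eq_one : ∑ o, P o = 1
  le_prob : ∀ i, q i / D ≤ P (some i)
  prob_le : ∀ i, P (some i) ≤ φ (some i)
  le_mul : ∀ i, φ (some i) ≤ (1 + η) * P (some i)

section Finite

variable {n d te : ℕ}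

/-- The rank of a time among the kept times; zero outside the range. -/
def rankAt (K : Fin te → Bool) (r : ℕ) : ℕ := if h : r < te then keptRank K ⟨r, h⟩ else 0

/-- The steps of the process of a mask. -/
def maskStep (w : Fin n → ℝ) (t0 : ℕ) (γ : ℝ) (P φ : ℕ → ℕ → Option (Fin n) → ℝ)
    (K : Fin te → Bool) (r : ℕ) : Step n where
  time := r + 1
  early := decide (r < t0)
  kept := keptAt K r
  rate := keepProb t0 γ (r + 1)
  pred := predicted t0 γ K r
  prob := P (numKept K) (rankAt K r)
  est i := φ (numKept K) (rankAt K r) (some i)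
  weight := w

/-- The samples determined by the sampled points. -/
def samplesOf (φ : ℕ → ℕ → Option (Fin n) → ℝ) (K : Fin te → Bool)
    (o : {r : Fin te // K r = true} → Option (Fin n)) : Samples n K :=
  fun r => (o r, φ (numKept K) (keptRank K r.1) (o r))

theorem one_le_keptRank {K : Fin te → Bool} {r : Fin te} (h : K r = true) : 1 ≤ keptRank K r :=
  Finset.card_pos.2 ⟨r, Finset.mem_filter.2 ⟨Finset.mem_univ _, h, le_rfl⟩⟩

theorem keptRank_le_numKept (K : Fin te → Bool) (r : Fin te) : keptRank K r ≤ numKept K :=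
  Finset.card_le_card fun _ hr =>
    Finset.mem_filter.2 ⟨Finset.mem_univ _, (Finset.mem_filter.1 hr).2.1⟩

theorem keptRank_lt_of_lt {K : Fin te → Bool} {r r' : Fin te} (h' : K r' = true) (hlt : r < r') :
    keptRank K r < keptRank K r' := by
  refine Finset.card_lt_card ?_
  rw [Finset.ssubset_iff_of_subset]
  · exact ⟨r', Finset.mem_filter.2 ⟨Finset.mem_univ _, h', le_rfl⟩,
      fun h => absurd (Finset.mem_filter.1 h).2.2 (not_le.2 hlt)⟩
  · intro l hl
    rw [Finset.mem_filter] at hl ⊢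
    exact ⟨hl.1, hl.2.1, hl.2.2.trans hlt.le⟩

variable {w : Fin n → ℝ} {t0 : ℕ} {γ : ℝ} {P φ : ℕ → ℕ → Option (Fin n) → ℝ} {q : Fin n → ℝ}
  {D η : ℝ} {δ : Fin n → Fin n → ℝ} {x : Fin n → Fin d → ℕ}

/-- The point is the field `past`: the sampler of a step is determined by the total count and the
rank of the time, and both can be read off from the count and the mask up to that time. -/
theorem isMaskedRun_maskStep (hγ : 0 < γ) (hw : ∀ i, q i / (2 * D) ≤ w i) (hw1 : ∀ i, w i ≤ 1)
    (hP : ∀ s j, 1 ≤ j → j ≤ s → IsFiniteSampler q D η (P s j) (φ s j)) :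
    IsMaskedRun q D η t0 γ (maskStep (te := te) w t0 γ P φ) where
  isRun K := by
    refine ⟨fun r => ?_, fun r => rfl⟩
    have hs : keptAt K r = true →
        IsFiniteSampler q D η (P (numKept K) (rankAt K r)) (φ (numKept K) (rankAt K r)) := by
      intro hk
      unfold keptAt at hk
      split_ifs at hk with hr
      simp only [rankAt, hr, dif_pos]
      exact hP _ _ (one_le_keptRank hk) (keptRank_le_numKept K _)
    exact {
      one_le_time := by simp [maskStep]
      rate_pos := keepProb_pos hγ (Nat.succ_pos r)
      prob_nonneg := fun hk => (hs hk).nonneg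
      sum_prob := fun hk => (hs hk).sum_eq_one
      le_prob := fun hk => (hs hk).le_prob
      prob_le_est := fun hk => (hs hk).prob_le
      est_le := fun hk => (hs hk).le_mul
      le_weight := hw
      weight_le := hw1 }
  past r K K' h l hl := by
    have hnum : numKept K = numKept K' := (Prod.mk.inj h).1
    have hlt : ∀ r' : Fin te, (r' : ℕ) < r → K r' = K' r' := fun r' hr' => by
      have := congrFun (Prod.mk.inj h).2 r'
      simpa [hr'] using this
    have hkept : keptAt K l = keptAt K' l := by
      unfold keptAt
      split_ifs with hte
      exacts [hlt _ hl, rfl]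
    have hrank : rankAt K l = rankAt K' l := by
      unfold rankAt
      split_ifs with hte
      · unfold keptRank
        congr 1
        refine Finset.filter_congr fun r' _ => and_congr_left fun hr' => ?_
        have : (r' : ℕ) ≤ l := hr'
        rw [hlt r' (by omega)]
      · rfl
    have hpast : maskPast l K = maskPast l K' := by
      unfold maskPast
      rw [hnum]
      congr 1
      funext r'
      split_ifs with hr'
      exacts [hlt r' (by omega), rfl]
    have hpred : predicted t0 γ K l = predicted t0 γ K' l := condAvg_congr hpast
    simp only [maskStep, hnum, hkept, hrank, hpred]
  early _ _ := rfl
  kept _ _ := rfl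
  rate _ _ := rfl
  pred _ _ := rfl

theorem entryProb_samplesOf (K : Fin te → Bool) (o : {r : Fin te // K r = true} → Option (Fin n))
    (A : Fin te → Fin n → Bool) (b : Fin n → Bool) (r : Fin te) (i : Fin n) :
    entryProb w K (samplesOf φ K o) A r i = (maskStep w t0 γ P φ K r).entry
      (State.run δ (maskStep w t0 γ P φ K) (State.init fun i => sign (b i)) (extend A) r).act
      (if h : K r = true then o ⟨r, h⟩ else none) i := by
  classical
  have hact := run_act (δ := δ) (p := maskStep w t0 γ P φ K) (b := b) (A := A) r r.2.le i
  have hact' : (State.run δ (maskStep w t0 γ P φ K) (State.init fun i => sign (b i))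
      (extend A) r).act i = true ↔ ActivatedBefore A r i := hact
  have hkept : keptAt K r = K r := by simp [keptAt]
  have hrank : rankAt K r = keptRank K r := by simp [rankAt]
  unfold entryProb Step.entry
  simp only [hact']
  by_cases hk : K r = true
  · by_cases ho : o ⟨r, hk⟩ = some i
    · simp [maskStep, hkept, hrank, hk, samplesOf, ho, time]
    · simp [maskStep, hkept, hk, samplesOf, ho]
  · simp [maskStep, hkept, hk, time]

/-- Given the mask, the samples are independent and each influences the law of one column only. So
summing over the sampled points factors over the times. -/
theorem sum_prod_mul_timelinesProb (K : Fin te → Bool) (A : Fin te → Fin n → Bool)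
    (b : Fin n → Bool) :
    ∑ o : {r : Fin te // K r = true} → Option (Fin n),
        (∏ r, P (numKept K) (keptRank K r.1) (o r)) * timelinesProb w K (samplesOf φ K o) A =
      ∏ r : Fin te, (maskStep w t0 γ P φ K r).colWeight (State.run δ (maskStep w t0 γ P φ K)
        (State.init fun i => sign (b i)) (extend A) r).act (A r) := by
  classical
  set p := maskStep w t0 γ P φ K with hp
  set act : ℕ → Fin n → Bool := fun r =>
    (State.run δ p (State.init fun i => sign (b i)) (extend A) r).act with hact
  have hkept : ∀ r : Fin te, (p r).kept = K r := fun r => by simp [hp, maskStep, keptAt]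
  have hprob : ∀ r : Fin te, (p r).prob = P (numKept K) (keptRank K r) := fun r => by
    simp [hp, maskStep, rankAt]
  have h1 : ∀ o : {r : Fin te // K r = true} → Option (Fin n),
      timelinesProb w K (samplesOf φ K o) A =
      (∏ r : {r : Fin te // K r = true}, ∏ i, bern ((p r.1).entry (act r.1) (o r) i) (A r.1 i)) *
        ∏ r : {r : Fin te // ¬ K r = true}, ∏ i, bern ((p r.1).entry (act r.1) none i) (A r.1 i) := by
    intro o
    unfold timelinesProb
    rw [← Fintype.prod_subtype_mul_prod_subtype (fun r => K r = true)]
    congr 1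
    · refine Finset.prod_congr rfl fun r _ => Finset.prod_congr rfl fun i _ => ?_
      rw [entryProb_samplesOf (P := P) (δ := δ) (t0 := t0) (γ := γ) K o A b, dif_pos r.2]
    · refine Finset.prod_congr rfl fun r _ => Finset.prod_congr rfl fun i _ => ?_
      rw [entryProb_samplesOf (P := P) (δ := δ) (t0 := t0) (γ := γ) K o A b, dif_neg r.2]
  rw [← Fintype.prod_subtype_mul_prod_subtype (fun r => K r = true)]
  have h2 : ∏ r : {r : Fin te // K r = true}, (p r.1).colWeight (act r.1) (A r.1) =
      ∑ o : {r : Fin te // K r = true} → Option (Fin n), ∏ r,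
        (P (numKept K) (keptRank K r.1) (o r) *
          ∏ i, bern ((p r.1).entry (act r.1) (o r) i) (A r.1 i)) := by
    have h := Finset.prod_univ_sum
      (fun _ : {r : Fin te // K r = true} => (Finset.univ : Finset (Option (Fin n))))
      (fun r o => P (numKept K) (keptRank K r.1) o *
        ∏ i, bern ((p r.1).entry (act r.1) o i) (A r.1 i))
    rw [Fintype.piFinset_univ] at h
    rw [← h]
    refine Finset.prod_congr rfl fun r _ => ?_
    simp only [Step.colWeight, hkept, r.2, if_true, hprob]
  have h3 : ∏ r : {r : Fin te // ¬ K r = true}, (p r.1).colWeight (act r.1) (A r.1) =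
      ∏ r : {r : Fin te // ¬ K r = true}, ∏ i, bern ((p r.1).entry (act r.1) none i) (A r.1 i) :=
    Finset.prod_congr rfl fun r _ => by simp [Step.colWeight, hkept, r.2]
  rw [h2, h3, Finset.sum_mul]
  refine Finset.sum_congr rfl fun o _ => ?_
  rw [h1, Finset.prod_mul_distrib, mul_assoc]

/-- For timelines of positive weight, an entry `1` at a kept time reveals the sampled point, hence
also its reported probability. So the cost is bounded by a function of the timelines alone, and the
samples can be summed out. -/
theorem sum_samples_le_expect (hγ : 0 < γ) (hq : ∀ i, 0 < q i) (hD : 1 ≤ D)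
    (hw : ∀ i, q i / (2 * D) ≤ w i) (hw1 : ∀ i, w i ≤ 1)
    (hP : ∀ s j, 1 ≤ j → j ≤ s → IsFiniteSampler q D η (P s j) (φ s j))
    (hδ : IsFinMetric δ) (hx : Function.Injective x) (K : Fin te → Bool) (b : Fin n → Bool) :
    ∑ o : {r : Fin te // K r = true} → Option (Fin n),
        (∏ r, P (numKept K) (keptRank K r.1) (o r)) *
          ∑ A, timelinesProb w K (samplesOf φ K o) A *
            bestSeedCost x δ t0 γ K (samplesOf φ K o) A ≤
      expect δ (maskStep w t0 γ P φ K) (State.init fun i => sign (b i)) te fun s =>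
        (totalDist δ + (quad δ s.y + 4 * ∑ i, degree δ i * ind (!s.act i))) / 4 := by
  have hrun := (isMaskedRun_maskStep (te := te) (t0 := t0) hγ hw hw1 hP).isRun K
  set p := maskStep w t0 γ P φ K with hp
  set B : State n → ℝ := fun s =>
    (totalDist δ + (quad δ s.y + 4 * ∑ i, degree δ i * ind (!s.act i))) / 4 with hB
  have hbox : ∀ (a : ℕ → Fin n → Bool) (T : ℕ) (i : Fin n),
      |(State.run δ p (State.init fun i => sign (b i)) a T).y i| ≤ 1 := by
    intro a T
    induction T with
    | zero => exact fun i => (abs_sign _).le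
    | succ T ih => exact (hrun.valid T).abs_next_y_le hq (by linarith) ih _
  have hP0 : ∀ r : {r : Fin te // K r = true}, ∀ o, 0 ≤ P (numKept K) (keptRank K r.1) o :=
    fun r => (hP _ _ (one_le_keptRank r.2) (keptRank_le_numKept K _)).nonneg
  have hentry : ∀ o A (r : Fin te) i, 0 ≤ entryProb w K (samplesOf φ K o) A r i ∧
      entryProb w K (samplesOf φ K o) A r i ≤ 1 := by
    intro o A r i
    rw [entryProb_samplesOf (P := P) (δ := δ) (t0 := t0) (γ := γ) K o A b]
    exact (hrun.valid r).entry_mem hq (by linarith) _ _ _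
  have hterm : ∀ o A, (∏ r, P (numKept K) (keptRank K r.1) (o r)) *
      (timelinesProb w K (samplesOf φ K o) A * bestSeedCost x δ t0 γ K (samplesOf φ K o) A) ≤
      (∏ r, P (numKept K) (keptRank K r.1) (o r)) * timelinesProb w K (samplesOf φ K o) A *
        B (State.run δ p (State.init fun i => sign (b i)) (extend A) te) := by
    intro o A
    rw [← mul_assoc]
    have h0 : 0 ≤ timelinesProb w K (samplesOf φ K o) A :=
      Finset.prod_nonneg fun r _ => Finset.prod_nonneg fun i _ =>
        bern_nonneg (hentry o A r i).1 (hentry o A r i).2 _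
    rcases h0.eq_or_lt with h | h
    · simp [← h]
    refine mul_le_mul_of_nonneg_left ?_
      (mul_nonneg (Finset.prod_nonneg fun r _ => hP0 r _) h0)
    have hcons : IsConsistent (samplesOf φ K o) A := by
      intro l i hl
      by_contra hne
      -- An entry `1` of a point that was not sampled has probability zero.
      refine h.ne' (Finset.prod_eq_zero (Finset.mem_univ l.1)
        (Finset.prod_eq_zero (Finset.mem_univ i) ?_))
      simp only [bern, hl, if_true, entryProb, l.2, dif_pos]
      exact if_neg hne
    refine bestSeedCost_le hδ hx (fun _ => rfl) (fun _ => rfl) (fun _ => rfl) (fun _ => rfl)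
      hcons (fun l i hl => ?_) (hbox _ _)
    have hrank : rankAt K l.1 = keptRank K l.1 := by simp [rankAt]
    simp only [samplesOf] at hl ⊢
    rw [hl]
    simp only [hp, maskStep, hrank]
  simp only [Finset.mul_sum]
  rw [Finset.sum_comm, expect_eq_sum]
  refine Finset.sum_le_sum fun A _ => (Finset.sum_le_sum fun o _ => hterm o A).trans (le_of_eq ?_)
  rw [← Finset.sum_mul, sum_prod_mul_timelinesProb (δ := δ) (t0 := t0) (γ := γ) K A b]

/-- The bound on the expected cost for samplers whose reported probability is a function of the
sampled point. -/
theorem sum_finite_le {ε : ℝ} (hD : 1 ≤ D) (hη : 0 ≤ η) (hδ : IsFinMetric δ)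
    (hx : Function.Injective x) (hW : 0 < totalDist δ) (hε : 0 < ε) (hε1 : ε < 1) (hη1 : η ≤ 1)
    (hηl : η * Real.log te ≤ ε) (hte : 2 ≤ te) (hγ : 0 < γ) (hnte : n * D ≤ ε * te)
    (hγε : D * Real.log te + 1 ≤ ε * Real.sqrt γ) (ht0 : Real.sqrt γ * D ≤ ε * t0)
    (ht0' : 1 ≤ ε * t0) (hw : ∀ i, distShare δ i / (2 * D) ≤ w i) (hw1 : ∀ i, w i ≤ 1)
    (hP : ∀ s j, 1 ≤ j → j ≤ s → IsFiniteSampler (distShare δ) D η (P s j) (φ s j)) :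
    ∑ K : Fin te → Bool, maskProb t0 γ K *
      ∑ o : {r : Fin te // K r = true} → Option (Fin n),
        (∏ r, P (numKept K) (keptRank K r.1) (o r)) *
          ∑ A, timelinesProb w K (samplesOf φ K o) A *
            bestSeedCost x δ t0 γ K (samplesOf φ K o) A ≤
      minCost δ + 201 * ε * totalDist δ := by
  obtain ⟨b, hb⟩ := exists_sign_cost_le_minCost hδ
  have hq : ∀ i, 0 < distShare δ i := fun i => hδ.distShare_pos hW i
  have h1 := sum_expect_cost_le (y := fun i => sign (b i))
    (isMaskedRun_maskStep (te := te) (t0 := t0) hγ hw hw1 hP)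
    hγ hD hη hδ (fun i => (abs_sign _).le) rfl hW hε hε1 hη1 hηl hte hnte hγε ht0 ht0'
  refine (Finset.sum_le_sum fun K _ => mul_le_mul_of_nonneg_left
    (sum_samples_le_expect hγ hq hD hw hw1 hP hδ hx K b) (maskProb_nonneg hγ K)).trans
    (h1.trans (by linarith))

end Finite

/-! ### Disintegration of the samples -/

instance instDiscreteMeasurableSpaceOptionFin (n : ℕ) :
    DiscreteMeasurableSpace (Option (Fin n)) := ⟨fun _ => trivial⟩

theorem exists_condLaw {α : Type*} [MeasurableSpace α] [MeasurableSingletonClass α] [Fintype α]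
    (G : Measure (α × ℝ)) [IsProbabilityMeasure G] :
    ∃ κ : α → Measure ℝ, (∀ o, IsProbabilityMeasure (κ o)) ∧
      G = ∑ o, G.fst {o} • (κ o).map (Prod.mk o) := by
  refine ⟨fun o => G.condKernel o, fun o => inferInstance, ?_⟩
  ext s hs
  conv_lhs => rw [← Measure.disintegrate G G.condKernel, Measure.compProd_apply hs,
    lintegral_fintype]
  rw [Measure.finsetSum_apply]
  refine Finset.sum_congr rfl fun o _ => ?_
  rw [Measure.smul_apply, smul_eq_mul, Measure.map_apply measurable_prodMk_left hs, mul_comm]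

/-- A product of mixtures is the mixture of the products. It suffices to compare both sides on
boxes. -/
theorem pi_sum_smul_map {ι α : Type*} [Fintype ι] [DecidableEq ι] [Fintype α] [MeasurableSpace α]
    [MeasurableSingletonClass α] (c : ι → α → ℝ≥0∞)
    (κ : ι → α → Measure ℝ) [∀ r o, IsProbabilityMeasure (κ r o)] (G : ι → Measure (α × ℝ))
    [∀ r, IsProbabilityMeasure (G r)] (hG : ∀ r, G r = ∑ o, c r o • (κ r o).map (Prod.mk o)) :
    Measure.pi G = ∑ o : ι → α, (∏ r, c r (o r)) •
      (Measure.pi fun r => κ r (o r)).map fun y r => (o r, y r) := by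
  refine Measure.pi_eq fun s hs => ?_
  have h := Finset.prod_univ_sum (fun _ : ι => (Finset.univ : Finset α))
      (fun r o => c r o * κ r o (Prod.mk o ⁻¹' s r))
  rw [Fintype.piFinset_univ] at h
  have h' : ∀ r, G r (s r) = ∑ o, c r o * κ r o (Prod.mk o ⁻¹' s r) := by
    intro r
    rw [hG r, Measure.finsetSum_apply]
    refine Finset.sum_congr rfl fun o _ => ?_
    rw [Measure.smul_apply, smul_eq_mul, Measure.map_apply measurable_prodMk_left (hs r)]
  rw [Finset.prod_congr rfl fun r _ => h' r, h, Measure.finsetSum_apply]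
  refine Finset.sum_congr rfl fun o _ => ?_
  rw [Measure.smul_apply, smul_eq_mul, Measure.map_apply (by fun_prop)
    (MeasurableSet.univ_pi hs), Finset.prod_mul_distrib, ← Measure.pi_pi]
  rfl

/-- The integral over independent samples, in terms of one family of reported probabilities with
law `Measure.infinitePi κ` from which the samples read off distinct coordinates. -/
theorem integral_pi_eq_sum {ι α J : Type*} [Fintype ι] [DecidableEq ι] [Fintype α] [MeasurableSpace α]
    [MeasurableSingletonClass α] (κ : J → Measure ℝ) [∀ j, IsProbabilityMeasure (κ j)]
    (e : ι → α → J) (he : ∀ o : ι → α, Function.Injective fun r => e r (o r))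
    (G : ι → Measure (α × ℝ)) [∀ r, IsProbabilityMeasure (G r)]
    (hG : ∀ r, G r = ∑ o, (G r).fst {o} • (κ (e r o)).map (Prod.mk o))
    {F : (ι → α × ℝ) → ℝ} (hF : Measurable F)
    (hint : ∀ o : ι → α,
      Integrable (fun ω => F fun r => (o r, ω (e r (o r)))) (Measure.infinitePi κ)) :
    ∫ v, F v ∂Measure.pi G = ∑ o : ι → α, (∏ r, (G r).fst.real {o r}) *
      ∫ ω, F (fun r => (o r, ω (e r (o r)))) ∂Measure.infinitePi κ := by
  have hmeas : ∀ o : ι → α, Measurable fun (ω : J → ℝ) r => (o r, ω (e r (o r))) := fun o =>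
    measurable_pi_iff.2 fun r => measurable_const.prodMk (measurable_pi_apply _)
  -- By `he`, distinct samples read distinct coordinates, so they are jointly independent under the
  -- infinite product.
  have hmap : ∀ o : ι → α, (Measure.pi fun r => κ (e r (o r))).map (fun y r => (o r, y r)) =
      (Measure.infinitePi κ).map fun ω r => (o r, ω (e r (o r))) := by
    intro o
    rw [← Measure.infinitePi_eq_pi, ← Measure.map_infinitePi_infinitePi_of_inj (P := κ) (he o),
      Measure.map_map (by fun_prop) (by fun_prop)]
    rfl
  have hint' : ∀ o : ι → α, Integrable F ((∏ r, (G r).fst {o r}) •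
      (Measure.pi fun r => κ (e r (o r))).map fun y r => (o r, y r)) := by
    intro o
    refine Integrable.smul_measure ?_ (ENNReal.prod_ne_top fun r _ => measure_ne_top _ _)
    rw [hmap, integrable_map_measure hF.aestronglyMeasurable (hmeas o).aemeasurable]
    exact hint o
  rw [pi_sum_smul_map (fun r o => (G r).fst {o}) (fun r o => κ (e r o)) G hG,
    integral_finsetSum_measure fun o _ => hint' o]
  refine Finset.sum_congr rfl fun o _ => ?_
  rw [integral_smul_measure, hmap, integral_map (hmeas o).aemeasurable hF.aestronglyMeasurable,
    ENNReal.toReal_prod, smul_eq_mul]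
  rfl

/-! ### Measurability -/

section Measurability

variable {n d te : ℕ} {x : Fin n → Fin d → ℕ} {δ : Fin n → Fin n → ℝ} {t0 : ℕ} {γ : ℝ}
  {w : Fin n → ℝ} {K : Fin te → Bool}

theorem measurable_rho (A : Fin te → Fin n → Bool) (j : Fin n) (l : {r : Fin te // K r = true}) :
    Measurable fun v : Samples n K => rho K v A j l := by
  unfold rho
  split_ifs <;> fun_prop

theorem measurable_assign (A : Fin te → Fin n → Bool) (σ : Seed t0 A) (t : ℕ) (i : Fin n) :
    Measurable fun v : Samples n K => assign x δ t0 γ K v A σ t i := by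
  classical
  induction t using Nat.strong_induction_on generalizing i with
  | _ t ih =>
  by_cases ht : t ≤ t0
  · have : (fun v : Samples n K => assign x δ t0 γ K v A σ t i) = fun _ => seedSide x t0 A σ i := by
      funext v
      rw [assign, if_pos ht]
    rw [this]
    exact measurable_const
  · set C : Bool → Samples n K → ℝ := fun b v =>
      ∑ j, ∑ l : {r : Fin te // K r = true},
        if _h : A l.1 j = true ∧ time l.1 < t then
          δ i j / (rho K v A j l * keepProb t0 γ (time l.1)) *
            (if assign x δ t0 γ K v A σ (activationTime A j) j = b then 1 else 0)
        else 0 with hC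
    have hCm : ∀ b, Measurable (C b) := by
      intro b
      refine Finset.measurable_sum _ fun j _ => Finset.measurable_sum _ fun l _ => ?_
      by_cases h : A l.1 j = true ∧ time l.1 < t
      · simp only [h, and_self, dif_pos]
        have h1 := ih _ (lt_of_le_of_lt (activationTime_le h.1) h.2) j
        have h2 := measurable_rho (K := K) A j l
        refine (measurable_const.div (h2.mul measurable_const)).mul ?_
        exact Measurable.ite (h1 (measurableSet_singleton b)) measurable_const measurable_const
      · simp only [h, dif_neg, not_false_eq_true, measurable_const]
    have : (fun v : Samples n K => assign x δ t0 γ K v A σ t i) =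
        fun v => decide (C true v < C false v) := by
      funext v
      rw [assign, if_neg ht]
    rw [this]
    refine measurable_to_bool ?_
    convert measurableSet_lt (hCm true) (hCm false) using 1
    ext v
    simp

theorem measurable_bestSeedCost (A : Fin te → Fin n → Bool) :
    Measurable fun v : Samples n K => bestSeedCost x δ t0 γ K v A := by
  refine Measurable.iInf fun σ => ?_
  have h1 : Measurable fun v : Samples n K => cutOfSeed x δ t0 γ K v A σ := by
    refine measurable_pi_iff.2 fun i => ?_
    unfold cutOfSeed
    split_ifs
    · exact (Measurable.of_discrete (f := sideRow)).comp (measurable_assign A σ _ i)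
    · exact measurable_const
  exact (Measurable.of_discrete (f := internalCost δ)).comp h1

theorem measurable_entryProb (A : Fin te → Fin n → Bool) (r : Fin te) (i : Fin n) :
    Measurable fun v : Samples n K => entryProb w K v A r i := by
  unfold entryProb
  by_cases h : K r = true
  · simp only [h, dif_pos]
    refine Measurable.ite ?_ ?_ measurable_const
    · exact (measurable_fst.comp (measurable_pi_apply _)) (measurableSet_singleton _)
    · split_ifs <;> fun_prop
  · simp only [h]
    exact measurable_const

theorem measurable_timelinesProb (A : Fin te → Fin n → Bool) :
    Measurable fun v : Samples n K => timelinesProb w K v A := by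
  refine Finset.measurable_prod _ fun r _ => Finset.measurable_prod _ fun i _ => ?_
  have h := measurable_entryProb (w := w) (K := K) A r i
  unfold bern
  split_ifs <;> fun_prop

theorem abs_timelinesProb_le (hw0 : ∀ i, 0 ≤ w i) (hw1 : ∀ i, w i ≤ 1) {v : Samples n K}
    (hv : ∀ r i, (v r).1 = some i → 0 ≤ (v r).2) (A : Fin te → Fin n → Bool) :
    |timelinesProb w K v A| ≤ 1 := by
  have h : ∀ r i, 0 ≤ entryProb w K v A r i ∧ entryProb w K v A r i ≤ 1 := by
    intro r i
    unfold entryProb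
    split_ifs with h1 h2
    · exact ⟨zero_le_one, le_rfl⟩
    · exact ⟨le_min (one_div_nonneg.2 (mul_nonneg (Nat.cast_nonneg _) (hv _ _ h2))) zero_le_one,
        min_le_right _ _⟩
    · exact ⟨le_rfl, zero_le_one⟩
    · exact ⟨hw0 i, hw1 i⟩
    · exact ⟨le_min (hw0 i) (by positivity), (min_le_left _ _).trans (hw1 i)⟩
  have hb : ∀ r i, 0 ≤ bern (entryProb w K v A r i) (A r i) ∧
      bern (entryProb w K v A r i) (A r i) ≤ 1 := by
    intro r i
    refine ⟨bern_nonneg (h r i).1 (h r i).2 _, ?_⟩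
    unfold bern
    split_ifs
    · exact (h r i).2
    · linarith [(h r i).1]
  have h0 : 0 ≤ timelinesProb w K v A :=
    Finset.prod_nonneg fun r _ => Finset.prod_nonneg fun i _ => (hb r i).1
  rw [abs_of_nonneg h0]
  exact Finset.prod_le_one (fun r _ => Finset.prod_nonneg fun i _ => (hb r i).1)
    fun r _ => Finset.prod_le_one (fun i _ => (hb r i).1) fun i _ => (hb r i).2

/-- The conditional expectation of the cost of the best seed given the mask and the samples. -/
def sampledCost (x : Fin n → Fin d → ℕ) (δ : Fin n → Fin n → ℝ) (t0 : ℕ) (γ : ℝ) (w : Fin n → ℝ)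
    (K : Fin te → Bool) (v : Samples n K) : ℝ :=
  ∑ A, timelinesProb w K v A * bestSeedCost x δ t0 γ K v A

theorem measurable_sampledCost : Measurable (sampledCost x δ t0 γ w K) :=
  Finset.measurable_sum _ fun A _ => (measurable_timelinesProb A).mul (measurable_bestSeedCost A)

/-- Supplies integrability. Nonnegative reported probabilities are required, since otherwise the
formal Bernoulli parameters may leave the unit interval. -/
theorem exists_abs_sampledCost_le (x : Fin n → Fin d → ℕ) (δ : Fin n → Fin n → ℝ) (t0 : ℕ) (γ : ℝ)
    (K : Fin te → Bool) (hw0 : ∀ i, 0 ≤ w i) (hw1 : ∀ i, w i ≤ 1) :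
    ∃ B, ∀ v : Samples n K, (∀ r i, (v r).1 = some i → 0 ≤ (v r).2) →
      |sampledCost x δ t0 γ w K v| ≤ B := by
  obtain ⟨B, hB⟩ := (Set.finite_range fun z : Fin n → Fin 2 → Bool =>
    |internalCost δ z|).bddAbove
  refine ⟨∑ _A : Fin te → Fin n → Bool, 1 * B, fun v hv => ?_⟩
  refine (Finset.abs_sum_le_sum_abs _ _).trans (Finset.sum_le_sum fun A _ => ?_)
  rw [abs_mul]
  refine mul_le_mul (abs_timelinesProb_le hw0 hw1 hv A) ?_ (abs_nonneg _) zero_le_one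
  obtain ⟨σ, hσ⟩ := exists_eq_ciInf_of_finite
    (f := fun σ : Seed t0 A => internalCost δ (cutOfSeed x δ t0 γ K v A σ))
  unfold bestSeedCost
  rw [← hσ]
  exact hB ⟨_, rfl⟩

end Measurability

/-! ### The law of the reported probabilities -/

section Coupling

variable {n d te : ℕ} {x : Fin n → Fin d → ℕ} {δ : Fin n → Fin n → ℝ} {t0 : ℕ} {D η γ : ℝ}
  {w : Fin n → ℝ}

theorem sampleProb_eq (G : Measure (Option (Fin n) × ℝ)) (i : Fin n) :
    sampleProb G i = G.fst.real {some i} := by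
  unfold sampleProb Measure.real
  rw [Measure.fst_apply (measurableSet_singleton _)]
  rfl

/-- Each point is sampled with positive probability, so its conditional law is absolutely continuous
with respect to `G` and inherits the almost sure bounds. -/
theorem IsGeometricSampler.ae_condLaw {G : Measure (Option (Fin n) × ℝ)}
    (hG : IsGeometricSampler δ D η G) (hq : ∀ i, 0 < distShare δ i) (hD : 0 < D)
    {κ : Option (Fin n) → Measure ℝ} (hκ : G = ∑ o, G.fst {o} • (κ o).map (Prod.mk o))
    (i : Fin n) :
    ∀ᵐ y ∂κ (some i), G.fst.real {some i} ≤ y ∧ y ≤ (1 + η) * G.fst.real {some i} := by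
  have hpos : 0 < G.fst.real {some i} := by
    rw [← sampleProb_eq]
    exact lt_of_lt_of_le (mul_pos (one_div_pos.2 hD) (hq i)) (hG.compatible i)
  have hne : G.fst {some i} ≠ 0 := fun h => hpos.ne' (by simp [Measure.real, h])
  have h1 : ∀ᵐ s ∂(κ (some i)).map (Prod.mk (some i)), ∀ i, s.1 = some i →
      sampleProb G i ≤ s.2 ∧ s.2 ≤ (1 + η) * sampleProb G i := by
    have h2 : (κ (some i)).map (Prod.mk (some i)) ≪ G := by
      refine (Measure.absolutelyContinuous_smul hne).trans
        (Measure.absolutelyContinuous_of_le ?_)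
      conv_rhs => rw [hκ]
      rw [Fintype.sum_eq_add_sum_compl (some i)]
      exact Measure.le_add_right le_rfl
    exact h2.ae_le hG.approx
  have h4 := ae_of_ae_map (by fun_prop) h1
  filter_upwards [h4] with y hy
  rw [← sampleProb_eq]
  exact hy i rfl

theorem keptRank_injective {K : Fin te → Bool} {r r' : Fin te} (h : K r = true) (h' : K r' = true)
    (heq : keptRank K r = keptRank K r') : r = r' := by
  rcases lt_trichotomy r r' with hlt | hlt | hlt
  · exact absurd heq (keptRank_lt_of_lt h' hlt).ne
  · exact hlt
  · exact absurd heq (keptRank_lt_of_lt h hlt).ne'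

/-- The reported probabilities of all (count, rank, point) triples are drawn in advance,
independently. The expectation becomes an average over this draw of the finite quantity in
`sum_finite_le`, which is bounded almost surely. -/
theorem corrExpectation_bestSeedCost_le {ε : ℝ} (hD : 1 ≤ D) (hη : 0 ≤ η) (hδ : IsFinMetric δ)
    (hx : Function.Injective x) (hW : 0 < totalDist δ) (hε : 0 < ε) (hε1 : ε < 1) (hη1 : η ≤ 1)
    (hηl : η * Real.log te ≤ ε) (hte : 2 ≤ te) (hγ : 0 < γ) (hnte : n * D ≤ ε * te)
    (hγε : D * Real.log te + 1 ≤ ε * Real.sqrt γ) (ht0 : Real.sqrt γ * D ≤ ε * t0)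
    (ht0' : 1 ≤ ε * t0) (hw : ∀ i, distShare δ i / (2 * D) ≤ w i) (hw1 : ∀ i, w i ≤ 1)
    {G : ℕ → ℕ → Measure (Option (Fin n) × ℝ)}
    (hG : ∀ s j, 1 ≤ j → j ≤ s → IsGeometricSampler δ D η (G s j)) :
    corrExpectation (te := te) t0 γ w G (fun K v A => bestSeedCost x δ t0 γ K v A) ≤
      minCost δ + 201 * ε * totalDist δ := by
  have hq : ∀ i, 0 < distShare δ i := fun i => hδ.distShare_pos hW i
  have hw0 : ∀ i, 0 ≤ w i := fun i =>
    (div_nonneg (hq i).le (by linarith)).trans (hw i)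
  have hκ : ∀ s j, ∃ κ : Option (Fin n) → Measure ℝ, (∀ o, IsProbabilityMeasure (κ o)) ∧
      (1 ≤ j → j ≤ s → G s j = ∑ o, (G s j).fst {o} • (κ o).map (Prod.mk o)) := by
    intro s j
    by_cases h : 1 ≤ j ∧ j ≤ s
    · have := (hG s j h.1 h.2).isProbabilityMeasure
      obtain ⟨κ, h1, h2⟩ := exists_condLaw (G s j)
      exact ⟨κ, h1, fun _ _ => h2⟩
    -- Nothing is assumed of `G s j` outside `1 ≤ j ≤ s`, and it is never used there, so any
    -- probability measure will do.
    · exact ⟨fun _ => Measure.dirac 0, fun _ => inferInstance, fun h1 h2 => absurd ⟨h1, h2⟩ h⟩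
  choose κ hκp hκG using hκ
  set ν : ℕ × ℕ × Option (Fin n) → Measure ℝ := fun j => κ j.1 j.2.1 j.2.2 with hν
  have : ∀ j, IsProbabilityMeasure (ν j) := fun j => hκp _ _ _
  set M := Measure.infinitePi ν with hM
  set P : ℕ → ℕ → Option (Fin n) → ℝ := fun s j o => (G s j).fst.real {o} with hP
  set φ : (ℕ × ℕ × Option (Fin n) → ℝ) → ℕ → ℕ → Option (Fin n) → ℝ :=
    fun ω s j o => ω (s, j, o) with hφ
  have hgood : ∀ᵐ ω ∂M, ∀ s j, 1 ≤ j → j ≤ s →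
      IsFiniteSampler (distShare δ) D η (P s j) (φ ω s j) := by
    have h1 : ∀ᵐ ω ∂M, ∀ s j i, 1 ≤ j → j ≤ s →
        P s j (some i) ≤ φ ω s j (some i) ∧ φ ω s j (some i) ≤ (1 + η) * P s j (some i) := by
      simp only [ae_all_iff]
      intro s j i hj hjs
      exact (measurePreserving_eval_infinitePi ν (s, j, some i)).quasiMeasurePreserving.ae
        ((hG s j hj hjs).ae_condLaw hq (by linarith) (hκG s j hj hjs) i)
    filter_upwards [h1] with ω hω s j hj hjs
    have := (hG s j hj hjs).isProbabilityMeasure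
    exact {
      nonneg := fun o => measureReal_nonneg
      sum_eq_one := by
        simp only [hP]
        rw [sum_measureReal_singleton, Finset.coe_univ, probReal_univ]
      le_prob := fun i => by
        have h := (hG s j hj hjs).compatible i
        rw [sampleProb_eq] at h
        rwa [div_eq_mul_one_div, mul_comm]
      prob_le := fun i => (hω s j i hj hjs).1
      le_mul := fun i => (hω s j i hj hjs).2 }
  have hmeas : ∀ (K : Fin te → Bool) (o : {r : Fin te // K r = true} → Option (Fin n)),
      Measurable fun ω => sampledCost x δ t0 γ w K (samplesOf (φ ω) K o) := by
    intro K o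
    refine measurable_sampledCost.comp (measurable_pi_iff.2 fun r => ?_)
    exact measurable_const.prodMk (measurable_pi_apply _)
  have hint : ∀ (K : Fin te → Bool) (o : {r : Fin te // K r = true} → Option (Fin n)),
      Integrable (fun ω => sampledCost x δ t0 γ w K (samplesOf (φ ω) K o)) M := by
    intro K o
    obtain ⟨B, hB⟩ := exists_abs_sampledCost_le x δ t0 γ K hw0 hw1
    refine Integrable.of_bound (hmeas K o).aestronglyMeasurable B ?_
    filter_upwards [hgood] with ω hω
    refine hB _ fun r i hr => ?_
    have h := hω _ _ (one_le_keptRank r.2) (keptRank_le_numKept K r.1)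
    simp only [samplesOf] at hr ⊢
    rw [hr]
    exact (h.nonneg _).trans (h.prob_le i)
  have hK : ∀ K : Fin te → Bool, ∫ v, sampledCost x δ t0 γ w K v ∂samplesLaw G K =
      ∑ o : {r : Fin te // K r = true} → Option (Fin n),
        (∏ r, P (numKept K) (keptRank K r.1) (o r)) *
          ∫ ω, sampledCost x δ t0 γ w K (samplesOf (φ ω) K o) ∂M := by
    intro K
    have hv : ∀ r : {r : Fin te // K r = true},
        IsProbabilityMeasure (G (numKept K) (keptRank K r.1)) := fun r =>
      (hG _ _ (one_le_keptRank r.2) (keptRank_le_numKept K r.1)).isProbabilityMeasure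
    have hd : ∀ r : {r : Fin te // K r = true}, G (numKept K) (keptRank K r.1) =
        ∑ o, (G (numKept K) (keptRank K r.1)).fst {o} •
          (ν (numKept K, keptRank K r.1, o)).map (Prod.mk o) := fun r =>
      hκG _ _ (one_le_keptRank r.2) (keptRank_le_numKept K r.1)
    refine integral_pi_eq_sum (ι := {r : Fin te // K r = true}) ν
      (fun r o => (numKept K, keptRank K r.1, o)) (fun o r r' h => ?_)
      (fun r => G (numKept K) (keptRank K r.1)) hd measurable_sampledCost (hint K)
    -- Different kept times have different ranks, hence read different coordinates even if the same
    -- point is sampled.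
    exact Subtype.ext (keptRank_injective r.2 r'.2 (Prod.mk.inj (Prod.mk.inj h).2).1)
  have hsum : corrExpectation (te := te) t0 γ w G (fun K v A => bestSeedCost x δ t0 γ K v A) =
      ∫ ω, ∑ K : Fin te → Bool, maskProb t0 γ K *
        ∑ o : {r : Fin te // K r = true} → Option (Fin n),
          (∏ r, P (numKept K) (keptRank K r.1) (o r)) *
            sampledCost x δ t0 γ w K (samplesOf (φ ω) K o) ∂M := by
    rw [integral_finsetSum _ fun K _ => (integrable_finsetSum _ fun o _ =>
      (hint K o).const_mul _).const_mul _]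
    refine Finset.sum_congr rfl fun K _ => ?_
    rw [integral_const_mul, integral_finsetSum _ fun o _ => (hint K o).const_mul _]
    congr 1
    refine (hK K).trans (Finset.sum_congr rfl fun o _ => ?_)
    rw [integral_const_mul]
  rw [hsum]
  refine (integral_mono_ae (integrable_finsetSum _ fun K _ => (integrable_finsetSum _ fun o _ =>
      (hint K o).const_mul _).const_mul _)
    (integrable_const (minCost δ + 201 * ε * totalDist δ)) ?_).trans (by simp)
  filter_upwards [hgood] with ω hω
  exact sum_finite_le hD hη hδ hx hW hε hε1 hη1 hηl hte hγ hnte hγε ht0 ht0' hw hw1 hω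

end Coupling

/-! ### The `ℓ_p` metrics -/

theorem isFinMetric_lpDist {n d : ℕ} {p : ℝ≥0∞} (hp : 1 ≤ p) (x : Fin n → Fin d → ℕ) :
    IsFinMetric fun i j => lpDist p (x i) (x j) := by
  have : Fact (1 ≤ p) := ⟨hp⟩
  exact ⟨fun _ _ => dist_nonneg, fun _ => dist_self _, fun _ _ => dist_comm _ _,
    fun _ _ _ => dist_triangle _ _ _⟩

theorem lpDist_pos {d : ℕ} {p : ℝ≥0∞} (hp : 1 ≤ p) {u v : Fin d → ℕ} (h : u ≠ v) :
    0 < lpDist p u v := by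
  have : Fact (1 ≤ p) := ⟨hp⟩
  refine dist_pos.2 fun heq => h (funext fun c => ?_)
  have := congrFun (WithLp.toLp_injective p heq) c
  exact_mod_cast this

theorem IsFinMetric.totalDist_pos {n : ℕ} {δ : Fin n → Fin n → ℝ} (hδ : IsFinMetric δ)
    {i j : Fin n} (h : 0 < δ i j) : 0 < totalDist δ :=
  Finset.sum_pos' (fun i _ => Finset.sum_nonneg fun j _ => hδ.nonneg i j)
    ⟨i, Finset.mem_univ _, Finset.sum_pos' (fun j _ => hδ.nonneg i j) ⟨j, Finset.mem_univ _, h⟩⟩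

end CorrelatedMaxCut

end

/-! ### The theorem: the parameter hypotheses in product form -/

theorem theorem7p4 :
    ∃ C : ℝ, 0 < C ∧
      ∀ (n d Δ : ℕ) (p : ℝ≥0∞), 2 ≤ n → 1 ≤ p →
      ∀ x : Fin n → Fin d → ℕ, Function.Injective x → (∀ i c, 1 ≤ x i c ∧ x i c ≤ Δ) →
      ∀ δ : Fin n → Fin n → ℝ, (δ = fun i j => CorrelatedMaxCut.lpDist p (x i) (x j)) →
      ∀ (D ε εpr γ : ℝ) (t0 te : ℕ),
        0 < ε → ε < 1 → 0 < εpr → εpr < 1 →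
        (n : ℝ) * D / ε ≤ te →
        (D * Real.log te + 1) ^ 2 / ε ^ 2 ≤ γ →
        max (Real.sqrt γ * D / ε) (1 / ε) ≤ t0 →
        εpr ≤ ε / Real.log te →
      ∀ wt : Fin n → ℝ, CorrelatedMaxCut.IsWeightSketch δ D wt →
      ∀ G : ℕ → ℕ → Measure (Option (Fin n) × ℝ),
        (∀ s j, 1 ≤ j → j ≤ s → CorrelatedMaxCut.IsGeometricSampler δ D εpr (G s j)) →
        CorrelatedMaxCut.corrExpectation (te := te) t0 γ (fun i => wt i / (2 * D)) G
            (fun K v A => CorrelatedMaxCut.bestSeedCost x δ t0 γ K v A)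
          ≤ CorrelatedMaxCut.minCost δ + C * ε * CorrelatedMaxCut.totalDist δ := by
  refine ⟨201, by norm_num, ?_⟩
  intro n d Δ p hn hp x hx _ δ hδx D ε εpr γ t0 te hε hε1 hη hη1 hnte hγ ht0 hηl wt hwt G hG
  have hδ : CorrelatedMaxCut.IsFinMetric δ := hδx ▸ CorrelatedMaxCut.isFinMetric_lpDist hp x
  have hne : x ⟨0, by omega⟩ ≠ x ⟨1, by omega⟩ := fun h => by simpa using hx h
  have hW : 0 < CorrelatedMaxCut.totalDist δ := by
    refine hδ.totalDist_pos (i := ⟨0, by omega⟩) (j := ⟨1, by omega⟩) ?_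
    rw [hδx]
    exact CorrelatedMaxCut.lpDist_pos hp hne
  have hq : ∀ i, 0 < CorrelatedMaxCut.distShare δ i := fun i => hδ.distShare_pos hW i
  have hqs : ∑ i, CorrelatedMaxCut.distShare δ i = 1 := CorrelatedMaxCut.sum_distShare hW.ne'
  have hq1 : ∀ i, CorrelatedMaxCut.distShare δ i ≤ 1 := fun i => by
    rw [← hqs]
    exact Finset.single_le_sum (fun j _ => (hq j).le) (Finset.mem_univ i)
  -- Forced by the sketch: `q ≤ D * q` with `q > 0`.
  have hD : 1 ≤ D := by
    have h := (hwt ⟨0, by omega⟩).1.trans (hwt ⟨0, by omega⟩).2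
    have h0 := hq ⟨0, by omega⟩
    by_contra hlt
    nlinarith
  have hD0 : 0 < D := by linarith
  have hn2 : (2 : ℝ) ≤ n := by exact_mod_cast hn
  rw [div_le_iff₀ hε] at hnte
  have hte : (2 : ℝ) ≤ te := by
    have hte0 : (0 : ℝ) ≤ te := Nat.cast_nonneg _
    nlinarith
  have hlog : 0 < Real.log te := Real.log_pos (by linarith)
  have hpos : 0 < D * Real.log te + 1 := by positivity
  have hγ0 : 0 < γ := lt_of_lt_of_le (by positivity) hγ
  have hsqrt : (D * Real.log te + 1) / ε ≤ Real.sqrt γ := by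
    rw [← div_pow] at hγ
    exact Real.le_sqrt_of_sq_le hγ
  rw [max_le_iff, div_le_iff₀ hε, div_le_iff₀ hε] at ht0
  rw [div_le_iff₀ hε] at hsqrt
  rw [le_div_iff₀ hlog] at hηl
  refine CorrelatedMaxCut.corrExpectation_bestSeedCost_le hD hη.le hδ hx hW hε hε1 hη1.le hηl
    (by exact_mod_cast hte) hγ0 (by linarith) (by linarith) (by linarith [ht0.1])
    (by linarith [ht0.2]) (fun i => ?_) (fun i => ?_) hG
  · exact div_le_div_of_nonneg_right (hwt i).1 (by linarith)
  · rw [div_le_one (by linarith)]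
    nlinarith [(hwt i).2, hq1 i, hq i]
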